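/- Let $\Sigma=\{1,\dots,\sigma\}$. For $S\in\Sigma^n$ let $\mathsf{cyc}(S)=S[2]\cdots S[n]S[1]$ be the cyclic shift by one position to the left; $\mathsf{cyc}^m$ is defined for all $m\in\mathbb Z$. Let $\mathsf{Ham}(S,T)$ be the number of positions in which $S,T\in\Sigma^n$ differ. A \emph{sketch} for $\Sigma^n$ is a pair of randomized functions $\mathtt{sk}:\Sigma^n\to\{0,1\}^*$ and $\mathtt{dec}:\{0,1\}^*\times\{0,1\}^*\times\mathbb Z\to\mathbb R$ on a common probability space (public randomness); both may depend on the parameters $\sigma,n,k,\varepsilon$. \textbf{Theorem.} There are absolute constants $c>0$, $C>0$ and $D\in\mathbb N$ such that for all integers $\sigma\ge 0$ and $1\le k\le n$ and every real $\varepsilon>0$ there is a sketch $(\mathtt{sk},\mathtt{dec})$ for $\Sigma^n$ with the following properties. (1) ($(1\pm\varepsilon)$-approximate circular $k$-mismatch sketch.) For every $S_1,S_2\in\Sigma^n$ and $m\in\mathbb Z$, with probability at least $1-n^{-c}$: writing $H=\mathsf{Ham}(S_1,\mathsf{cyc}^m(S_2))$, - if $H\le k$, then $(1-\varepsilon)H\le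 \mathtt{dec}(\mathtt{sk}(S_1),\mathtt{sk}(S_2),m)\le(1+\varepsilon)H$; - if $H>k$, then $\mathtt{dec}(\mathtt{sk}(S_1),\mathtt{sk}(S_2),m)>(1-\varepsilon)k$. (2) (Size $\tilde O(\min(\varepsilon^{-2}\sqrt k,\varepsilon^{-1.5}\sqrt n))$.) For every $S\in\Sigma^n$, with probability at least $1-n^{-c}$, $$|\mathtt{sk}(S)|\le C\,(\log n)^{D}\,\min\bigl(\varepsilon^{-2}\sqrt k,\ \varepsilon^{-1.5}\sqrt n\bigr).$$ -/

import Mathlib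

open MeasureTheory

/-- Strings of length `n` over the alphabet with `σ` letters (positions are numbered from `0`). -/
abbrev Str (σ n : ℕ) : Type := Fin n → Fin σ

/-- The cyclic shift by one position to the left, `S[0]S[1]⋯S[n-1] ↦ S[1]⋯S[n-1]S[0]`, as a
permutation of the set of strings, so that `cyc ^ m` makes sense for every integer `m`. -/
def cyc {σ n : ℕ} : Equiv.Perm (Str σ n) where
  toFun S i := S (finRotate n i)
  invFun S i := S ((finRotate n).symm i)
  left_inv S := funext fun i => congrArg S ((finRotate n).apply_symm_apply i)
  right_inv S := funext fun i => congrArg S ((finRotate n).symm_apply_apply i)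

/-- A pair of randomized functions `sk : Σⁿ → {0,1}*` and `dec : {0,1}* × {0,1}* × ℤ → ℝ`, i.e. a
random variable, on some probability space (the public randomness), whose values are pairs of
functions. The two encoders and the decoder see the same outcome `ω`. -/
structure CircularSketch (σ n : ℕ) where
  Ω : Type
  mΩ : MeasurableSpace Ω
  P : Measure Ω
  isProb : IsProbabilityMeasure P
  sk : Ω → Str σ n → List Bool
  dec : Ω → List Bool → List Bool → ℤ → ℝ
  measurableSet_sk : ∀ (S : Str σ n) (x : List Bool), MeasurableSet {ω | sk ω S = x}
  measurable_dec : ∀ (x y : List Bool) (m : ℤ), Measurable fun ω => dec ω x y m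

namespace CircularSketch

variable {σ n : ℕ}

/-- The decoder's answer for the strings `S₁`, `S₂` and the shift `m`, as a random variable. -/
def answer (K : CircularSketch σ n) (S₁ S₂ : Str σ n) (m : ℤ) (ω : K.Ω) : ℝ :=
  K.dec ω (K.sk ω S₁) (K.sk ω S₂) m

/-- The `(1 ± ε)`-approximate circular `k`-mismatch guarantee, with probability at least `p` for
each choice of two strings and a shift. -/
def IsApprox (K : CircularSketch σ n) (ε : ℝ) (k : ℕ) (p : ℝ) : Prop :=
  ∀ (S₁ S₂ : Str σ n) (m : ℤ),
    p ≤ (K.P {ω |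
      (hammingDist S₁ ((cyc ^ m) S₂) ≤ k →
        K.answer S₁ S₂ m ω ∈ Set.Icc ((1 - ε) * (hammingDist S₁ ((cyc ^ m) S₂) : ℝ))
          ((1 + ε) * (hammingDist S₁ ((cyc ^ m) S₂) : ℝ))) ∧
      (k < hammingDist S₁ ((cyc ^ m) S₂) →
        (1 - ε) * (k : ℝ) < K.answer S₁ S₂ m ω)}).toReal

/-- The sketch has size `s`: for each string the sketch has at most `s` bits, with probability at
least `p`. -/
def HasSize (K : CircularSketch σ n) (s p : ℝ) : Prop :=
  ∀ S : Str σ n, p ≤ (K.P {ω | ((K.sk ω S).length : ℝ) ≤ s}).toReal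

end CircularSketch

/-!
A string is read as a function on the circle `ZMod n`. Two strings and a shift `m` define the set
`mism` of mismatches, whose size `H` has to be estimated from the two messages. The decoder knows `m`,
but the messages must not depend on it, so a message can only describe what its own string looks like
in places that are fixed in advance.

The square root in the size comes from sampling. Cut the circle into cells of equal length and let
each string report on a random set of cells, chosen with rate `1 / P`, independently for the two
strings. A point `u` is seen by the decoder if the cell of `u` is kept for `S₁` and the cell of its
image under the shift is kept for `S₂`, which happens with probability `1 / P ^ 2` for every shift. Any
local quantity `X u ∈ [0, 1]` that both reports together determine can thus be summed over the circle
without bias (`sampleSum`). Only points that share a cell are correlated, so that the variance is at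
most `P ^ 2` times the cell length times the sum (`avg_sampleSum_sq_le`), and rates of order
`1 / sqrt H` suffice for a constant relative error. `LocalScheme.sample` is this construction.

Local quantities can count mismatches only if these are not clustered. Therefore the circle is first
multiplied by a random unit of `ZMod n`. A nonzero difference `d` is moved to distance at most `r` of
`0` with probability `O(r log n / n)`: its dilates are multiples of `gcd(d, n)`, and their number is
`φ(n / gcd(d, n))` (`pr_cabs_dilate_le`). So few pairs of mismatches are close together after the
dilation (`avg_collisions_le`). Shifts turn into shifts, by the dilated amount.

There are two local schemes, both used at the scales `κ = 2 ^ i`.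

* The gap test (`exists_gap_test`) tells `H ≤ κ` from `H ≥ κ * polylog n`. Its local question is
  whether two windows agree up to a small relative displacement, which is known to the decoder but not
  to the strings. Each string reports an anchor, which is the place near the start of the cell whose
  word of length `ℓ` has the least hash value, the hash value itself, and the least period of that
  word. If the windows agree then the same word is chosen in both unless the minimum lies close to the
  ends of the range, which a random range makes unlikely (`sum_one_sub_div_le`,
  `pr_not_min_mem_le`); the word may occur several times, but then the occurrences differ by multiples
  of its least period (`leastPeriod_dvd`, `anchors_agree`). Conversely, equal words at positions that
  match up to a period force the windows to agree (`eq_of_word_eq`).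

* The estimator (`exists_estimator`) approximates `H` with relative error `e` once `H` is known to be
  of order `κ` up to logarithms. The letters are replaced by random signs, and the string reports on
  each cell a Gaussian average of its signs. The difference of the averages of the two strings only
  sees mismatches, because everything else cancels, and it is the Gaussian weight of the mismatch if
  there is only one nearby (`abs_min_norm_sub_sum_le`). The displacement inside the cell is again known
  only to the decoder; the string therefore reports `O(log n)` Taylor coefficients of the average as a
  function of its centre, which determine it everywhere in the cell (`abs_reading_sub_signSum_le`).
  Up to logarithms, cells have length `e * n / κ`, so that collisions cost a relative error of at most
  `e`, and the sampling rate is `1 / (e * sqrt κ)`, so that the number of kept cells is at most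
  `n / (e * sqrt κ)` and at most `sqrt κ / e ^ 2`.

The answer is the estimate at the least scale at which the gap test says that `H` is small, or `k` if
there is none up to `k` (`selectScale_spec`). The sum of the sizes over the scales is at most
`sqrt k / e ^ 2`, and also at most the geometric mean `sqrt n / e ^ (3 / 2)` of the two bounds, up to
logarithms. The median of `O(log n)` independent runs fails with probability at most `1 / n`
(`Protocol.amplify`). If `ε < 1 / n` then it is enough to run the protocol with error about `1 / n` and
to round the estimate, because `H ≤ n`.
-/

/-! ### Averages over finite sample spaces -/

/-- The expectation of `f` under the uniform distribution on the finite type `Ω`. -/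
noncomputable def avg {Ω : Type*} [Fintype Ω] (f : Ω → ℝ) : ℝ := (∑ ω, f ω) / Fintype.card Ω

open Classical in
/-- The probability of the event `p` under the uniform distribution on the finite type `Ω`. -/
noncomputable def pr {Ω : Type*} [Fintype Ω] (p : Ω → Prop) : ℝ :=
  avg fun ω => if p ω then (1 : ℝ) else 0

section Avg

variable {Ω Ω' : Type*} [Fintype Ω] [Fintype Ω']

lemma avg_mono {f g : Ω → ℝ} (h : ∀ ω, f ω ≤ g ω) : avg f ≤ avg g := by
  unfold avg
  exact div_le_div_of_nonneg_right (Finset.sum_le_sum fun ω _ => h ω) (Nat.cast_nonneg _)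

lemma avg_nonneg {f : Ω → ℝ} (h : ∀ ω, 0 ≤ f ω) : 0 ≤ avg f :=
  div_nonneg (Finset.sum_nonneg fun ω _ => h ω) (Nat.cast_nonneg _)

lemma avg_add (f g : Ω → ℝ) : avg (fun ω => f ω + g ω) = avg f + avg g := by
  simp only [avg, Finset.sum_add_distrib, add_div]

lemma avg_const_mul (c : ℝ) (f : Ω → ℝ) : avg (fun ω => c * f ω) = c * avg f := by
  simp only [avg, ← Finset.mul_sum, mul_div_assoc]

lemma avg_const [Nonempty Ω] (c : ℝ) : avg (fun _ : Ω => c) = c := by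
  simp [avg]

lemma avg_sum {ι : Type*} (s : Finset ι) (f : ι → Ω → ℝ) :
    avg (fun ω => ∑ i ∈ s, f i ω) = ∑ i ∈ s, avg (f i) := by
  simp only [avg]
  rw [Finset.sum_comm, Finset.sum_div]

lemma avg_prod (f : Ω × Ω' → ℝ) : avg f = avg fun ω => avg fun ω' => f (ω, ω') := by
  simp only [avg, Fintype.sum_prod_type, Fintype.card_prod, Nat.cast_mul, ← Finset.sum_div]
  rw [div_div, mul_comm]

lemma avg_prod_swap (f : Ω × Ω' → ℝ) : avg f = avg fun ω' => avg fun ω => f (ω, ω') := by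
  simp only [avg, Fintype.sum_prod_type_right, Fintype.card_prod, Nat.cast_mul, ← Finset.sum_div]
  rw [div_div]

lemma avg_prod_fst [Nonempty Ω'] (f : Ω → ℝ) : avg (fun ω : Ω × Ω' => f ω.1) = avg f := by
  rw [avg_prod]
  simp only [avg_const]

lemma avg_prod_snd [Nonempty Ω] (f : Ω' → ℝ) : avg (fun ω : Ω × Ω' => f ω.2) = avg f := by
  rw [avg_prod]
  simp only [avg_const]

lemma avg_prod_mul (f : Ω → ℝ) (g : Ω' → ℝ) :
    avg (fun ω : Ω × Ω' => f ω.1 * g ω.2) = avg f * avg g := by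
  rw [avg_prod]
  simp only [avg_const_mul]
  simp only [mul_comm _ (avg g), avg_const_mul]

lemma pr_mono {p q : Ω → Prop} (h : ∀ ω, p ω → q ω) : pr p ≤ pr q := by
  classical
  refine avg_mono fun ω => ?_
  by_cases hp : p ω
  · simp [hp, h ω hp]
  · simp only [hp, if_false]
    split_ifs <;> norm_num

lemma pr_nonneg (p : Ω → Prop) : 0 ≤ pr p :=
  avg_nonneg fun ω => by split_ifs <;> norm_num

lemma pr_le_one (p : Ω → Prop) : pr p ≤ 1 := by
  unfold pr avg
  refine div_le_one_of_le₀ ?_ (Nat.cast_nonneg _)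
  refine (Finset.sum_le_sum (g := fun _ => (1 : ℝ)) fun ω _ => ?_).trans (by simp)
  split_ifs <;> norm_num

lemma pr_or_le (p q : Ω → Prop) : pr (fun ω => p ω ∨ q ω) ≤ pr p + pr q := by
  classical
  unfold pr
  rw [← avg_add]
  refine avg_mono fun ω => ?_
  by_cases hp : p ω <;> by_cases hq : q ω <;> simp [hp, hq]

lemma pr_eq_zero {p : Ω → Prop} (h : ∀ ω, ¬ p ω) : pr p = 0 := by
  simp [pr, avg, h]

lemma pr_exists_le {ι : Type*} (s : Finset ι) (p : ι → Ω → Prop) :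
    pr (fun ω => ∃ i ∈ s, p i ω) ≤ ∑ i ∈ s, pr (p i) := by
  classical
  unfold pr
  rw [← avg_sum]
  refine avg_mono fun ω => ?_
  split_ifs with h
  · obtain ⟨i, hi, hp⟩ := h
    refine le_trans ?_ (Finset.single_le_sum (f := fun i => if p i ω then (1 : ℝ) else 0)
      (fun j _ => by positivity) hi)
    simp [hp]
  · exact Finset.sum_nonneg fun j _ => by positivity

lemma pr_not [Nonempty Ω] (p : Ω → Prop) : pr (fun ω => ¬ p ω) = 1 - pr p := by
  classical
  have h : pr p + pr (fun ω => ¬ p ω) = 1 := by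
    unfold pr
    rw [← avg_add]
    refine Eq.trans ?_ (avg_const (Ω := Ω) 1)
    congr 1
    funext ω
    by_cases hp : p ω <;> simp [hp]
  linarith

/-- Markov's inequality. -/
lemma pr_le_avg_div {f : Ω → ℝ} (hf : ∀ ω, 0 ≤ f ω) {t : ℝ} (ht : 0 < t) :
    pr (fun ω => t ≤ f ω) ≤ avg f / t := by
  classical
  rw [le_div_iff₀ ht, mul_comm]
  unfold pr
  rw [← avg_const_mul]
  refine avg_mono fun ω => ?_
  split_ifs with h
  · simpa using h
  · simpa using hf ω

lemma pr_prod_fst [Nonempty Ω'] (p : Ω → Prop) : pr (fun ω : Ω × Ω' => p ω.1) = pr p := by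
  classical
  exact avg_prod_fst fun ω => if p ω then (1 : ℝ) else 0

lemma pr_prod_snd [Nonempty Ω] (p : Ω' → Prop) : pr (fun ω : Ω × Ω' => p ω.2) = pr p := by
  classical
  exact avg_prod_snd fun ω => if p ω then (1 : ℝ) else 0

/-- Conditioning on the first coordinate: the bad event has small probability given any good value
of the first coordinate. -/
lemma pr_prod_le [Nonempty Ω] [Nonempty Ω'] {p : Ω × Ω' → Prop} {good : Ω → Prop} {q₀ q : ℝ}
    (hq : 0 ≤ q) (h₀ : pr (fun ω => ¬ good ω) ≤ q₀)
    (h : ∀ ω, good ω → pr (fun ω' => p (ω, ω')) ≤ q) : pr p ≤ q₀ + q := by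
  classical
  have h1 : pr p ≤ pr (fun ω => ¬ good ω) + q := by
    rw [show pr p = avg fun ω => pr fun ω' => p (ω, ω') from avg_prod _]
    rw [← avg_const (Ω := Ω) q, show pr (fun ω => ¬ good ω) = avg _ from rfl, ← avg_add]
    refine avg_mono fun ω => ?_
    by_cases hg : good ω
    · simpa [hg, avg_const] using h ω hg
    · simp only [hg, not_false_eq_true, if_true]
      have := pr_le_one (fun ω' => p (ω, ω'))
      linarith
  linarith

/-- Independence of the coordinates of a uniform point of a product. -/
lemma avg_pi_prod {ι : Type*} [Fintype ι] [DecidableEq ι] {X : ι → Type*} [∀ i, Fintype (X i)]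
    (g : ∀ i, X i → ℝ) : avg (fun f : ∀ i, X i => ∏ i, g i (f i)) = ∏ i, avg (g i) := by
  unfold avg
  rw [Finset.prod_div_distrib, Fintype.card_pi, Finset.prod_univ_sum, Fintype.piFinset_univ]
  push_cast
  rfl

lemma avg_pi_eval {ι : Type*} [Fintype ι] [DecidableEq ι] {X : ι → Type*} [∀ i, Fintype (X i)]
    [∀ i, Nonempty (X i)] (i : ι) (g : X i → ℝ) :
    avg (fun f : ∀ i, X i => g (f i)) = avg g := by
  classical
  have key := avg_pi_prod (X := X) (fun j => if h : j = i then fun x => g (h ▸ x) else fun _ => 1)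
  rw [Finset.prod_eq_single i] at key
  · simp only [dite_true] at key
    rw [← key]
    congr 1
    funext f
    rw [Finset.prod_eq_single i]
    · simp
    · intro j _ hj
      simp [hj]
    · simp
  · intro j _ hj
    simp only [hj, dite_false]
    exact avg_const 1
  · simp

lemma pr_pi_eval {ι : Type*} [Fintype ι] [DecidableEq ι] {X : ι → Type*} [∀ i, Fintype (X i)]
    [∀ i, Nonempty (X i)] (i : ι) (p : X i → Prop) :
    pr (fun f : ∀ i, X i => p (f i)) = pr p := by
  classical
  exact avg_pi_eval i fun x => if p x then (1 : ℝ) else 0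

/-- The probability that all coordinates from `T` satisfy `p`. -/
lemma pr_pi_forall {ι X : Type*} [Fintype ι] [DecidableEq ι] [Fintype X] [Nonempty X]
    (T : Finset ι) (p : X → Prop) :
    pr (fun f : ι → X => ∀ i ∈ T, p (f i)) = pr p ^ T.card := by
  classical
  have key := avg_pi_prod (X := fun _ : ι => X)
    (fun i x => if i ∈ T then (if p x then (1 : ℝ) else 0) else 1)
  have h1 : ∀ i, avg (fun x => if i ∈ T then (if p x then (1 : ℝ) else 0) else 1)
      = if i ∈ T then pr p else 1 := by
    intro i
    by_cases hi : i ∈ T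
    · simp only [hi, if_true]; rfl
    · simp only [hi, if_false]; exact avg_const 1
  simp only [h1, Finset.prod_ite_mem, Finset.univ_inter, Finset.prod_const] at key
  rw [← key]
  unfold pr
  congr 1
  funext f
  by_cases h : ∀ i ∈ T, p (f i)
  · rw [if_pos h, Finset.prod_eq_one]
    intro i hi
    simp [h i hi]
  · rw [if_neg h]
    push Not at h
    obtain ⟨i, hi, hp⟩ := h
    exact (Finset.prod_eq_zero hi (by simp [hp])).symm

lemma pr_fin_eq_zero {P : ℕ} (hP : 0 < P) : pr (fun x : Fin P => (x : ℕ) = 0) = 1 / P := by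
  classical
  have : NeZero P := ⟨hP.ne'⟩
  unfold pr avg
  rw [Fintype.card_fin]
  congr 1
  rw [Finset.sum_eq_single (0 : Fin P)]
  · simp
  · intro b _ hb
    have : (b : ℕ) ≠ 0 := fun h => hb (Fin.ext (by simpa using h))
    simp [this]
  · simp

/-- Two distinct coordinates of a uniform function agree with probability one over the number of
values. -/
lemma pr_pi_eq {ι X : Type*} [Fintype ι] [DecidableEq ι] [Fintype X] [Nonempty X]
    {i j : ι} (hij : i ≠ j) :
    pr (fun f : ι → X => f i = f j) = 1 / Fintype.card X := by
  classical
  have hsum : ∀ f : ι → X, (if f i = f j then (1 : ℝ) else 0)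
      = ∑ v : X, if (∀ k ∈ ({i, j} : Finset ι), f k = v) then (1 : ℝ) else 0 := by
    intro f
    by_cases h : f i = f j
    · rw [if_pos h, Finset.sum_eq_single (f i)]
      · simp [h]
      · intro v _ hv
        rw [if_neg]
        intro hc
        exact hv (hc i (by simp)).symm
      · simp
    · rw [if_neg h, Finset.sum_eq_zero]
      intro v _
      rw [if_neg]
      intro hc
      exact h ((hc i (by simp)).trans (hc j (by simp)).symm)
  have hv : ∀ v : X, pr (fun x : X => x = v) = 1 / Fintype.card X := by
    intro v
    simp [pr, avg]
  have hcard : (0 : ℝ) < Fintype.card X := by exact_mod_cast Fintype.card_pos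
  unfold pr
  simp only [hsum]
  rw [avg_sum]
  have : ∀ v : X, avg (fun f : ι → X =>
      if (∀ k ∈ ({i, j} : Finset ι), f k = v) then (1 : ℝ) else 0)
      = (1 / Fintype.card X) ^ 2 := by
    intro v
    have := pr_pi_forall (X := X) ({i, j} : Finset ι) (fun x => x = v)
    rw [hv, Finset.card_pair hij] at this
    rw [← this]
    unfold pr
    congr 1
    funext f
    split_ifs <;> rfl
  rw [Finset.sum_congr rfl fun v _ => this v]
  simp only [Finset.sum_const, Finset.card_univ, nsmul_eq_mul]
  field_simp

end Avg

/-! ### Protocols with finite randomness -/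

/-- A sketch with finitely many equally likely outcomes of the public randomness, for strings indexed
by `ZMod n`. The messages range over a finite type that may depend on the randomness; the decoder
gets the shift modulo `n`. -/
structure Protocol (n : ℕ) (Γ : Type) where
  Ω : Type
  fin : Fintype Ω
  ne : Nonempty Ω
  Msg : Ω → Type
  finMsg : ∀ ω, Fintype (Msg ω)
  msg : (ω : Ω) → (ZMod n → Γ) → Msg ω
  dec : (ω : Ω) → Msg ω → Msg ω → ZMod n → ℝ

attribute [instance] Protocol.fin Protocol.ne Protocol.finMsg

open Classical in
/-- The positions at which `S₁` differs from the shift of `S₂` by `m`. -/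
noncomputable def mism {n : ℕ} [NeZero n] {Γ : Type} (S₁ S₂ : ZMod n → Γ) (m : ZMod n) :
    Finset (ZMod n) :=
  Finset.univ.filter fun x => S₁ x ≠ S₂ (x + m)

lemma mem_mism {n : ℕ} [NeZero n] {Γ : Type} {S₁ S₂ : ZMod n → Γ} {m x : ZMod n} :
    x ∈ mism S₁ S₂ m ↔ S₁ x ≠ S₂ (x + m) := by
  simp [mism]

lemma card_mism_le {n : ℕ} [NeZero n] {Γ : Type} (S₁ S₂ : ZMod n → Γ) (m : ZMod n) :
    (mism S₁ S₂ m).card ≤ n := by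
  have := Finset.card_le_univ (mism S₁ S₂ m)
  rwa [ZMod.card] at this

namespace Protocol

variable {n : ℕ} [NeZero n] {Γ : Type}

/-- The decoder's answer, as a random variable. -/
def out (P : Protocol n Γ) (S₁ S₂ : ZMod n → Γ) (m : ZMod n) (ω : P.Ω) : ℝ :=
  P.dec ω (P.msg ω S₁) (P.msg ω S₂) m

/-- Every message can be written with `b` bits. -/
def HasBits (P : Protocol n Γ) (b : ℕ) : Prop := ∀ ω, Fintype.card (P.Msg ω) ≤ 2 ^ b

/-- For every input, the answer is acceptable for the true Hamming distance except with probability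
at most `q`. -/
def Solves (P : Protocol n Γ) (Good : ℕ → Set ℝ) (q : ℝ) : Prop :=
  ∀ (S₁ S₂ : ZMod n → Γ) (m : ZMod n),
    pr (fun ω => P.out S₁ S₂ m ω ∉ Good (mism S₁ S₂ m).card) ≤ q

/-- Run a finite family of protocols independently and combine their answers. For a family with one
member this is a function of its answer. -/
def combine {ι : Type} [Fintype ι] [DecidableEq ι] (P : ι → Protocol n Γ) (g : (ι → ℝ) → ℝ) :
    Protocol n Γ where
  Ω := ∀ i, (P i).Ω
  fin := inferInstance
  ne := inferInstance
  Msg ω := ∀ i, (P i).Msg (ω i)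
  finMsg _ := inferInstance
  msg ω S i := (P i).msg (ω i) S
  dec ω x y m := g fun i => (P i).dec (ω i) (x i) (y i) m

omit [NeZero n] in
lemma combine_hasBits {ι : Type} [Fintype ι] [DecidableEq ι] {P : ι → Protocol n Γ}
    (g : (ι → ℝ) → ℝ) {b : ι → ℕ} (h : ∀ i, (P i).HasBits (b i)) :
    (combine P g).HasBits (∑ i, b i) := by
  intro ω
  let ω' : ∀ i, (P i).Ω := ω
  change Fintype.card (∀ i, (P i).Msg (ω' i)) ≤ _
  rw [Fintype.card_pi, ← Finset.prod_pow_eq_pow_sum]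
  exact Finset.prod_le_prod' fun i _ => h i (ω' i)

/-- The union bound: unless one of the protocols fails, all their answers are acceptable together. -/
lemma combine_solves {ι : Type} [Fintype ι] [DecidableEq ι] {P : ι → Protocol n Γ}
    {g : (ι → ℝ) → ℝ} {Good : ι → ℕ → Set ℝ} {Good' : ℕ → Set ℝ} {q : ι → ℝ}
    (h : ∀ i, (P i).Solves (Good i) (q i))
    (hg : ∀ H ≤ n, ∀ x : ι → ℝ, (∀ i, x i ∈ Good i H) → g x ∈ Good' H) :
    (combine P g).Solves Good' (∑ i, q i) := by
  intro S₁ S₂ m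
  have h1 : ∀ i, pr (fun ω : ∀ i, (P i).Ω => (P i).out S₁ S₂ m (ω i) ∉
      Good i (mism S₁ S₂ m).card) ≤ q i := by
    intro i
    exact (pr_pi_eval (X := fun i => (P i).Ω) i fun w =>
      (P i).out S₁ S₂ m w ∉ Good i (mism S₁ S₂ m).card).trans_le (h i S₁ S₂ m)
  refine le_trans (pr_mono fun ω hω => ?_) ((pr_exists_le (Ω := ∀ i, (P i).Ω) Finset.univ
    fun i ω => (P i).out S₁ S₂ m (ω i) ∉ Good i (mism S₁ S₂ m).card).trans
    (Finset.sum_le_sum fun i _ => h1 i))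
  by_contra hc
  push Not at hc
  exact hω (hg _ (card_mism_le S₁ S₂ m) _ fun i => hc i (Finset.mem_univ i))

end Protocol

/-! ### Amplification by the median -/

/-- The least `x i` such that at least half of the numbers are at most `x i`. -/
lemma exists_median {R : ℕ} (hR : 0 < R) (x : Fin R → ℝ) :
    ∃ y, R ≤ 2 * (Finset.univ.filter fun i => x i ≤ y).card ∧
      R ≤ 2 * (Finset.univ.filter fun i => y ≤ x i).card := by
  classical
  have : Nonempty (Fin R) := ⟨⟨0, hR⟩⟩
  let s := Finset.univ.filter fun i : Fin R => R ≤ 2 * (Finset.univ.filter fun j => x j ≤ x i).card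
  have hs : s.Nonempty := by
    obtain ⟨i, hi⟩ := Finite.exists_max x
    refine ⟨i, Finset.mem_filter.2 ⟨Finset.mem_univ _, ?_⟩⟩
    rw [Finset.filter_true_of_mem fun j _ => hi j]
    simp; omega
  obtain ⟨i, his, hi⟩ := s.exists_min_image x hs
  refine ⟨x i, (Finset.mem_filter.1 his).2, ?_⟩
  have hsplit := Finset.card_filter_add_card_filter_not (s := (Finset.univ : Finset (Fin R)))
    (fun j => x i ≤ x j)
  simp only [Finset.card_univ, Fintype.card_fin, not_le] at hsplit
  have hlt : 2 * (Finset.univ.filter fun j => x j < x i).card ≤ R := by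
    rcases (Finset.univ.filter fun j => x j < x i).eq_empty_or_nonempty with h0 | hne
    · simp [h0]
    · obtain ⟨j, hj, hjm⟩ := Finset.exists_max_image _ x hne
      have hji := (Finset.mem_filter.1 hj).2
      have hjs : j ∉ s := fun hjs => absurd (hi j hjs) (not_le.2 hji)
      have hlt' : ¬ R ≤ 2 * (Finset.univ.filter fun l => x l ≤ x j).card := fun h =>
        hjs (Finset.mem_filter.2 ⟨Finset.mem_univ _, h⟩)
      have hsub : (Finset.univ.filter fun l => x l < x i) ⊆
          Finset.univ.filter fun l => x l ≤ x j := fun l hl =>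
        Finset.mem_filter.2 ⟨Finset.mem_univ _, hjm l hl⟩
      have := Finset.card_le_card hsub
      omega
  omega

open Classical in
/-- A median of finitely many reals (`0` for the empty family). -/
noncomputable def median {R : ℕ} (x : Fin R → ℝ) : ℝ :=
  if h : 0 < R then (exists_median h x).choose else 0

/-- If the median misses an interval then at least half of the numbers miss it. -/
lemma exists_half_notMem_of_median_notMem {R : ℕ} (hR : 0 < R) {x : Fin R → ℝ} {I : Set ℝ}
    (hI : I.OrdConnected) (h : median x ∉ I) :
    ∃ T : Finset (Fin R), R ≤ 2 * T.card ∧ ∀ i ∈ T, x i ∉ I := by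
  classical
  rw [median, dif_pos hR] at h
  obtain ⟨h1, h2⟩ := (exists_median hR x).choose_spec
  set y := (exists_median hR x).choose
  by_cases hlow : ∃ i, x i ≤ y ∧ x i ∈ I
  · obtain ⟨i, hiy, hiI⟩ := hlow
    refine ⟨_, h2, fun j hj hjI => h ?_⟩
    exact hI.out hiI hjI ⟨hiy, (Finset.mem_filter.1 hj).2⟩
  · push Not at hlow
    exact ⟨_, h1, fun j hj => hlow j (Finset.mem_filter.1 hj).2⟩

namespace Protocol

variable {n : ℕ} [NeZero n] {Γ : Type}

/-- The median of `R` independent runs fails only if half of the runs fail; there are at most `2 ^ R`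
sets of failing runs, each of probability at most `(1 / 16) ^ (R / 2)`. -/
lemma amplify {P : Protocol n Γ} {Good : ℕ → Set ℝ} (hP : P.Solves Good (1 / 16))
    (hG : ∀ H, (Good H).OrdConnected) {R : ℕ} (hR : 0 < R) :
    (combine (fun _ : Fin R => P) median).Solves Good ((1 / 2) ^ R) := by
  classical
  intro S₁ S₂ m
  set bad : P.Ω → Prop := fun ω => P.out S₁ S₂ m ω ∉ Good (mism S₁ S₂ m).card with hbad
  have hq : pr bad ≤ 1 / 16 := hP S₁ S₂ m
  have hq0 := pr_nonneg bad
  set F := (Finset.univ : Finset (Finset (Fin R))).filter fun T => R ≤ 2 * T.card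
  have h1 : pr (fun ω : Fin R → P.Ω => ∃ T ∈ F, ∀ i ∈ T, bad (ω i)) ≤ ∑ T ∈ F, pr bad ^ T.card := by
    refine (pr_exists_le F _).trans (le_of_eq (Finset.sum_congr rfl fun T _ => ?_))
    exact pr_pi_forall T bad
  have h2 : ∀ T ∈ F, pr bad ^ T.card ≤ (1 / 4) ^ R := by
    intro T hT
    have hT' := (Finset.mem_filter.1 hT).2
    calc pr bad ^ T.card ≤ (1 / 16) ^ T.card := pow_le_pow_left₀ hq0 hq _
      _ = (1 / 4) ^ (2 * T.card) := by rw [pow_mul]; norm_num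
      _ ≤ (1 / 4) ^ R := pow_le_pow_of_le_one (by norm_num) (by norm_num) hT'
  refine le_trans (pr_mono fun ω hω => ?_) (h1.trans ((Finset.sum_le_sum h2).trans ?_))
  · -- the acceptable answers form an interval, so a bad median means that half of the runs are bad
    obtain ⟨T, hT, hTb⟩ := exists_half_notMem_of_median_notMem hR (hG _) hω
    exact ⟨T, Finset.mem_filter.2 ⟨Finset.mem_univ _, hT⟩, hTb⟩
  · rw [Finset.sum_const, nsmul_eq_mul]
    have hF : (F.card : ℝ) ≤ 2 ^ R := by
      have := Finset.card_le_univ F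
      rw [Fintype.card_finset, Fintype.card_fin] at this
      exact_mod_cast this
    calc (F.card : ℝ) * (1 / 4) ^ R ≤ 2 ^ R * (1 / 4) ^ R := by gcongr
      _ = (1 / 2) ^ R := by rw [← mul_pow]; norm_num

end Protocol

/-! ### From protocols to sketches -/

/-- A string as a function on `ZMod n`. -/
noncomputable def onZMod {σ n : ℕ} [NeZero n] (S : Str σ n) : ZMod n → Fin σ :=
  fun x => S ((ZMod.finEquiv n).symm x)

lemma onZMod_cyc {σ n : ℕ} [NeZero n] (S : Str σ n) (x : ZMod n) :
    onZMod (cyc S) x = onZMod S (x + 1) := by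
  obtain ⟨n, rfl⟩ := Nat.exists_eq_succ_of_ne_zero (NeZero.ne n)
  unfold onZMod cyc
  simp only [Equiv.coe_fn_mk]
  congr 1
  rw [finRotate_apply, map_add, map_one]

lemma onZMod_cyc_zpow {σ n : ℕ} [NeZero n] (S : Str σ n) (m : ℤ) (x : ZMod n) :
    onZMod ((cyc ^ m) S) x = onZMod S (x + m) := by
  induction m using Int.induction_on generalizing S x with
  | zero => simp
  | succ i ih =>
    rw [zpow_add_one, Equiv.Perm.mul_apply, ih, onZMod_cyc]
    push_cast
    rw [add_assoc]
  | pred i ih =>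
    rw [zpow_sub_one, Equiv.Perm.mul_apply, ih]
    have := onZMod_cyc ((cyc⁻¹ : Equiv.Perm (Str σ n)) S) (x + ((-(i : ℤ) - 1 : ℤ) : ZMod n))
    rw [show cyc ((cyc⁻¹ : Equiv.Perm (Str σ n)) S) = S from cyc.apply_symm_apply S] at this
    rw [this]
    congr 1
    push_cast
    ring

/-- The Hamming distance of the statement is the number of mismatches on the circle. -/
lemma hammingDist_eq_card_mism {σ n : ℕ} [NeZero n] (S₁ S₂ : Str σ n) (m : ℤ) :
    hammingDist S₁ ((cyc ^ m) S₂) = (mism (onZMod S₁) (onZMod S₂) (m : ZMod n)).card := by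
  classical
  unfold hammingDist
  refine Finset.card_bij (fun i _ => ZMod.finEquiv n i) ?_ ?_ ?_
  · intro i hi
    rw [mem_mism, ← onZMod_cyc_zpow]
    simpa [onZMod] using hi
  · intro i _ j _ h
    exact (ZMod.finEquiv n).injective h
  · intro x hx
    rw [mem_mism, ← onZMod_cyc_zpow] at hx
    exact ⟨(ZMod.finEquiv n).symm x, by simpa [onZMod] using hx, by simp⟩

namespace Protocol

variable {n : ℕ} [NeZero n] {σ : ℕ}

/-- The messages of a protocol with `b` bits, written as bit strings of length `b`. -/
noncomputable def encode {Γ : Type} (P : Protocol n Γ) {b : ℕ} (hb : P.HasBits b) (ω : P.Ω) :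
    P.Msg ω ↪ (Fin b → Bool) :=
  (Function.Embedding.nonempty_of_card_le (by simpa using hb ω)).some

open Classical in
/-- The sketch that writes the messages of a protocol in binary. -/
noncomputable def toSketch (P : Protocol n (Fin σ)) {b : ℕ} (hb : P.HasBits b) :
    CircularSketch σ n where
  Ω := P.Ω
  mΩ := ⊤
  P := @PMF.toMeasure _ ⊤ (PMF.uniformOfFintype P.Ω)
  isProb := @PMF.toMeasure.isProbabilityMeasure _ ⊤ (PMF.uniformOfFintype P.Ω)
  sk ω S := List.ofFn (P.encode hb ω (P.msg ω (onZMod S)))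
  dec ω x y m :=
    if h : ∃ p : P.Msg ω × P.Msg ω,
        List.ofFn (P.encode hb ω p.1) = x ∧ List.ofFn (P.encode hb ω p.2) = y then
      P.dec ω h.choose.1 h.choose.2 m
    else 0
  measurableSet_sk _ _ := trivial
  measurable_dec _ _ _ := measurable_from_top

/-- Events have the same probability in the sketch as in the protocol. -/
lemma toSketch_prob (P : Protocol n (Fin σ)) {b : ℕ} (hb : P.HasBits b) (p : P.Ω → Prop) :
    ((P.toSketch hb).P {ω | p ω}).toReal = pr p := by
  classical
  have : (P.toSketch hb).P {ω | p ω} = _ :=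
    @PMF.toMeasure_uniformOfFintype_apply P.Ω _ _ {ω | p ω} ⊤ trivial _
  rw [this]
  simp only [ENNReal.toReal_div, ENNReal.toReal_natCast, pr, avg, Finset.sum_boole]
  congr 2
  rw [Fintype.card_subtype]
  rfl

lemma toSketch_answer (P : Protocol n (Fin σ)) {b : ℕ} (hb : P.HasBits b) (S₁ S₂ : Str σ n)
    (m : ℤ) (ω : P.Ω) : (P.toSketch hb).answer S₁ S₂ m ω = P.out (onZMod S₁) (onZMod S₂) m ω := by
  have hex : ∃ p : P.Msg ω × P.Msg ω,
      List.ofFn (P.encode hb ω p.1) = List.ofFn (P.encode hb ω (P.msg ω (onZMod S₁))) ∧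
      List.ofFn (P.encode hb ω p.2) = List.ofFn (P.encode hb ω (P.msg ω (onZMod S₂))) :=
    ⟨(P.msg ω (onZMod S₁), P.msg ω (onZMod S₂)), rfl, rfl⟩
  have h : (P.toSketch hb).answer S₁ S₂ m ω = P.dec ω hex.choose.1 hex.choose.2 m := dif_pos hex
  obtain ⟨h1, h2⟩ := hex.choose_spec
  rw [h, (P.encode hb ω).injective (List.ofFn_injective h1),
    (P.encode hb ω).injective (List.ofFn_injective h2)]
  rfl

/-- A protocol that solves the approximate `k`-mismatch problem yields a sketch of fixed length. -/
lemma exists_sketch (P : Protocol n (Fin σ)) {b k : ℕ} (hb : P.HasBits b) {ε q s : ℝ}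
    (hs : (b : ℝ) ≤ s) (hq : 0 ≤ q)
    (hP : P.Solves (fun H => if H ≤ k then Set.Icc ((1 - ε) * (H : ℝ)) ((1 + ε) * (H : ℝ))
      else Set.Ioi ((1 - ε) * (k : ℝ))) q) :
    ∃ K : CircularSketch σ n, K.IsApprox ε k (1 - q) ∧ K.HasSize s (1 - q) := by
  refine ⟨P.toSketch hb, fun S₁ S₂ m => ?_, fun S => ?_⟩
  · have h := hP (onZMod S₁) (onZMod S₂) m
    rw [pr_not] at h
    refine le_of_le_of_eq ?_ (toSketch_prob P hb _).symm
    refine le_trans (sub_le_comm.1 h) (pr_mono fun ω hω => ?_)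
    rw [hammingDist_eq_card_mism]
    rw [toSketch_answer]
    refine ⟨fun hH => ?_, fun hH => ?_⟩
    · simpa only [if_pos hH] using hω
    · simpa only [if_neg (not_le.2 hH), Set.mem_Ioi] using hω
  · refine le_of_le_of_eq ?_ (toSketch_prob P hb _).symm
    have h1 : pr (fun ω : P.Ω => ¬ (((((P.toSketch hb).sk ω S).length : ℕ) : ℝ) ≤ s)) = 0 := by
      refine pr_eq_zero fun ω => not_not.2 ?_
      have : ((P.toSketch hb).sk ω S).length = b := List.length_ofFn
      rw [this]
      exact hs
    rw [pr_not] at h1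
    exact le_trans (by linarith : 1 - q ≤ 1) (sub_nonpos.1 h1.le)

end Protocol

/-! ### Sampling cells of the circle -/

section Sampling

variable {C P : ℕ}

/-- The indicator that the sample `A`, which keeps every cell with probability `1 / P`, keeps `i`. -/
noncomputable def kept (A : Fin C → Fin P) (i : Fin C) : ℝ := if (A i : ℕ) = 0 then 1 else 0

lemma kept_nonneg (A : Fin C → Fin P) (i : Fin C) : 0 ≤ kept A i := by
  unfold kept; split_ifs <;> norm_num

lemma kept_le_one (A : Fin C → Fin P) (i : Fin C) : kept A i ≤ 1 := by
  unfold kept; split_ifs <;> norm_num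

lemma avg_kept (hP : 0 < P) (i : Fin C) : avg (fun A : Fin C → Fin P => kept A i) = 1 / P := by
  have : NeZero P := ⟨hP.ne'⟩
  rw [← pr_fin_eq_zero hP, ← pr_pi_eval (X := fun _ : Fin C => Fin P) i fun x => (x : ℕ) = 0]
  unfold pr
  congr 1
  funext A
  simp [kept]

lemma avg_kept_mul (hP : 0 < P) {i j : Fin C} (hij : i ≠ j) :
    avg (fun A : Fin C → Fin P => kept A i * kept A j) = 1 / (P : ℝ) ^ 2 := by
  classical
  have : NeZero P := ⟨hP.ne'⟩
  have h := pr_pi_forall (X := Fin P) ({i, j} : Finset (Fin C)) fun x => (x : ℕ) = 0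
  rw [pr_fin_eq_zero hP, Finset.card_pair hij, one_div, inv_pow, ← one_div] at h
  rw [← h]
  unfold pr
  congr 1
  funext A
  simp only [kept, Finset.mem_insert, Finset.mem_singleton, forall_eq_or_imp, forall_eq]
  by_cases h1 : (A i : ℕ) = 0 <;> by_cases h2 : (A j : ℕ) = 0 <;> simp [h1, h2]

lemma avg_kept_mul_le (hP : 0 < P) (i j : Fin C) :
    avg (fun A : Fin C → Fin P => kept A i * kept A j) ≤ 1 / P := by
  rw [← avg_kept hP i]
  exact avg_mono fun A => mul_le_of_le_one_right (kept_nonneg A i) (kept_le_one A j)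

variable {U : Type} [Fintype U]

/-- The unbiased estimate of `∑ u, X u` from the summands whose two cells are both kept. -/
noncomputable def sampleSum (α β : U → Fin C) (X : U → ℝ)
    (AB : (Fin C → Fin P) × (Fin C → Fin P)) : ℝ :=
  (P : ℝ) ^ 2 * ∑ u, kept AB.1 (α u) * kept AB.2 (β u) * X u

lemma avg_sampleSum (hP : 0 < P) (α β : U → Fin C) (X : U → ℝ) :
    avg (sampleSum (P := P) α β X) = ∑ u, X u := by
  have hP' : (P : ℝ) ≠ 0 := by exact_mod_cast hP.ne'
  unfold sampleSum
  rw [avg_const_mul, avg_sum, Finset.mul_sum]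
  refine Finset.sum_congr rfl fun u _ => ?_
  have : avg (fun AB : (Fin C → Fin P) × (Fin C → Fin P) =>
      kept AB.1 (α u) * kept AB.2 (β u) * X u) = 1 / P * (1 / P) * X u := by
    simp only [mul_comm _ (X u)]
    rw [avg_const_mul, avg_prod_mul (fun A => kept A (α u)) (fun B => kept B (β u)),
      avg_kept hP, avg_kept hP]
  rw [this]
  field_simp

/-- The variance of the sampled sum. Points that share no cell are independent, and a point shares a
cell with at most `2 * c` others. -/
lemma avg_sampleSum_sq_le (hP : 0 < P) {α β : U → Fin C} {X : U → ℝ} {c : ℕ}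
    (hα : ∀ i, (Finset.univ.filter fun u => α u = i).card ≤ c)
    (hβ : ∀ i, (Finset.univ.filter fun u => β u = i).card ≤ c)
    (h0 : ∀ u, 0 ≤ X u) (h1 : ∀ u, X u ≤ 1) :
    avg (fun AB => (sampleSum (P := P) α β X AB - ∑ u, X u) ^ 2) ≤
      (P : ℝ) ^ 2 * (2 * c) * ∑ u, X u := by
  classical
  have : NeZero P := ⟨hP.ne'⟩
  have hP' : (1 : ℝ) ≤ P := by exact_mod_cast hP
  have hP0 : (P : ℝ) ≠ 0 := by positivity
  set E := ∑ u, X u with hE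
  have hexp : ∀ AB, (sampleSum (P := P) α β X AB - E) ^ 2 =
      (sampleSum (P := P) α β X AB) ^ 2 + ((-2 * E) * sampleSum (P := P) α β X AB + E ^ 2) := by
    intro AB; ring
  simp only [hexp]
  rw [avg_add, avg_add, avg_const_mul, avg_const, avg_sampleSum hP]
  have hsq : ∀ AB : (Fin C → Fin P) × (Fin C → Fin P), (sampleSum (P := P) α β X AB) ^ 2 =
      ∑ u, ∑ v, ((P : ℝ) ^ 4 * X u * X v) *
        ((kept AB.1 (α u) * kept AB.1 (α v)) * (kept AB.2 (β u) * kept AB.2 (β v))) := by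
    intro AB
    rw [sampleSum, mul_pow, sq (∑ u, _), Finset.sum_mul_sum, Finset.mul_sum]
    refine Finset.sum_congr rfl fun u _ => ?_
    rw [Finset.mul_sum]
    refine Finset.sum_congr rfl fun v _ => ?_
    ring
  simp only [hsq]
  rw [avg_sum]
  simp only [avg_sum, avg_const_mul]
  have hpair : ∀ u v, (P : ℝ) ^ 4 * X u * X v *
      avg (fun AB : (Fin C → Fin P) × (Fin C → Fin P) =>
        (kept AB.1 (α u) * kept AB.1 (α v)) * (kept AB.2 (β u) * kept AB.2 (β v))) ≤
      X u * X v + (P : ℝ) ^ 2 * (X u * ((if α v = α u then 1 else 0) +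
        (if β v = β u then 1 else 0))) := by
    intro u v
    rw [avg_prod_mul (fun A => kept A (α u) * kept A (α v))
      (fun B => kept B (β u) * kept B (β v))]
    have hXX : 0 ≤ X u * X v := mul_nonneg (h0 u) (h0 v)
    have hXu : X u * X v ≤ X u := mul_le_of_le_one_right (h0 u) (h1 v)
    have hshare : (P : ℝ) ^ 4 * X u * X v *
        (avg (fun A : Fin C → Fin P => kept A (α u) * kept A (α v)) *
          avg (fun B : Fin C → Fin P => kept B (β u) * kept B (β v))) ≤ (P : ℝ) ^ 2 * X u := by
      have ha := avg_kept_mul_le hP (α u) (α v)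
      have hb := avg_kept_mul_le hP (β u) (β v)
      have hb0 : 0 ≤ avg (fun B : Fin C → Fin P => kept B (β u) * kept B (β v)) :=
        avg_nonneg fun B => mul_nonneg (kept_nonneg _ _) (kept_nonneg _ _)
      calc _ ≤ (P : ℝ) ^ 4 * X u * X v * (1 / P * (1 / P)) := by
            rw [mul_assoc ((P : ℝ) ^ 4)]; gcongr
        _ = (P : ℝ) ^ 2 * (X u * X v) := by field_simp
        _ ≤ _ := by gcongr
    by_cases ha : α v = α u
    · rw [if_pos ha]
      refine hshare.trans ?_
      have : 0 ≤ (P : ℝ) ^ 2 * (X u * (if β v = β u then (1 : ℝ) else 0)) := by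
        have := h0 u; positivity
      nlinarith
    · by_cases hb : β v = β u
      · rw [if_pos hb, if_neg ha]
        refine hshare.trans ?_
        nlinarith
      · rw [if_neg ha, if_neg hb, avg_kept_mul hP (Ne.symm ha), avg_kept_mul hP (Ne.symm hb)]
        apply le_of_eq
        field_simp
        ring
  have htot := Finset.sum_le_sum fun u (_ : u ∈ Finset.univ) =>
    Finset.sum_le_sum fun v (_ : v ∈ Finset.univ) => hpair u v
  have hrow : ∀ u, ∑ v, (X u * X v + (P : ℝ) ^ 2 * (X u * ((if α v = α u then 1 else 0) +
        (if β v = β u then 1 else 0)))) ≤ X u * E + (P : ℝ) ^ 2 * (2 * c) * X u := by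
    intro u
    rw [Finset.sum_add_distrib, ← Finset.mul_sum, ← Finset.mul_sum, ← Finset.mul_sum,
      Finset.sum_add_distrib, Finset.sum_boole, Finset.sum_boole]
    have ha : ((Finset.univ.filter fun v => α v = α u).card : ℝ) ≤ c := by exact_mod_cast hα (α u)
    have hb : ((Finset.univ.filter fun v => β v = β u).card : ℝ) ≤ c := by exact_mod_cast hβ (β u)
    have : (P : ℝ) ^ 2 * (X u * (((Finset.univ.filter fun v => α v = α u).card : ℝ) +
        ((Finset.univ.filter fun v => β v = β u).card : ℝ))) ≤ (P : ℝ) ^ 2 * (X u * (c + c)) := by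
      have := h0 u
      gcongr
    linarith
  have hfin := htot.trans (Finset.sum_le_sum fun u _ => hrow u)
  rw [Finset.sum_add_distrib, ← Finset.sum_mul, ← Finset.mul_sum, ← hE] at hfin
  linarith

lemma sampleSum_one (α β : U → Fin C) (X : U → ℝ) (AB : (Fin C → Fin 1) × (Fin C → Fin 1)) :
    sampleSum α β X AB = ∑ u, X u := by
  simp [sampleSum, kept]

open Classical in
/-- The cells kept by the sample, or none if the sample is larger than `cap`. -/
noncomputable def keptCells (cap : ℕ) (A : Fin C → Fin P) : Finset (Fin C) :=
  if (Finset.univ.filter fun i => (A i : ℕ) = 0).card ≤ cap then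
    Finset.univ.filter fun i => (A i : ℕ) = 0
  else ∅

lemma card_keptCells_le (cap : ℕ) (A : Fin C → Fin P) : (keptCells cap A).card ≤ cap := by
  unfold keptCells
  split_ifs with h
  · exact h
  · simp

open Classical in
/-- A sample is oversized with small probability, by Markov's inequality. -/
lemma pr_oversize_le (hP : 0 < P) {cap : ℕ} (hcap : 0 < cap) :
    pr (fun A : Fin C → Fin P => ¬ (Finset.univ.filter fun i => (A i : ℕ) = 0).card ≤ cap) ≤
      C / (P * cap) := by
  have h1 : avg (fun A : Fin C → Fin P => ∑ i, kept A i) = C / P := by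
    rw [avg_sum]
    simp only [avg_kept hP, Finset.sum_const, Finset.card_univ, Fintype.card_fin, nsmul_eq_mul]
    ring
  have h2 := pr_le_avg_div (f := fun A : Fin C → Fin P => ∑ i, kept A i)
    (fun A => Finset.sum_nonneg fun i _ => kept_nonneg A i) (t := cap) (by exact_mod_cast hcap)
  rw [h1, div_div] at h2
  refine (pr_mono fun A hA => ?_).trans h2
  have : ∑ i, kept A i = ((Finset.univ.filter fun i => (A i : ℕ) = 0).card : ℝ) := by
    simp only [kept, Finset.sum_boole]
  rw [this]
  exact_mod_cast (not_le.1 hA).le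

end Sampling

/-- The data of a protocol that reads the circle `ZMod n`, dilated by a random unit, cell by cell:
each string provides one message per cell, and a message of `S₁` about the cell of `u` together with a
message of `S₂` about the cell of the image of `u` under the shift determine a number `val`; its last
two arguments are the offsets of the two points in their cells. -/
structure LocalScheme (n : ℕ) (Γ : Type) where
  Ω : Type
  fin : Fintype Ω
  ne : Nonempty Ω
  unit : Ω → (ZMod n)ˣ
  Msg : Type
  finMsg : Fintype Msg
  msg : Ω → (ZMod n → Γ) → ℕ → Msg
  val : Ω → Msg → Msg → ℕ → ℕ → ℝ

attribute [instance] LocalScheme.fin LocalScheme.ne LocalScheme.finMsg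

namespace LocalScheme

variable {n : ℕ} [NeZero n] {Γ : Type}

/-- The value that the decoder can compute for the point `u` if cells have length `c`. -/
noncomputable def X (D : LocalScheme n Γ) (c : ℕ) (S₁ S₂ : ZMod n → Γ) (m : ZMod n) (ω : D.Ω)
    (u : ZMod n) : ℝ :=
  D.val ω (D.msg ω S₁ (u.val / c)) (D.msg ω S₂ ((u + (D.unit ω : ZMod n) * m).val / c))
    (u.val % c) ((u + (D.unit ω : ZMod n) * m).val % c)

/-- The cell of a point of the circle. -/
def cell (c : ℕ) (u : ZMod n) : Fin (n / c + 1) :=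
  ⟨u.val / c, Nat.lt_succ_of_le (Nat.div_le_div_right (ZMod.val_lt u).le)⟩

lemma card_cell_le {c : ℕ} (hc : 0 < c) (s : ZMod n) (i : Fin (n / c + 1)) :
    (Finset.univ.filter fun u : ZMod n => cell c (u + s) = i).card ≤ c := by
  classical
  have h := Finset.card_le_card_of_injOn (s := Finset.univ.filter fun u : ZMod n =>
    cell c (u + s) = i) (t := Finset.range c) (fun u => (u + s).val % c)
    (fun u _ => by simpa using Nat.mod_lt _ hc) ?_
  · simpa using h
  · intro u hu v hv huv
    have hu' : (u + s).val / c = i := congrArg Fin.val (by simpa using hu)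
    have hv' : (v + s).val / c = i := congrArg Fin.val (by simpa using hv)
    have : (u + s).val = (v + s).val := by
      rw [← Nat.div_add_mod (u + s).val c, ← Nat.div_add_mod (v + s).val c, hu', hv']
      simp only at huv
      rw [huv]
    exact add_right_cancel (ZMod.val_injective n this)

open Classical in
/-- Sample the cells of the two strings independently with rate `1 / P`, and estimate the sum of the
values over the circle. -/
noncomputable def sample (D : LocalScheme n Γ) (c P cap : ℕ) (hP : 0 < P) : Protocol n Γ where
  Ω := D.Ω × ((Fin (n / c + 1) → Fin P) × (Fin (n / c + 1) → Fin P))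
  fin := inferInstance
  ne := by have : NeZero P := ⟨hP.ne'⟩; infer_instance
  Msg ω := (keptCells cap ω.2.1 → D.Msg) × (keptCells cap ω.2.2 → D.Msg)
  finMsg _ := inferInstance
  msg ω S := (fun i => D.msg ω.1 S i.1, fun i => D.msg ω.1 S i.1)
  dec ω x y m := (P : ℝ) ^ 2 * ∑ u : ZMod n,
    if h : cell c u ∈ keptCells cap ω.2.1 ∧
        cell c (u + (D.unit ω.1 : ZMod n) * m) ∈ keptCells cap ω.2.2 then
      D.val ω.1 (x.1 ⟨_, h.1⟩) (y.2 ⟨_, h.2⟩) (u.val % c) ((u + (D.unit ω.1 : ZMod n) * m).val % c)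
    else 0

variable (D : LocalScheme n Γ) {c P cap : ℕ} (hP : 0 < P)

lemma sample_hasBits {b : ℕ} (hb : Fintype.card D.Msg ≤ 2 ^ b) :
    (D.sample c P cap hP).HasBits (2 * cap * b) := by
  classical
  intro ω
  let ω' : D.Ω × ((Fin (n / c + 1) → Fin P) × (Fin (n / c + 1) → Fin P)) := ω
  change Fintype.card ((keptCells cap ω'.2.1 → D.Msg) × (keptCells cap ω'.2.2 → D.Msg)) ≤ _
  rw [Fintype.card_prod, Fintype.card_fun, Fintype.card_fun, Fintype.card_coe, Fintype.card_coe,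
    ← pow_add]
  calc _ ≤ (2 ^ b) ^ ((keptCells cap ω'.2.1).card + (keptCells cap ω'.2.2).card) :=
        Nat.pow_le_pow_left hb _
    _ ≤ (2 ^ b) ^ (cap + cap) := Nat.pow_le_pow_right (by positivity)
        (add_le_add (card_keptCells_le _ _) (card_keptCells_le _ _))
    _ = _ := by rw [← pow_mul]; congr 1; ring

/-- If neither sample is oversized then the decoder computes the sampled sum. -/
lemma sample_out_eq (S₁ S₂ : ZMod n → Γ) (m : ZMod n) (ω : D.Ω)
    (A B : Fin (n / c + 1) → Fin P)
    (hA : (Finset.univ.filter fun i => (A i : ℕ) = 0).card ≤ cap)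
    (hB : (Finset.univ.filter fun i => (B i : ℕ) = 0).card ≤ cap) :
    (D.sample c P cap hP).out S₁ S₂ m (ω, A, B) =
      sampleSum (cell c) (fun u => cell c (u + (D.unit ω : ZMod n) * m)) (D.X c S₁ S₂ m ω) (A, B) := by
  classical
  change (P : ℝ) ^ 2 * ∑ u : ZMod n, (if h : cell c u ∈ keptCells cap A ∧
        cell c (u + (D.unit ω : ZMod n) * m) ∈ keptCells cap B then D.X c S₁ S₂ m ω u else 0) = _
  rw [sampleSum]
  congr 1
  refine Finset.sum_congr rfl fun u _ => ?_
  have e1 : keptCells cap A = Finset.univ.filter fun i => (A i : ℕ) = 0 := if_pos hA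
  have e2 : keptCells cap B = Finset.univ.filter fun i => (B i : ℕ) = 0 := if_pos hB
  simp only [e1, e2, Finset.mem_filter, Finset.mem_univ, true_and, kept]
  by_cases h1 : (A (cell c u) : ℕ) = 0 <;>
    by_cases h2 : (B (cell c (u + (D.unit ω : ZMod n) * m)) : ℕ) = 0 <;> simp [h1, h2]

/-- Even if a sample is oversized, the decoder's answer is at most the sampled sum. -/
lemma sample_out_le (S₁ S₂ : ZMod n → Γ) (m : ZMod n) (ω : D.Ω)
    (A B : Fin (n / c + 1) → Fin P) (h0 : ∀ u, 0 ≤ D.X c S₁ S₂ m ω u) :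
    (D.sample c P cap hP).out S₁ S₂ m (ω, A, B) ≤
      sampleSum (cell c) (fun u => cell c (u + (D.unit ω : ZMod n) * m)) (D.X c S₁ S₂ m ω) (A, B) := by
  classical
  change (P : ℝ) ^ 2 * ∑ u : ZMod n, (if h : cell c u ∈ keptCells cap A ∧
        cell c (u + (D.unit ω : ZMod n) * m) ∈ keptCells cap B then D.X c S₁ S₂ m ω u else 0) ≤ _
  rw [sampleSum]
  refine mul_le_mul_of_nonneg_left (Finset.sum_le_sum fun u _ => ?_) (by positivity)
  have hsub : ∀ (A : Fin (n / c + 1) → Fin P) i, i ∈ keptCells cap A → (A i : ℕ) = 0 := by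
    intro A i hi
    unfold keptCells at hi
    split_ifs at hi
    · exact (Finset.mem_filter.1 hi).2
    · simp at hi
  split_ifs with h
  · simp [kept, hsub _ _ h.1, hsub _ _ h.2]
  · exact mul_nonneg (mul_nonneg (kept_nonneg _ _) (kept_nonneg _ _)) (h0 u)

/-- The sampled sum is concentrated: its variance is at most `P ^ 2 * (2 * c)` times its mean, as only
points that share a cell are correlated. -/
lemma sample_pr_le (hc : 0 < c) (hcap : 0 < cap) {S₁ S₂ : ZMod n → Γ} {m : ZMod n} {G : Set ℝ}
    {good : D.Ω → Prop} {q₀ q₁ : ℝ} {t : D.Ω → ℝ} (hq₁ : 0 ≤ q₁)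
    (hgood : pr (fun ω => ¬ good ω) ≤ q₀)
    (h0 : ∀ ω u, 0 ≤ D.X c S₁ S₂ m ω u) (h1 : ∀ ω u, D.X c S₁ S₂ m ω u ≤ 1)
    (ht : ∀ ω, good ω → 0 < t ω)
    (hG : ∀ ω, good ω → ∀ x, |x - ∑ u, D.X c S₁ S₂ m ω u| < t ω → x ∈ G)
    (hvar : P = 1 ∨ ∀ ω, good ω →
      (P : ℝ) ^ 2 * (2 * c) * ∑ u, D.X c S₁ S₂ m ω u ≤ q₁ * t ω ^ 2) :
    pr (fun ω => (D.sample c P cap hP).out S₁ S₂ m ω ∉ G) ≤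
      q₀ + (q₁ + 2 * (((n / c + 1 : ℕ) : ℝ) / (P * cap))) := by
  classical
  have : NeZero P := ⟨hP.ne'⟩
  refine pr_prod_le (Ω := D.Ω) (Ω' := (Fin (n / c + 1) → Fin P) × (Fin (n / c + 1) → Fin P))
    (by positivity) hgood fun ω hω => ?_
  set α : ZMod n → Fin (n / c + 1) := cell c
  set β : ZMod n → Fin (n / c + 1) := fun u => cell c (u + (D.unit ω : ZMod n) * m)
  set Xω := D.X c S₁ S₂ m ω
  have hdev : pr (fun AB => t ω ≤ |sampleSum (P := P) α β Xω AB - ∑ u, Xω u|) ≤ q₁ := by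
    rcases hvar with h | h
    · subst h
      refine (pr_eq_zero fun AB => ?_).trans_le hq₁
      rw [sampleSum_one]
      simpa using ht ω hω
    · have hα : ∀ i, (Finset.univ.filter fun u => α u = i).card ≤ c := by
        intro i
        have := card_cell_le hc (0 : ZMod n) i
        simpa using this
      have h2 := avg_sampleSum_sq_le hP hα (card_cell_le hc ((D.unit ω : ZMod n) * m)) (h0 ω) (h1 ω)
      have h3 := pr_le_avg_div (f := fun AB => (sampleSum (P := P) α β Xω AB - ∑ u, Xω u) ^ 2)
        (fun AB => sq_nonneg _) (t := t ω ^ 2) (by have := ht ω hω; positivity)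
      refine (pr_mono fun AB hAB => ?_).trans (h3.trans ?_)
      · rw [← sq_abs (_ - _)]
        exact pow_le_pow_left₀ (ht ω hω).le hAB 2
      · rw [div_le_iff₀ (by have := ht ω hω; positivity)]
        exact h2.trans (h ω hω)
  have hsize := pr_oversize_le (C := n / c + 1) hP hcap
  have hA := (pr_prod_fst (Ω' := Fin (n / c + 1) → Fin P) (fun A : Fin (n / c + 1) → Fin P =>
    ¬ (Finset.univ.filter fun i => (A i : ℕ) = 0).card ≤ cap)).trans_le hsize
  have hB := (pr_prod_snd (Ω := Fin (n / c + 1) → Fin P) (fun A : Fin (n / c + 1) → Fin P =>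
    ¬ (Finset.univ.filter fun i => (A i : ℕ) = 0).card ≤ cap)).trans_le hsize
  refine (pr_mono fun AB hAB => ?_).trans ((pr_or_le _ _).trans (add_le_add hdev
    ((pr_or_le _ _).trans ((add_le_add hA hB).trans_eq (two_mul _).symm))))
  by_contra hcon
  push Not at hcon
  obtain ⟨hd, h2, h3⟩ := hcon
  refine hAB (hG ω hω _ ?_)
  rw [show (ω, AB) = (ω, AB.1, AB.2) from rfl, sample_out_eq D hP S₁ S₂ m ω AB.1 AB.2 h2 h3]
  exact hd

/-- Markov's inequality for the sampled sum. -/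
lemma sample_pr_ge_le {S₁ S₂ : ZMod n → Γ} {m : ZMod n}
    (h0 : ∀ ω u, 0 ≤ D.X c S₁ S₂ m ω u) {t μ : ℝ} (ht : 0 < t)
    (hμ : avg (fun ω => ∑ u, D.X c S₁ S₂ m ω u) ≤ μ) :
    pr (fun ω => t ≤ (D.sample c P cap hP).out S₁ S₂ m ω) ≤ μ / t := by
  have : NeZero P := ⟨hP.ne'⟩
  let f : D.Ω × ((Fin (n / c + 1) → Fin P) × (Fin (n / c + 1) → Fin P)) → ℝ := fun ω =>
    sampleSum (cell c) (fun u => cell c (u + (D.unit ω.1 : ZMod n) * m)) (D.X c S₁ S₂ m ω.1) ω.2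
  have hf : avg f ≤ μ := by
    rw [avg_prod]
    simp only [f, avg_sampleSum hP]
    exact hμ
  have hf0 : ∀ ω, 0 ≤ f ω := fun ω => mul_nonneg (by positivity)
    (Finset.sum_nonneg fun u _ => mul_nonneg (mul_nonneg (kept_nonneg _ _) (kept_nonneg _ _))
      (h0 _ u))
  refine (pr_mono fun ω hω => ?_).trans ((pr_le_avg_div hf0 ht).trans
    (div_le_div_of_nonneg_right hf ht.le))
  exact hω.trans (sample_out_le D hP S₁ S₂ m ω.1 ω.2.1 ω.2.2 (h0 ω.1))

end LocalScheme

/-- If no point contributes then the answer is exactly `0`. -/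
lemma LocalScheme.sample_out_eq_zero {n : ℕ} [NeZero n] {Γ : Type} (D : LocalScheme n Γ)
    {c P cap : ℕ} (hP : 0 < P) {S₁ S₂ : ZMod n → Γ} {m : ZMod n}
    (h0 : ∀ ω u, D.X c S₁ S₂ m ω u = 0) (ω : (D.sample c P cap hP).Ω) :
    (D.sample c P cap hP).out S₁ S₂ m ω = 0 := by
  classical
  obtain ⟨ω, A, B⟩ := ω
  change (P : ℝ) ^ 2 * ∑ u : ZMod n, (if h : cell c u ∈ keptCells cap A ∧
        cell c (u + (D.unit ω : ZMod n) * m) ∈ keptCells cap B then D.X c S₁ S₂ m ω u else 0) = 0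
  rw [Finset.sum_eq_zero, mul_zero]
  intro u _
  split_ifs
  · exact h0 ω u
  · rfl

/-- The capacity of the sample of cells is exceeded with small probability. -/
lemma two_mul_div_capacity_le {C P L : ℕ} (hP : 0 < P) (hL : 0 < L) :
    2 * ((C : ℝ) / (P * ((2 ^ 9 * L * (C / P + 1) : ℕ) : ℝ))) ≤ 1 / (2 ^ 8 * L) := by
  have h1 : C ≤ P * (C / P + 1) := (Nat.lt_mul_div_succ _ hP).le
  have hPr : (0 : ℝ) < P := by exact_mod_cast hP
  have hLr : (0 : ℝ) < L := by exact_mod_cast hL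
  have h2 : (C : ℝ) ≤ P * ((C / P : ℕ) + 1) := by exact_mod_cast h1
  push_cast
  rw [← mul_div_assoc, div_le_div_iff₀ (by positivity) (by positivity)]
  calc 2 * (C : ℝ) * (2 ^ 8 * L) ≤ 2 * (P * ((C / P : ℕ) + 1)) * (2 ^ 8 * L) := by gcongr
    _ = _ := by ring

/-! ### Dilation of the circle by a random unit -/

/-- The product of `p / (p - 1)` over `t` distinct integers `p ≥ 2` is largest for `2, …, t + 1`, where it
telescopes to `t + 1`. -/
lemma prod_le_card_add_one_mul (s : Finset ℕ) (hs : ∀ p ∈ s, 2 ≤ p) :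
    ∏ p ∈ s, p ≤ (s.card + 1) * ∏ p ∈ s, (p - 1) := by
  induction s using Finset.induction_on_max with
  | empty => simp
  | insert a s ha ih =>
    have hna : a ∉ s := fun h => lt_irrefl _ (ha a h)
    have ha2 := hs a (Finset.mem_insert_self a s)
    rw [Finset.prod_insert hna, Finset.prod_insert hna, Finset.card_insert_of_notMem hna]
    have ih' := ih fun p hp => hs p (Finset.mem_insert_of_mem hp)
    -- the largest element of `insert a s ⊆ [2, a]` is at least `s.card + 2`
    have hcard : s.card + 2 ≤ a := by
      have hsub : s ⊆ Finset.Ico 2 a := fun p hp =>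
        Finset.mem_Ico.2 ⟨hs p (Finset.mem_insert_of_mem hp), ha p hp⟩
      have := Finset.card_le_card hsub
      rw [Nat.card_Ico] at this
      omega
    obtain ⟨b, rfl⟩ : ∃ b, a = b + 1 := ⟨a - 1, by omega⟩
    simp only [Nat.add_sub_cancel]
    calc (b + 1) * ∏ p ∈ s, p ≤ (b + 1) * ((s.card + 1) * ∏ p ∈ s, (p - 1)) := by gcongr
      _ = ((b + 1) * (s.card + 1)) * ∏ p ∈ s, (p - 1) := by ring
      _ ≤ ((s.card + 1 + 1) * b) * ∏ p ∈ s, (p - 1) := by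
          refine Nat.mul_le_mul_right _ ?_
          nlinarith
      _ = _ := by ring

/-- A number `n` has at most `log₂ n` prime factors, so `φ(n) / n` is at least
`∏ i ≤ log₂ n, (1 - 1 / (i + 1))`. -/
lemma le_totient_mul_log (n : ℕ) (hn : 0 < n) : n ≤ n.totient * (Nat.log 2 n + 1) := by
  have h1 := Nat.totient_mul_prod_primeFactors n
  have h2 := prod_le_card_add_one_mul n.primeFactors fun p hp =>
    (Nat.prime_of_mem_primeFactors hp).two_le
  have hcard : n.primeFactors.card ≤ Nat.log 2 n := by
    refine Nat.le_log_of_pow_le (by norm_num) ?_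
    calc 2 ^ n.primeFactors.card ≤ ∏ p ∈ n.primeFactors, p :=
          Finset.pow_card_le_prod _ _ _ fun p hp => (Nat.prime_of_mem_primeFactors hp).two_le
      _ ≤ n := Nat.le_of_dvd hn (Nat.prod_primeFactors_dvd n)
  have hpos : 0 < ∏ p ∈ n.primeFactors, (p - 1) := Finset.prod_pos fun p hp => by
    have := (Nat.prime_of_mem_primeFactors hp).two_le
    omega
  refine Nat.le_of_mul_le_mul_right ?_ hpos
  calc n * ∏ p ∈ n.primeFactors, (p - 1) = n.totient * ∏ p ∈ n.primeFactors, p := h1.symm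
    _ ≤ n.totient * ((n.primeFactors.card + 1) * ∏ p ∈ n.primeFactors, (p - 1)) := by gcongr
    _ ≤ n.totient * ((Nat.log 2 n + 1) * ∏ p ∈ n.primeFactors, (p - 1)) := by gcongr
    _ = _ := by ring

/-- A uniform group element maps a point to any given point with probability at most one over the
size of the orbit. -/
lemma pr_smul_mem_le {G X : Type} [Group G] [Fintype G] [MulAction G X] [DecidableEq X] (x : X)
    (Y : Finset X) {N : ℕ} (hN : 0 < N) (horb : N ≤ Nat.card (MulAction.orbit G x)) :
    pr (fun a : G => a • x ∈ Y) ≤ Y.card / N := by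
  classical
  have hfib : ∀ y, (Finset.univ.filter fun a : G => a • x = y).card ≤
      Nat.card (MulAction.stabilizer G x) := by
    intro y
    rcases (Finset.univ.filter fun a : G => a • x = y).eq_empty_or_nonempty with h | ⟨b, hb⟩
    · simp [h]
    · have hb' : b • x = y := by simpa using hb
      have hle := Finset.card_le_card_of_injOn
        (s := Finset.univ.filter fun a : G => a • x = y)
        (t := Finset.univ.filter fun a : G => a ∈ MulAction.stabilizer G x)
        (fun a => b⁻¹ * a) ?_ ?_
      · rw [Nat.card_eq_fintype_card, Fintype.card_subtype]
        exact hle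
      · intro a ha
        have ha' : a • x = y := by simpa using ha
        simp only [Finset.coe_filter, Finset.mem_univ, true_and, Set.mem_ofPred_eq,
          MulAction.mem_stabilizer_iff, mul_smul]
        rw [ha', ← hb', inv_smul_smul]
      · intro a _ c _ h
        exact mul_left_cancel h
  have hcount : (Finset.univ.filter fun a : G => a • x ∈ Y).card ≤
      Y.card * Nat.card (MulAction.stabilizer G x) := by
    have := Finset.card_le_mul_card_image_of_maps_to
      (s := Finset.univ.filter fun a : G => a • x ∈ Y) (t := Y) (f := fun a : G => a • x)
      (fun a ha => by simpa using ha) (Nat.card (MulAction.stabilizer G x)) (fun y _ => by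
        refine (Finset.card_le_card fun a ha => ?_).trans (hfib y)
        simp only [Finset.mem_filter, Finset.mem_univ, true_and] at ha ⊢
        exact ha.2)
    rwa [mul_comm] at this
  have hgrp : Nat.card (MulAction.orbit G x) * Nat.card (MulAction.stabilizer G x) =
      Fintype.card G := by
    have : Finite (MulAction.orbit G x) := Set.finite_range _
    have : Fintype (MulAction.orbit G x) := Fintype.ofFinite _
    have h := MulAction.card_orbit_mul_card_stabilizer_eq_card_group G x
    simpa only [← Nat.card_eq_fintype_card] using h
  have hG : (0 : ℝ) < Fintype.card G := by exact_mod_cast Fintype.card_pos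
  have hpr : pr (fun a : G => a • x ∈ Y) =
      (Finset.univ.filter fun a : G => a • x ∈ Y).card / (Fintype.card G : ℝ) := by
    unfold pr avg
    rw [← Finset.sum_boole]
    congr 1
    exact Finset.sum_congr rfl fun a _ => by by_cases h : a • x ∈ Y <;> simp [h]
  rw [hpr, div_le_div_iff₀ hG (by exact_mod_cast hN)]
  have : (Finset.univ.filter fun a : G => a • x ∈ Y).card * N ≤ Y.card * Fintype.card G := by
    calc _ ≤ Y.card * Nat.card (MulAction.stabilizer G x) * N := by gcongr
      _ ≤ Y.card * Nat.card (MulAction.stabilizer G x) * Nat.card (MulAction.orbit G x) := by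
          gcongr
      _ = _ := by rw [← hgrp]; ring
  exact_mod_cast this

section Dilation

variable {n : ℕ} [NeZero n]

/-- The distance of a point of the circle `ZMod n` from `0`. -/
def cabs (x : ZMod n) : ℕ := x.valMinAbs.natAbs

omit [NeZero n] in
lemma cabs_neg (x : ZMod n) : cabs (-x) = cabs x := by
  exact ZMod.natAbs_valMinAbs_neg x

omit [NeZero n] in
lemma cabs_add_le (x y : ZMod n) : cabs (x + y) ≤ cabs x + cabs y := by
  exact (ZMod.natAbs_valMinAbs_add_le x y).trans (Int.natAbs_add_le _ _)

omit [NeZero n] in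
lemma cabs_sub_le (x y : ZMod n) : cabs (x - y) ≤ cabs x + cabs y := by
  rw [sub_eq_add_neg, ← cabs_neg y]
  exact cabs_add_le _ _

lemma cabs_intCast_le (z : ℤ) : cabs (z : ZMod n) ≤ z.natAbs :=
  ZMod.natAbs_min_of_le_div_two n _ _ (by simp [ZMod.coe_valMinAbs])
    (ZMod.natAbs_valMinAbs_le _)

/-- The orbit of `d` under multiplication by units has at least `φ(n / gcd(d, n))` elements. -/
lemma totient_le_card_orbit (d : ZMod n) :
    (n / Nat.gcd d.val n).totient ≤ Nat.card (MulAction.orbit (ZMod n)ˣ d) := by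
  classical
  set g := Nat.gcd d.val n with hg
  have hn : 0 < n := NeZero.pos n
  have hg0 : 0 < g := Nat.gcd_pos_of_pos_right _ hn
  obtain ⟨n', hn'⟩ : g ∣ n := Nat.gcd_dvd_right _ _
  obtain ⟨d', hd'⟩ : g ∣ d.val := Nat.gcd_dvd_left _ _
  have hdiv : n / g = n' := by rw [hn']; exact Nat.mul_div_cancel_left _ hg0
  have hn'0 : 0 < n' := Nat.pos_of_ne_zero fun h => by rw [h, mul_zero] at hn'; omega
  have : NeZero n' := ⟨hn'0.ne'⟩
  have hcop : Nat.Coprime d' n' := by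
    have := Nat.coprime_div_gcd_div_gcd (m := d.val) (n := n) hg0
    rwa [← hg, hdiv, hd', Nat.mul_div_cancel_left _ hg0] at this
  have hdvd : n' ∣ n := ⟨g, by rw [hn', mul_comm]⟩
  have hsurj := ZMod.unitsMap_surjective hdvd
  rw [hdiv, ← ZMod.card_units_eq_totient, ← Nat.card_eq_fintype_card]
  choose lift hlift using hsurj
  refine Nat.card_le_card_of_injective
    (fun b => (⟨lift b • d, MulAction.mem_orbit d _⟩ : MulAction.orbit (ZMod n)ˣ d)) ?_
  intro b c hbc
  have h1 : ((lift b : (ZMod n)ˣ) : ZMod n) * d = (lift c : (ZMod n)ˣ) * d :=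
    congrArg Subtype.val hbc
  rw [← hlift b, ← hlift c]
  ext
  rw [ZMod.unitsMap_val, ZMod.unitsMap_val]
  set x := ((lift b : (ZMod n)ˣ) : ZMod n)
  set y := ((lift c : (ZMod n)ˣ) : ZMod n)
  rw [← ZMod.natCast_zmod_val d, ← ZMod.natCast_zmod_val x, ← ZMod.natCast_zmod_val y,
    ← Nat.cast_mul, ← Nat.cast_mul, ZMod.natCast_eq_natCast_iff, hd'] at h1
  have h2 : g * (x.val * d') ≡ g * (y.val * d') [MOD g * n'] := by
    rw [← hn']
    convert h1 using 1 <;> ring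
  have h3 := Nat.ModEq.mul_left_cancel' hg0.ne' h2
  have h4 : x.val ≡ y.val [MOD n'] :=
    Nat.ModEq.cancel_right_of_coprime (by rw [Nat.gcd_comm]; exact hcop) h3
  rw [ZMod.cast_eq_val, ZMod.cast_eq_val, ZMod.natCast_eq_natCast_iff]
  exact h4

/-- A nonzero difference is dilated to one of size at most `r` with probability `O(r / n)`, up to the
logarithm: the dilates of `d` are multiples of `g = gcd(d, n)`, so at most `2 r / g` of them are short,
while the orbit has `φ(n / g)` elements. -/
lemma pr_cabs_dilate_le {d : ZMod n} (hd : d ≠ 0) (r : ℕ) :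
    pr (fun a : (ZMod n)ˣ => cabs ((a : ZMod n) * d) ≤ r) ≤
      2 * r * (Nat.log 2 n + 1 : ℕ) / n := by
  classical
  set g := Nat.gcd d.val n with hg
  have hn : 0 < n := NeZero.pos n
  have hg0 : 0 < g := Nat.gcd_pos_of_pos_right _ hn
  obtain ⟨n', hn'⟩ : g ∣ n := Nat.gcd_dvd_right _ _
  have hdiv : n / g = n' := by rw [hn']; exact Nat.mul_div_cancel_left _ hg0
  have hn'0 : 0 < n' := Nat.pos_of_ne_zero fun h => by rw [h, mul_zero] at hn'; omega
  have hn'n : n' ≤ n := hdiv ▸ Nat.div_le_self n g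
  have horb := totient_le_card_orbit d
  rw [← hg, hdiv] at horb
  set Y : Finset (ZMod n) := (((Finset.Icc (-((r / g : ℕ) : ℤ)) ((r / g : ℕ) : ℤ)).erase 0).image
    fun z : ℤ => ((g * z : ℤ) : ZMod n)) with hY
  have hYcard : Y.card ≤ 2 * (r / g) := by
    refine Finset.card_image_le.trans ?_
    rw [Finset.card_erase_of_mem (Finset.mem_Icc.2 ⟨neg_nonpos.2 (Int.natCast_nonneg _),
      Int.natCast_nonneg _⟩), Int.card_Icc]
    omega
  have h1 : pr (fun a : (ZMod n)ˣ => cabs ((a : ZMod n) * d) ≤ r) ≤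
      pr (fun a : (ZMod n)ˣ => a • d ∈ Y) := by
    refine pr_mono fun a ha => ?_
    have hsm : a • d = (a : ZMod n) * d := rfl
    rw [hsm]
    set y := (a : ZMod n) * d with hy
    have hy0 : y ≠ 0 := fun h => hd (by rwa [hy, Units.mul_right_eq_zero] at h)
    have hgy : (g : ℤ) ∣ y.valMinAbs := by
      have hgn : (g : ℤ) ∣ (n : ℤ) := Int.natCast_dvd_natCast.2 (Nat.gcd_dvd_right _ _)
      have hgd : (g : ℤ) ∣ (d.val : ℤ) := Int.natCast_dvd_natCast.2 (Nat.gcd_dvd_left _ _)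
      have hcong : ((y.valMinAbs : ℤ) : ZMod n) = (((a : ZMod n).val * d.val : ℤ) : ZMod n) := by
        rw [ZMod.coe_valMinAbs]
        push_cast
        rw [ZMod.natCast_zmod_val, ZMod.natCast_zmod_val]
      rw [ZMod.intCast_eq_intCast_iff] at hcong
      have h2 := hcong.dvd
      have h3 : (g : ℤ) ∣ ((a : ZMod n).val * d.val : ℤ) - y.valMinAbs := hgn.trans h2
      have h4 : (g : ℤ) ∣ ((a : ZMod n).val * d.val : ℤ) := Dvd.dvd.mul_left hgd _
      exact (dvd_sub_right h4).1 h3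
    obtain ⟨z, hz⟩ := hgy
    refine Finset.mem_image.2 ⟨z, ?_, ?_⟩
    · rw [Finset.mem_erase, Finset.mem_Icc]
      have hz0 : z ≠ 0 := by
        rintro rfl
        rw [mul_zero, ZMod.valMinAbs_eq_zero] at hz
        exact hy0 hz
      have hzabs : z.natAbs ≤ r / g := by
        rw [Nat.le_div_iff_mul_le hg0, mul_comm]
        have h5 : cabs y = g * z.natAbs := by
          unfold cabs; rw [hz, Int.natAbs_mul, Int.natAbs_natCast]
        rw [← h5]; exact ha
      exact ⟨hz0, by omega, by omega⟩
    · rw [← hz, ZMod.coe_valMinAbs]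
  have hφ : 0 < n'.totient := Nat.totient_pos.2 hn'0
  refine h1.trans ((pr_smul_mem_le d Y hφ horb).trans ?_)
  have hlog := le_totient_mul_log n' hn'0
  have hlog' : (n' : ℝ) ≤ n'.totient * (Nat.log 2 n + 1 : ℕ) := by
    have : n' ≤ n'.totient * (Nat.log 2 n + 1) :=
      hlog.trans (by gcongr)
    exact_mod_cast this
  have hYr : (Y.card : ℝ) * g ≤ 2 * r := by
    have : Y.card * g ≤ 2 * r := by
      calc Y.card * g ≤ 2 * (r / g) * g := by gcongr
        _ = 2 * (r / g * g) := by ring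
        _ ≤ 2 * r := by gcongr; exact Nat.div_mul_le_self r g
    exact_mod_cast this
  have hng : (n : ℝ) = g * n' := by exact_mod_cast hn'
  rw [div_le_div_iff₀ (by exact_mod_cast hφ) (by exact_mod_cast hn), hng]
  calc (Y.card : ℝ) * (g * n') = (Y.card * g) * n' := by ring
    _ ≤ 2 * r * (n'.totient * (Nat.log 2 n + 1 : ℕ)) := by gcongr
    _ = _ := by ring

/-- The number of ordered pairs of distinct elements of `M` whose dilates are at distance at most
`r`. -/
def collisions (M : Finset (ZMod n)) (r : ℕ) (a : (ZMod n)ˣ) : ℕ :=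
  ((M ×ˢ M).filter fun p => p.1 ≠ p.2 ∧ cabs ((a : ZMod n) * (p.1 - p.2)) ≤ r).card

/-- A random dilation brings few pairs of points close together. -/
lemma avg_collisions_le (M : Finset (ZMod n)) (r : ℕ) :
    avg (fun a => (collisions M r a : ℝ)) ≤
      (M.card : ℝ) ^ 2 * (2 * r * (Nat.log 2 n + 1 : ℕ) / n) := by
  classical
  have h : ∀ a, (collisions M r a : ℝ) = ∑ p ∈ M ×ˢ M,
      if p.1 ≠ p.2 ∧ cabs ((a : ZMod n) * (p.1 - p.2)) ≤ r then (1 : ℝ) else 0 := by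
    intro a
    rw [collisions, Finset.sum_boole]
  simp only [h]
  rw [avg_sum]
  refine (Finset.sum_le_sum (g := fun _ => (2 * r * (Nat.log 2 n + 1 : ℕ) / n : ℝ))
    fun p _ => ?_).trans ?_
  · by_cases hp : p.1 = p.2
    · simp only [hp, ne_eq, not_true_eq_false, false_and, if_false]
      rw [avg_const]
      positivity
    · refine le_trans (le_of_eq ?_) (pr_cabs_dilate_le (sub_ne_zero.2 hp) r)
      unfold pr
      congr 1
      funext a
      simp [hp]
  · rw [Finset.sum_const, Finset.card_product, nsmul_eq_mul]
    push_cast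
    rw [sq]

end Dilation

/-! ### Periods of words -/

section Periods

variable {Γ : Type} {ℓ : ℕ}

/-- `q` is a period of the word `w`. -/
def IsPeriod (w : Fin ℓ → Γ) (q : ℕ) : Prop := ∀ x y : Fin ℓ, (y : ℕ) = x + q → w x = w y

lemma exists_isPeriod (w : Fin ℓ → Γ) : ∃ q, 0 < q ∧ IsPeriod w q :=
  ⟨ℓ + 1, by omega, fun x y h => by have := y.2; omega⟩

open Classical in
/-- The least positive period of a word. -/
noncomputable def leastPeriod (w : Fin ℓ → Γ) : ℕ := Nat.find (exists_isPeriod w)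

lemma leastPeriod_pos (w : Fin ℓ → Γ) : 0 < leastPeriod w := by
  classical
  exact (Nat.find_spec (exists_isPeriod w)).1

lemma isPeriod_leastPeriod (w : Fin ℓ → Γ) : IsPeriod w (leastPeriod w) := by
  classical
  exact (Nat.find_spec (exists_isPeriod w)).2

lemma leastPeriod_le {w : Fin ℓ → Γ} {q : ℕ} (hq : 0 < q) (h : IsPeriod w q) :
    leastPeriod w ≤ q := by
  classical
  exact Nat.find_min' _ ⟨hq, h⟩

lemma leastPeriod_le_length (w : Fin ℓ → Γ) : leastPeriod w ≤ ℓ + 1 :=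
  leastPeriod_le (by omega) fun x y h => by have := y.2; omega

/-- A weak form of the theorem of Fine and Wilf: a short period is a multiple of the least one. -/
lemma leastPeriod_dvd {w : Fin ℓ → Γ} {η : ℕ} (h : IsPeriod w η) (hη : 2 * η ≤ ℓ) :
    leastPeriod w ∣ η := by
  induction η using Nat.strong_induction_on with
  | _ η ih =>
    rcases Nat.eq_zero_or_pos η with rfl | hpos
    · exact dvd_zero _
    · have hle := leastPeriod_le hpos h
      have hq := leastPeriod_pos w
      have hper : IsPeriod w (η - leastPeriod w) := by
        intro x y hxy
        by_cases hx : leastPeriod w ≤ x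
        · have h1 := isPeriod_leastPeriod w ⟨x - leastPeriod w, by omega⟩ x (by simp; omega)
          have h2 := h ⟨x - leastPeriod w, by omega⟩ y (by simp; omega)
          exact h1.symm.trans h2
        · have hlt : (x : ℕ) + η < ℓ := by omega
          have h1 := h x ⟨x + η, hlt⟩ rfl
          have h2 := isPeriod_leastPeriod w y ⟨x + η, hlt⟩ (by simp; omega)
          exact h1.trans h2.symm
      have := ih _ (by omega) hper (by omega)
      exact (Nat.dvd_sub_iff_left hle dvd_rfl).1 this

/-- A word with period `q` has equal letters at positions that differ by a multiple of `q`, of either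
sign. -/
lemma IsPeriod.eq_of_dvd {w : Fin ℓ → Γ} {q : ℕ} (h : IsPeriod w q) {x y : Fin ℓ}
    (hd : (q : ℤ) ∣ (y : ℤ) - x) : w x = w y := by
  have hmul : ∀ (k : ℕ) (x y : Fin ℓ), (y : ℕ) = x + k * q → w x = w y := by
    intro k
    induction k with
    | zero => intro x y hxy; congr 1; ext; simpa using hxy.symm
    | succ k ih =>
      intro x y hxy
      have hy := y.2
      have hlt : (x : ℕ) + k * q < ℓ := by nlinarith
      exact (ih x ⟨x + k * q, hlt⟩ rfl).trans (h _ y (by simp only [hxy]; ring))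
  obtain ⟨k, hk⟩ := hd
  rcases le_or_gt 0 k with h0 | h0
  · lift k to ℕ using h0
    refine hmul k x y ?_
    have : (y : ℤ) = x + k * q := by linarith
    exact_mod_cast this
  · obtain ⟨k', rfl⟩ : ∃ k' : ℕ, k = -(k' : ℤ) := ⟨k.natAbs, by omega⟩
    refine (hmul k' y x ?_).symm
    have : (x : ℤ) = y + k' * q := by linarith
    exact_mod_cast this

end Periods

/-! ### Minimum hashing -/

section MinHash

variable {α : Type} [Fintype α] [DecidableEq α] {N : ℕ}

lemma pr_comp_equiv {Ω : Type*} [Fintype Ω] (e : Ω ≃ Ω) (p : Ω → Prop) :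
    pr (fun ω => p (e ω)) = pr p := by
  classical
  unfold pr avg
  rw [Equiv.sum_comp e fun ω => if p ω then (1 : ℝ) else 0]

/-- A random function has a collision in `V` with probability at most `|V|² / N`. -/
lemma pr_not_injOn_le [NeZero N] (V : Finset α) :
    pr (fun φ : α → Fin N => ¬ Set.InjOn φ V) ≤ (V.card : ℝ) ^ 2 / N := by
  have h := pr_exists_le (Ω := α → Fin N) V.offDiag fun p φ => φ p.1 = φ p.2
  refine (pr_mono fun φ hφ => ?_).trans (h.trans ?_)
  · rw [Set.InjOn] at hφ
    push Not at hφ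
    obtain ⟨x, hx, y, hy, hxy, hne⟩ := hφ
    exact ⟨(x, y), Finset.mem_offDiag.2 ⟨hx, hy, hne⟩, hxy⟩
  · have h1 : ∀ p ∈ V.offDiag, pr (fun φ : α → Fin N => φ p.1 = φ p.2) = 1 / N := by
      intro p hp
      rw [pr_pi_eq (Finset.mem_offDiag.1 hp).2.2, Fintype.card_fin]
    rw [Finset.sum_congr rfl h1, Finset.sum_const, nsmul_eq_mul, mul_one_div]
    refine div_le_div_of_nonneg_right ?_ (Nat.cast_nonneg _)
    rw [Finset.offDiag_card, sq]
    exact_mod_cast Nat.sub_le _ _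

/-- By symmetry each element of `V` is the strict minimum of a random function with the same
probability. -/
lemma pr_strict_min_le [NeZero N] {V : Finset α} {c : α} (hc : c ∈ V) :
    pr (fun φ : α → Fin N => ∀ x ∈ V, x ≠ c → φ c < φ x) ≤ 1 / V.card := by
  classical
  have hsymm : ∀ d ∈ V, pr (fun φ : α → Fin N => ∀ x ∈ V, x ≠ d → φ d < φ x) =
      pr (fun φ : α → Fin N => ∀ x ∈ V, x ≠ c → φ c < φ x) := by
    intro d hd
    have hmem : ∀ x ∈ V, Equiv.swap c d x ∈ V := by
      intro x hx
      by_cases h1 : x = c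
      · rw [h1, Equiv.swap_apply_left]; exact hd
      · by_cases h2 : x = d
        · rw [h2, Equiv.swap_apply_right]; exact hc
        · rw [Equiv.swap_apply_of_ne_of_ne h1 h2]; exact hx
    rw [← pr_comp_equiv ((Equiv.swap c d).arrowCongr (Equiv.refl (Fin N)))]
    congr 1
    funext φ
    simp only [Equiv.arrowCongr_apply, Equiv.symm_swap, Function.comp, Equiv.coe_refl, id,
      Equiv.swap_apply_right, eq_iff_iff]
    constructor
    · intro h x hx hxc
      have := h (Equiv.swap c d x) (hmem x hx) (fun h' => hxc (by
        have := congrArg (Equiv.swap c d) h'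
        rwa [Equiv.swap_apply_self, Equiv.swap_apply_right] at this))
      rwa [Equiv.swap_apply_self] at this
    · intro h x hx hxd
      exact h (Equiv.swap c d x) (hmem x hx) (fun h' => hxd (by
        have := congrArg (Equiv.swap c d) h'
        rwa [Equiv.swap_apply_self, Equiv.swap_apply_left] at this))
  have hsum : ∑ d ∈ V, pr (fun φ : α → Fin N => ∀ x ∈ V, x ≠ d → φ d < φ x) ≤ 1 := by
    unfold pr
    rw [← avg_sum]
    refine le_of_le_of_eq (avg_mono (g := fun _ => 1) fun φ => ?_) (avg_const 1)
    refine (Finset.sum_congr rfl fun d _ => ?_ : _ = ∑ d ∈ V,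
      if ∀ x ∈ V, x ≠ d → φ d < φ x then (1 : ℝ) else 0).trans_le ?_
    · by_cases h : ∀ x ∈ V, x ≠ d → φ d < φ x
      · rw [if_pos h, if_pos h]
      · rw [if_neg h, if_neg h]
    rw [Finset.sum_boole]
    refine Nat.cast_le_one.2 (Finset.card_le_one.2 fun x hx y hy => ?_)
    rw [Finset.mem_filter] at hx hy
    by_contra hne
    exact absurd (hx.2 y hy.1 (Ne.symm hne)) (not_lt.2 (hy.2 x hx.1 hne).le)
  rw [Finset.sum_congr rfl hsymm, Finset.sum_const, nsmul_eq_mul] at hsum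
  have hV : (0 : ℝ) < V.card := by exact_mod_cast Finset.card_pos.2 ⟨c, hc⟩
  rw [le_div_iff₀ hV]
  linarith

/-- The minimum of a random function over `V` is attained in a subset `V'`, except with probability
`1 - |V'| / |V|` and the probability of a collision. -/
lemma pr_not_min_mem_le [NeZero N] {V' V : Finset α} (hsub : V' ⊆ V) (hne : V.Nonempty) :
    pr (fun φ : α → Fin N => ¬ (Set.InjOn φ V ∧ ∃ c ∈ V', ∀ x ∈ V, φ c ≤ φ x)) ≤
      (V.card : ℝ) ^ 2 / N + (1 - (V'.card : ℝ) / V.card) := by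
  classical
  have h1 := pr_exists_le (Ω := α → Fin N) (V \ V') fun c φ => ∀ x ∈ V, x ≠ c → φ c < φ x
  have h2 : ∑ c ∈ V \ V', pr (fun φ : α → Fin N => ∀ x ∈ V, x ≠ c → φ c < φ x) ≤
      1 - (V'.card : ℝ) / V.card := by
    refine (Finset.sum_le_sum fun c hc => pr_strict_min_le (Finset.mem_sdiff.1 hc).1).trans ?_
    have hV : (0 : ℝ) < V.card := by exact_mod_cast Finset.card_pos.2 hne
    rw [Finset.sum_const, nsmul_eq_mul, Finset.card_sdiff_of_subset hsub,
      Nat.cast_sub (Finset.card_le_card hsub), mul_one_div, sub_div, div_self hV.ne']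
  refine (pr_mono fun φ hφ => ?_).trans ((pr_or_le _ _).trans
    (add_le_add (pr_not_injOn_le V) (h1.trans h2)))
  by_cases hinj : Set.InjOn φ V
  · right
    obtain ⟨c, hc, hmin⟩ := V.exists_min_image φ hne
    have hcV' : c ∉ V' := fun h => hφ ⟨hinj, c, h, hmin⟩
    refine ⟨c, Finset.mem_sdiff.2 ⟨hc, hcV'⟩, fun x hx hxc => lt_of_le_of_ne (hmin x hx) ?_⟩
    exact fun h => hxc (hinj hx hc h.symm)
  · exact Or.inl hinj

end MinHash

/-- Along an increasing sequence of positive integers, the relative increments over two steps are small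
on average, since they telescope after taking logarithms. -/
lemma sum_one_sub_div_le {d : ℕ → ℕ} (hd : Monotone d) (h0 : 0 < d 0) (J : ℕ) :
    ∑ j ∈ Finset.range J, (1 - (d j : ℝ) / d (j + 2)) ≤ 2 * Real.log (d (J + 1)) := by
  have hpos : ∀ j, (0 : ℝ) < d j := fun j => by exact_mod_cast h0.trans_le (hd (Nat.zero_le j))
  have h1 : ∀ j, (1 - (d j : ℝ) / d (j + 2)) ≤ Real.log (d (j + 2)) - Real.log (d j) := by
    intro j
    have := Real.log_le_sub_one_of_pos (div_pos (hpos j) (hpos (j + 2)))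
    rw [Real.log_div (hpos _).ne' (hpos _).ne'] at this
    linarith
  have h2 : ∀ J, ∑ j ∈ Finset.range J, (Real.log (d (j + 2)) - Real.log (d j)) =
      Real.log (d (J + 1)) + Real.log (d J) - Real.log (d 1) - Real.log (d 0) := by
    intro J
    induction J with
    | zero => simp
    | succ J ih => rw [Finset.sum_range_succ, ih]; ring
  refine (Finset.sum_le_sum fun j _ => h1 j).trans ?_
  rw [h2]
  have hl : ∀ j, 0 ≤ Real.log (d j) := fun j =>
    Real.log_nonneg (by exact_mod_cast h0.trans_le (hd (Nat.zero_le j)))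
  have hm : Real.log (d J) ≤ Real.log (d (J + 1)) :=
    Real.log_le_log (hpos J) (by exact_mod_cast hd (Nat.le_succ J))
  linarith [hl 0, hl 1]

/-! ### Anchors -/

section Anchor

variable {Γ : Type} {ℓ N : ℕ}

/-- The word of length `ℓ` that starts at position `e` of the sequence `g`. -/
def word (ℓ : ℕ) (g : ℤ → Γ) (e : ℤ) : Fin ℓ → Γ := fun x => g (e + (x : ℕ))

lemma exists_anchor (φ : (Fin ℓ → Γ) → Fin N) (g : ℤ → Γ) (r : ℕ) :
    ∃ e ∈ Finset.Icc (-(r : ℤ)) r, ∀ e' ∈ Finset.Icc (-(r : ℤ)) r,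
      φ (word ℓ g e) ≤ φ (word ℓ g e') :=
  Finset.exists_min_image _ _ ⟨0, by simp⟩

/-- A position in `[-r, r]` whose word has the least hash value. -/
noncomputable def anchor (φ : (Fin ℓ → Γ) → Fin N) (g : ℤ → Γ) (r : ℕ) : ℤ :=
  (exists_anchor φ g r).choose

lemma anchor_mem (φ : (Fin ℓ → Γ) → Fin N) (g : ℤ → Γ) (r : ℕ) :
    -(r : ℤ) ≤ anchor φ g r ∧ anchor φ g r ≤ r :=
  Finset.mem_Icc.1 (exists_anchor φ g r).choose_spec.1

lemma anchor_le (φ : (Fin ℓ → Γ) → Fin N) (g : ℤ → Γ) (r : ℕ) {e : ℤ} (h1 : -(r : ℤ) ≤ e)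
    (h2 : e ≤ r) : φ (word ℓ g (anchor φ g r)) ≤ φ (word ℓ g e) :=
  (exists_anchor φ g r).choose_spec.2 e (Finset.mem_Icc.2 ⟨h1, h2⟩)

/-- Two sequences that contain the same word at positions which differ from the prescribed shift `τ`
by a multiple of its least period agree, up to the shift, on the inner part of the word. -/
lemma eq_of_word_eq {g₁ g₂ : ℤ → Γ} {e₁ e₂ τ : ℤ} (h : word ℓ g₁ e₁ = word ℓ g₂ e₂)
    (hd : (leastPeriod (word ℓ g₁ e₁) : ℤ) ∣ e₂ - e₁ - τ) {z : ℤ}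
    (hz1 : e₁ + |e₂ - e₁ - τ| ≤ z) (hz2 : z + |e₂ - e₁ - τ| < e₁ + ℓ) : g₁ z = g₂ (z + τ) := by
  set η := e₂ - e₁ - τ with hη
  have ha := neg_abs_le η
  have hb := le_abs_self η
  obtain ⟨x, hx⟩ : ∃ x : ℕ, (x : ℤ) = z - e₁ := ⟨(z - e₁).toNat, by omega⟩
  obtain ⟨y, hy⟩ : ∃ y : ℕ, (y : ℤ) = z - e₁ - η := ⟨(z - e₁ - η).toNat, by omega⟩
  have h1 : word ℓ g₁ e₁ ⟨x, by omega⟩ = g₁ z := by unfold word; congr 1; simp; omega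
  have h2 : word ℓ g₂ e₂ ⟨y, by omega⟩ = g₂ (z + τ) := by unfold word; congr 1; simp; omega
  rw [← h1, ← h2, ← h]
  refine (isPeriod_leastPeriod _).eq_of_dvd ?_
  simp only [hx, hy]
  rw [show z - e₁ - η - (z - e₁) = -η by ring]
  exact (dvd_neg).2 hd

open Classical in
/-- The words that start at distance at most `r` from the origin. -/
noncomputable def words (ℓ : ℕ) (g : ℤ → Γ) (r : ℕ) : Finset (Fin ℓ → Γ) :=
  (Finset.Icc (-(r : ℤ)) r).image (word ℓ g)

lemma word_mem_words {g : ℤ → Γ} {r : ℕ} {e : ℤ} (h1 : -(r : ℤ) ≤ e) (h2 : e ≤ r) :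
    word ℓ g e ∈ words ℓ g r := by
  classical
  exact Finset.mem_image_of_mem _ (Finset.mem_Icc.2 ⟨h1, h2⟩)

lemma words_nonempty (g : ℤ → Γ) (r : ℕ) : (words ℓ g r).Nonempty :=
  ⟨_, word_mem_words (e := 0) (by simp) (by simp)⟩

lemma words_mono (g : ℤ → Γ) {r s : ℕ} (h : r ≤ s) : words ℓ g r ⊆ words ℓ g s := by
  classical
  intro w hw
  obtain ⟨e, he, rfl⟩ := Finset.mem_image.1 hw
  obtain ⟨h1, h2⟩ := Finset.mem_Icc.1 he
  exact word_mem_words (by omega) (by omega)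

/-- If two sequences agree up to a shift by `τ` around the origin, and the least hash value over a
slightly larger range is attained in a slightly smaller range, then their anchors carry the same word,
and the positions of the anchors match up to a period of that word. -/
lemma anchors_agree {g₁ g₂ : ℤ → Γ} {τ : ℤ} {r δ : ℕ} {φ : (Fin ℓ → Γ) → Fin N}
    (hτ : |τ| ≤ δ) (hr : 4 * (r + 2 * δ) ≤ ℓ)
    (hclean : ∀ z : ℤ, -((r + 2 * δ : ℕ) : ℤ) ≤ z → z ≤ (r + 2 * δ + ℓ : ℕ) → g₁ z = g₂ (z + τ))
    (hinj : Set.InjOn φ (words ℓ g₁ (r + 2 * δ)))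
    (hmin : ∃ w ∈ words ℓ g₁ r, ∀ x ∈ words ℓ g₁ (r + 2 * δ), φ w ≤ φ x) :
    word ℓ g₁ (anchor φ g₁ (r + δ)) = word ℓ g₂ (anchor φ g₂ (r + δ)) ∧
      (leastPeriod (word ℓ g₁ (anchor φ g₁ (r + δ))) : ℤ) ∣
        anchor φ g₂ (r + δ) - anchor φ g₁ (r + δ) - τ := by
  classical
  obtain ⟨hτ1, hτ2⟩ := abs_le.1 hτ
  have hshift : ∀ e : ℤ, -((r + δ : ℕ) : ℤ) ≤ e → e ≤ (r + δ : ℕ) →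
      word ℓ g₂ e = word ℓ g₁ (e - τ) := by
    intro e h1 h2
    funext x
    have hx := x.2
    have := hclean (e - τ + (x : ℕ)) (by push_cast at *; omega) (by push_cast at *; omega)
    unfold word
    rw [this]
    congr 1
    ring
  obtain ⟨w, hw, hwmin⟩ := hmin
  obtain ⟨e₀, he₀, rfl⟩ := Finset.mem_image.1 hw
  obtain ⟨he1, he2⟩ := Finset.mem_Icc.1 he₀
  have hwV := words_mono g₁ (show r ≤ r + 2 * δ by omega) hw
  obtain ⟨ha1, ha2⟩ := anchor_mem φ g₁ (r + δ)
  obtain ⟨hb1, hb2⟩ := anchor_mem φ g₂ (r + δ)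
  set a := anchor φ g₁ (r + δ) with ha
  set b := anchor φ g₂ (r + δ) with hb
  have haV : word ℓ g₁ a ∈ words ℓ g₁ (r + 2 * δ) :=
    word_mem_words (by push_cast at *; omega) (by push_cast at *; omega)
  have hbV : word ℓ g₁ (b - τ) ∈ words ℓ g₁ (r + 2 * δ) :=
    word_mem_words (by push_cast at *; omega) (by push_cast at *; omega)
  have h1 : word ℓ g₁ a = word ℓ g₁ e₀ := by
    refine hinj haV hwV (le_antisymm ?_ (hwmin _ haV))
    exact anchor_le φ g₁ (r + δ) (by push_cast at *; omega) (by push_cast at *; omega)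
  have h2 : word ℓ g₁ (b - τ) = word ℓ g₁ e₀ := by
    refine hinj hbV hwV (le_antisymm ?_ (hwmin _ hbV))
    have := anchor_le φ g₂ (r + δ) (e := e₀ + τ) (by push_cast at *; omega)
      (by push_cast at *; omega)
    rw [← hb, hshift b hb1 hb2,
      hshift (e₀ + τ) (by push_cast at *; omega) (by push_cast at *; omega)] at this
    rwa [add_sub_cancel_right] at this
  have h3 : word ℓ g₁ a = word ℓ g₁ (b - τ) := h1.trans h2.symm
  refine ⟨by rw [hshift b hb1 hb2]; exact h3, ?_⟩
  -- the same word occurs at distance `|b - a - τ|` from itself, so this distance is a period of it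
  have hper : IsPeriod (word ℓ g₁ a) (b - a - τ).natAbs := by
    intro x y hxy
    rcases le_total 0 (b - a - τ) with hs | hs
    · have : word ℓ g₁ (b - τ) x = word ℓ g₁ a y := by
        unfold word; congr 1; omega
      rw [← this, h3]
    · have : word ℓ g₁ a x = word ℓ g₁ (b - τ) y := by
        unfold word; congr 1; omega
      rw [this, h3]
  have hlen : 2 * (b - a - τ).natAbs ≤ ℓ := by push_cast at *; omega
  exact Int.natCast_dvd.2 (leastPeriod_dvd hper hlen)

end Anchor

/-! ### The gap test -/

section Overlap

variable {n : ℕ} [NeZero n]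

open Classical in
/-- If the dilates of two points of `M` are close whenever their sets overlap, then the number of
overlaps is controlled by the number of collisions. -/
lemma sum_overlap_le (M : Finset (ZMod n)) (I : ZMod n → Finset (ZMod n)) (a : (ZMod n)ˣ) {r w : ℕ}
    (hw : ∀ x, (I x).card ≤ w)
    (hcl : ∀ x ∈ M, ∀ y ∈ M, ∀ u, u ∈ I x → u ∈ I y → cabs ((a : ZMod n) * (x - y)) ≤ r) :
    ∑ u, (M.filter fun x => u ∈ I x).card * ((M.filter fun x => u ∈ I x).card - 1) ≤
      w * collisions M r a := by
  set K := (M ×ˢ M).filter fun p => p.1 ≠ p.2 ∧ cabs ((a : ZMod n) * (p.1 - p.2)) ≤ r with hK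
  have h1 : ∀ u, (M.filter fun x => u ∈ I x).card * ((M.filter fun x => u ∈ I x).card - 1) ≤
      (K.filter fun p => u ∈ I p.1).card := by
    intro u
    rw [Nat.mul_sub, mul_one, ← Finset.offDiag_card]
    refine Finset.card_le_card fun p hp => ?_
    obtain ⟨hp1, hp2, hne⟩ := Finset.mem_offDiag.1 hp
    rw [Finset.mem_filter] at hp1 hp2
    refine Finset.mem_filter.2 ⟨Finset.mem_filter.2 ⟨Finset.mem_product.2 ⟨hp1.1, hp2.1⟩, hne, ?_⟩,
      hp1.2⟩
    exact hcl _ hp1.1 _ hp2.1 u hp1.2 hp2.2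
  calc _ ≤ ∑ u, (K.filter fun p => u ∈ I p.1).card := Finset.sum_le_sum fun u _ => h1 u
    _ = ∑ u, ∑ p ∈ K, if u ∈ I p.1 then 1 else 0 := by
        simp only [Finset.card_filter]
    _ = ∑ p ∈ K, (I p.1).card := by
        rw [Finset.sum_comm]
        refine Finset.sum_congr rfl fun p _ => ?_
        simp
    _ ≤ ∑ p ∈ K, w := Finset.sum_le_sum fun p _ => hw _
    _ = w * collisions M r a := by
        rw [Finset.sum_const, smul_eq_mul, mul_comm, hK, collisions]

end Overlap

section GapScheme

variable {n : ℕ} [NeZero n] {Γ : Type}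

/-- The string `S`, dilated by the unit `a` and read from the point `y` of the circle. -/
def seqFrom (a : (ZMod n)ˣ) (S : ZMod n → Γ) (y : ZMod n) : ℤ → Γ :=
  fun z => S (((a⁻¹ : (ZMod n)ˣ) : ZMod n) * (y + z))

/-- The local equality test. The message about a cell is the position of the anchor near the start of
the cell, the hash value of the word there, and its least period; the value is `0` if the hash values
agree and the positions match up to the period, and `1` otherwise. The range of positions in which the
anchor is sought is random. -/
noncomputable def gapScheme (n : ℕ) (Γ : Type) [Fintype Γ] (ℓ δ J N : ℕ) [NeZero n] [NeZero J]
    [NeZero N] : LocalScheme n Γ where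
  Ω := (ZMod n)ˣ × (((Fin ℓ → Γ) → Fin N) × Fin J)
  fin := by classical infer_instance
  ne := inferInstance
  unit ω := ω.1
  Msg := Finset.Icc (-((J * δ : ℕ) : ℤ)) ((J * δ : ℕ) : ℤ) × Fin N × Fin (ℓ + 2)
  finMsg := inferInstance
  msg ω S i :=
    let g := seqFrom ω.1 S ((i * δ : ℕ) : ZMod n)
    let e := anchor ω.2.1 g (ω.2.2 * δ + δ)
    (⟨e, by
      have h := anchor_mem ω.2.1 g (ω.2.2 * δ + δ)
      have hJ : (ω.2.2 : ℕ) * δ + δ ≤ J * δ := by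
        have := Nat.mul_le_mul_right δ (Nat.succ_le_of_lt ω.2.2.2)
        rwa [Nat.succ_mul] at this
      rw [Finset.mem_Icc]
      omega⟩, ω.2.1 (word ℓ g e), ⟨leastPeriod (word ℓ g e), by
        have := leastPeriod_le_length (word ℓ g e); omega⟩)
  val _ x y t t' :=
    if x.2.1 = y.2.1 ∧ (x.2.2 : ℤ) ∣ y.1 - x.1 - ((t' : ℤ) - t) then 0 else 1

variable [Fintype Γ] {ℓ δ J N : ℕ} [NeZero J] [NeZero N]

lemma gapScheme_X_nonneg (c : ℕ) (S₁ S₂ : ZMod n → Γ) (m : ZMod n)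
    (ω : (gapScheme n Γ ℓ δ J N).Ω) (u : ZMod n) :
    0 ≤ (gapScheme n Γ ℓ δ J N).X c S₁ S₂ m ω u := by
  simp only [LocalScheme.X, gapScheme]
  split_ifs <;> norm_num

lemma gapScheme_X_le_one (c : ℕ) (S₁ S₂ : ZMod n → Γ) (m : ZMod n)
    (ω : (gapScheme n Γ ℓ δ J N).Ω) (u : ZMod n) :
    (gapScheme n Γ ℓ δ J N).X c S₁ S₂ m ω u ≤ 1 := by
  simp only [LocalScheme.X, gapScheme]
  split_ifs <;> norm_num

lemma cast_div_mul_eq (u : ZMod n) (δ : ℕ) :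
    ((u.val / δ * δ : ℕ) : ZMod n) = u - ((u.val % δ : ℕ) : ZMod n) := by
  rw [eq_sub_iff_add_eq, ← Nat.cast_add, Nat.div_add_mod', ZMod.natCast_zmod_val]

omit [Fintype Γ] in
/-- The sequence of `S₁` read from the cell of `u` and that of `S₂` read from the cell of the image of
`u` agree at corresponding places exactly where there is no mismatch. -/
lemma seqFrom_eq_iff (a : (ZMod n)ˣ) (S₁ S₂ : ZMod n → Γ) (m u : ZMod n) (z : ℤ) :
    seqFrom a S₁ ((u.val / δ * δ : ℕ) : ZMod n) z =
      seqFrom a S₂ (((u + a * m).val / δ * δ : ℕ) : ZMod n)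
        (z + ((((u + a * m).val % δ : ℕ) : ℤ) - ((u.val % δ : ℕ) : ℤ))) ↔
    ((a⁻¹ : (ZMod n)ˣ) : ZMod n) * (u + ((z - ((u.val % δ : ℕ) : ℤ) : ℤ) : ZMod n)) ∉
      mism S₁ S₂ m := by
  rw [mem_mism, not_not]
  have h1 : ((a⁻¹ : (ZMod n)ˣ) : ZMod n) * (((u.val / δ * δ : ℕ) : ZMod n) + (z : ZMod n)) =
      ((a⁻¹ : (ZMod n)ˣ) : ZMod n) * (u + ((z - ((u.val % δ : ℕ) : ℤ) : ℤ) : ZMod n)) := by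
    rw [cast_div_mul_eq]
    congr 1
    simp only [Int.cast_sub, Int.cast_natCast]
    ring
  have h2 : ((a⁻¹ : (ZMod n)ˣ) : ZMod n) * ((((u + a * m).val / δ * δ : ℕ) : ZMod n) +
      ((z + ((((u + a * m).val % δ : ℕ) : ℤ) - ((u.val % δ : ℕ) : ℤ)) : ℤ) : ZMod n)) =
      ((a⁻¹ : (ZMod n)ˣ) : ZMod n) * (u + ((z - ((u.val % δ : ℕ) : ℤ) : ℤ) : ZMod n)) + m := by
    rw [cast_div_mul_eq]
    have : ((a⁻¹ : (ZMod n)ˣ) : ZMod n) * ((a : ZMod n) * m) = m := Units.inv_mul_cancel_left a m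
    simp only [Int.cast_sub, Int.cast_add, Int.cast_natCast]
    linear_combination this
  unfold seqFrom
  rw [h1, h2]

open Classical in
/-- All words that occur in the dilated string. -/
noncomputable def allWords (ℓ : ℕ) (a : (ZMod n)ˣ) (S : ZMod n → Γ) : Finset (Fin ℓ → Γ) :=
  Finset.univ.image fun y => word ℓ (seqFrom a S y) 0

omit [Fintype Γ] in
lemma word_mem_allWords (a : (ZMod n)ˣ) (S : ZMod n → Γ) (y : ZMod n) (e : ℤ) :
    word ℓ (seqFrom a S y) e ∈ allWords ℓ a S := by
  classical
  refine Finset.mem_image.2 ⟨y + e, Finset.mem_univ _, ?_⟩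
  funext x
  simp only [word, seqFrom]
  congr 2
  push_cast
  ring

omit [Fintype Γ] in
lemma card_allWords_le (a : (ZMod n)ˣ) (S : ZMod n → Γ) : (allWords ℓ a S).card ≤ n := by
  classical
  refine Finset.card_image_le.trans ?_
  rw [Finset.card_univ, ZMod.card]

omit [Fintype Γ] in
lemma words_subset_allWords (a : (ZMod n)ˣ) (S : ZMod n → Γ) (y : ZMod n) (r : ℕ) :
    words ℓ (seqFrom a S y) r ⊆ allWords ℓ a S := by
  classical
  intro w hw
  obtain ⟨e, _, rfl⟩ := Finset.mem_image.1 hw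
  exact word_mem_allWords a S y e

/-- Soundness of the local test: if it accepts at `u` then there is no mismatch in the middle part of
the window at `u`. -/
lemma gapScheme_sound (hδ : 0 < δ) (hℓ : ℓ = 16 * ((J + 1) * δ)) {S₁ S₂ : ZMod n → Γ} {m : ZMod n}
    {ω : (gapScheme n Γ ℓ δ J N).Ω}
    (hinj : Set.InjOn ω.2.1 (allWords ℓ ω.1 S₁ ∪ allWords ℓ ω.1 S₂ : Set (Fin ℓ → Γ)))
    {u : ZMod n} (hu : (gapScheme n Γ ℓ δ J N).X δ S₁ S₂ m ω u ≠ 1) {v : ℕ}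
    (hv1 : 4 * ((J + 1) * δ) ≤ v) (hv2 : v < 12 * ((J + 1) * δ)) :
    ((ω.1⁻¹ : (ZMod n)ˣ) : ZMod n) * (u + (v : ZMod n)) ∉ mism S₁ S₂ m := by
  obtain ⟨a, φ, j⟩ := ω
  simp only [LocalScheme.X, gapScheme] at hu
  simp only at hinj ⊢
  set g₁ := seqFrom a S₁ ((u.val / δ * δ : ℕ) : ZMod n) with hg₁
  set g₂ := seqFrom a S₂ (((u + a * m).val / δ * δ : ℕ) : ZMod n) with hg₂
  set t := u.val % δ
  set t' := (u + a * m).val % δ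
  have ht : t < δ := Nat.mod_lt _ hδ
  have ht' : t' < δ := Nat.mod_lt _ hδ
  obtain ⟨hφ, hdvd⟩ : φ (word ℓ g₁ (anchor φ g₁ (j * δ + δ))) =
      φ (word ℓ g₂ (anchor φ g₂ (j * δ + δ))) ∧
      (leastPeriod (word ℓ g₁ (anchor φ g₁ (j * δ + δ))) : ℤ) ∣
        anchor φ g₂ (j * δ + δ) - anchor φ g₁ (j * δ + δ) - ((t' : ℤ) - t) :=
    not_not.1 (mt (fun h => if_neg h) hu)
  have hw := hinj (Or.inl (word_mem_allWords a S₁ _ _)) (Or.inr (word_mem_allWords a S₂ _ _)) hφ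
  obtain ⟨ha1, ha2⟩ := anchor_mem φ g₁ (j * δ + δ)
  obtain ⟨hb1, hb2⟩ := anchor_mem φ g₂ (j * δ + δ)
  have hJ : (j : ℕ) * δ + δ ≤ J * δ := by
    have := Nat.mul_le_mul_right δ (Nat.succ_le_of_lt j.2)
    rwa [Nat.succ_mul] at this
  rw [show (J + 1) * δ = J * δ + δ by ring] at hℓ hv1 hv2
  have habs : |anchor φ g₂ (j * δ + δ) - anchor φ g₁ (j * δ + δ) - ((t' : ℤ) - t)| ≤
      2 * ((J * δ : ℕ) : ℤ) + δ := abs_le.2 (by constructor <;> omega)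
  have key := eq_of_word_eq (τ := (t' : ℤ) - t) (z := (v : ℤ) + t) hw hdvd (by omega) (by omega)
  have key' := (seqFrom_eq_iff a S₁ S₂ m u _).1 key
  rwa [add_sub_cancel_right, Int.cast_natCast] at key'

open Classical in
/-- Completeness of the local test: if there is no mismatch near `u` then it rejects with small
probability. -/
lemma gapScheme_complete (hδ : 0 < δ) (hℓ : ℓ = 16 * ((J + 1) * δ))
    {S₁ S₂ : ZMod n → Γ} {m : ZMod n} {a : (ZMod n)ˣ} {u : ZMod n}
    (hclean : ∀ v : ℤ, -(ℓ : ℤ) ≤ v → v ≤ 2 * ℓ →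
      ((a⁻¹ : (ZMod n)ˣ) : ZMod n) * (u + (v : ZMod n)) ∉ mism S₁ S₂ m) :
    avg (fun ω' : ((Fin ℓ → Γ) → Fin N) × Fin J =>
      (gapScheme n Γ ℓ δ J N).X δ S₁ S₂ m (a, ω') u) ≤
      (n : ℝ) ^ 2 / N + 2 * (Nat.log 2 n + 1 : ℕ) / J := by
  set g₁ := seqFrom a S₁ ((u.val / δ * δ : ℕ) : ZMod n) with hg₁
  set g₂ := seqFrom a S₂ (((u + a * m).val / δ * δ : ℕ) : ZMod n) with hg₂
  set t := u.val % δ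
  set t' := (u + a * m).val % δ
  have ht : t < δ := Nat.mod_lt _ hδ
  have ht' : t' < δ := Nat.mod_lt _ hδ
  have hJ0 : (0 : ℝ) < J := by exact_mod_cast NeZero.pos J
  rw [show (J + 1) * δ = J * δ + δ by ring] at hℓ
  set d : ℕ → ℕ := fun j => (words ℓ g₁ (j * δ)).card with hd
  have hdmono : Monotone d := fun i j hij =>
    Finset.card_le_card (words_mono g₁ (Nat.mul_le_mul_right δ hij))
  have hd0 : ∀ j, 0 < d j := fun j => Finset.card_pos.2 (words_nonempty g₁ _)
  have hdn : ∀ j, d j ≤ n := fun j =>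
    (Finset.card_le_card (words_subset_allWords a S₁ _ _)).trans (card_allWords_le a S₁)
  have hj : ∀ j : Fin J, avg (fun φ : (Fin ℓ → Γ) → Fin N =>
      (gapScheme n Γ ℓ δ J N).X δ S₁ S₂ m (a, φ, j) u) ≤
      (n : ℝ) ^ 2 / N + (1 - (d j : ℝ) / d (j + 2)) := by
    intro j
    have hJ : (j : ℕ) * δ + δ ≤ J * δ := by
      have := Nat.mul_le_mul_right δ (Nat.succ_le_of_lt j.2)
      rwa [Nat.succ_mul] at this
    have e2 : ((j : ℕ) + 2) * δ = j * δ + 2 * δ := by ring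
    have h1 := pr_not_min_mem_le (N := N)
      (words_mono (ℓ := ℓ) g₁ (show (j : ℕ) * δ ≤ j * δ + 2 * δ by omega)) (words_nonempty g₁ _)
    have h2 : (((words ℓ g₁ (j * δ + 2 * δ)).card : ℕ) : ℝ) ^ 2 / N ≤ (n : ℝ) ^ 2 / N := by
      have := hdn (j + 2)
      simp only [hd, e2] at this
      gcongr
    simp only [hd, e2]
    refine le_trans ?_ (h1.trans (by linarith))
    unfold pr
    refine avg_mono fun φ => ?_
    by_cases hgood : Set.InjOn φ (words ℓ g₁ (j * δ + 2 * δ)) ∧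
        ∃ c ∈ words ℓ g₁ (j * δ), ∀ x ∈ words ℓ g₁ (j * δ + 2 * δ), φ c ≤ φ x
    · rw [if_neg (not_not.2 hgood)]
      have hag := anchors_agree (g₁ := g₁) (g₂ := g₂) (τ := (t' : ℤ) - t) (r := j * δ) (δ := δ)
        (φ := φ) (abs_le.2 (by constructor <;> omega)) (by omega) (fun z hz1 hz2 => by
          rw [hg₁, hg₂, seqFrom_eq_iff]
          refine hclean _ ?_ ?_
          · push_cast at *; omega
          · push_cast at *; omega) hgood.1 hgood.2
      refine le_of_eq ?_
      simp only [LocalScheme.X, gapScheme]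
      exact if_pos ⟨congrArg φ hag.1, hag.2⟩
    · rw [if_pos hgood]
      exact gapScheme_X_le_one δ S₁ S₂ m _ u
  rw [avg_prod_swap]
  refine (avg_mono hj).trans ?_
  rw [avg_add, avg_const]
  gcongr
  unfold avg
  rw [Fintype.card_fin, Fin.sum_univ_eq_sum_range (fun j => 1 - (d j : ℝ) / d (j + 2))]
  gcongr
  refine (sum_one_sub_div_le hdmono (hd0 0) J).trans ?_
  gcongr
  have hn : (0 : ℝ) < n := by exact_mod_cast NeZero.pos n
  calc Real.log (d (J + 1)) ≤ Real.log n :=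
        Real.log_le_log (by exact_mod_cast hd0 _) (by exact_mod_cast hdn _)
    _ ≤ Real.log ((2 : ℝ) ^ (Nat.log 2 n + 1)) := by
        refine Real.log_le_log hn ?_
        exact_mod_cast (Nat.lt_pow_succ_log_self (by norm_num) n).le
    _ = (Nat.log 2 n + 1 : ℕ) * Real.log 2 := by rw [Real.log_pow]
    _ ≤ (Nat.log 2 n + 1 : ℕ) * 1 := by
        gcongr
        exact (Real.log_le_sub_one_of_pos (by norm_num)).trans (by norm_num)
    _ = _ := mul_one _

open Classical in
/-- If there are few mismatches then the local test rejects at few points on average. -/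
lemma gapScheme_avg_le (hδ : 0 < δ) (hℓ : ℓ = 16 * ((J + 1) * δ))
    (S₁ S₂ : ZMod n → Γ) (m : ZMod n) :
    avg (fun ω => ∑ u, (gapScheme n Γ ℓ δ J N).X δ S₁ S₂ m ω u) ≤
      (mism S₁ S₂ m).card * (3 * ℓ + 1 : ℕ) +
        n * ((n : ℝ) ^ 2 / N + 2 * (Nat.log 2 n + 1 : ℕ) / J) := by
  set q := (n : ℝ) ^ 2 / N + 2 * (Nat.log 2 n + 1 : ℕ) / J with hq
  have hq0 : 0 ≤ q := by positivity
  change avg (fun ω : (ZMod n)ˣ × (((Fin ℓ → Γ) → Fin N) × Fin J) =>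
    ∑ u, (gapScheme n Γ ℓ δ J N).X δ S₁ S₂ m ω u) ≤ _
  rw [avg_prod, ← avg_const (Ω := (ZMod n)ˣ) ((mism S₁ S₂ m).card * (3 * ℓ + 1 : ℕ) + n * q)]
  refine avg_mono fun a => ?_
  rw [avg_sum]
  -- the points that have a dilated mismatch nearby
  set D : Finset (ZMod n) := (mism S₁ S₂ m ×ˢ Finset.Icc (-(ℓ : ℤ)) (2 * ℓ)).image
    fun p => (a : ZMod n) * p.1 - (p.2 : ZMod n)
  have hDcard : D.card ≤ (mism S₁ S₂ m).card * (3 * ℓ + 1) := by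
    refine Finset.card_image_le.trans ?_
    rw [Finset.card_product, Int.card_Icc]
    refine Nat.mul_le_mul_left _ ?_
    omega
  have hu : ∀ u, avg (fun ω' : ((Fin ℓ → Γ) → Fin N) × Fin J =>
      (gapScheme n Γ ℓ δ J N).X δ S₁ S₂ m (a, ω') u) ≤ (if u ∈ D then (1 : ℝ) else 0) + q := by
    intro u
    by_cases hD : u ∈ D
    · rw [if_pos hD, ← avg_const (Ω := ((Fin ℓ → Γ) → Fin N) × Fin J) (1 + q)]
      refine avg_mono fun ω' => (gapScheme_X_le_one δ S₁ S₂ m _ u).trans (by linarith)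
    · rw [if_neg hD, zero_add]
      refine gapScheme_complete hδ hℓ fun v hv1 hv2 hmem => hD ?_
      refine Finset.mem_image.2 ⟨(_, v), Finset.mem_product.2 ⟨hmem, Finset.mem_Icc.2 ⟨hv1, hv2⟩⟩,
        ?_⟩
      simp only [Units.mul_inv_cancel_left]
      ring
  refine (Finset.sum_le_sum fun u _ => hu u).trans ?_
  rw [Finset.sum_add_distrib, Finset.sum_boole, Finset.sum_const, Finset.card_univ, ZMod.card,
    nsmul_eq_mul]
  gcongr
  rw [Finset.filter_mem_eq_inter, Finset.univ_inter]
  exact_mod_cast hDcard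

open Classical in
/-- If there are many mismatches then the local test rejects at many points: the windows that contain
one of them cover a large part of the circle unless many dilated mismatches are close to each other. -/
lemma le_sum_gapScheme_X (hδ : 0 < δ) (hℓ : ℓ = 16 * ((J + 1) * δ)) (hn : ℓ ≤ n)
    {S₁ S₂ : ZMod n → Γ} {m : ZMod n} {ω : (gapScheme n Γ ℓ δ J N).Ω}
    (hinj : Set.InjOn ω.2.1 (allWords ℓ ω.1 S₁ ∪ allWords ℓ ω.1 S₂ : Set (Fin ℓ → Γ)))
    {M : Finset (ZMod n)} (hM : M ⊆ mism S₁ S₂ m) :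
    (8 * ((J + 1) * δ) : ℕ) * ((M.card : ℝ) - collisions M (8 * ((J + 1) * δ)) ω.1) ≤
      ∑ u, (gapScheme n Γ ℓ δ J N).X δ S₁ S₂ m ω u := by
  set lam := 4 * ((J + 1) * δ) with hlam
  have e8 : 8 * ((J + 1) * δ) = 2 * lam := by omega
  rw [e8]
  set a : (ZMod n)ˣ := ω.1
  -- the points whose window contains the dilated mismatch `a * x` in its middle part
  set I : ZMod n → Finset (ZMod n) := fun x =>
    (Finset.range (2 * lam)).image fun v => (a : ZMod n) * x - ((lam + v : ℕ) : ZMod n) with hI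
  have hIcard : ∀ x, (I x).card = 2 * lam := by
    intro x
    rw [hI, Finset.card_image_of_injOn, Finset.card_range]
    intro v hv w hw hvw
    simp only [Finset.coe_range, Set.mem_Iio] at hv hw
    have h1 : ((lam + v : ℕ) : ZMod n) = ((lam + w : ℕ) : ZMod n) := sub_right_injective hvw
    rw [ZMod.natCast_eq_natCast_iff] at h1
    have h2 := Nat.ModEq.add_left_cancel' lam h1
    exact Nat.ModEq.eq_of_lt_of_lt h2 (by omega) (by omega)
  have hover := sum_overlap_le M I a (r := 2 * lam) (fun x => (hIcard x).le) (by
    intro x _ y _ u hux huy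
    obtain ⟨v, hv, hv'⟩ := Finset.mem_image.1 hux
    obtain ⟨w, hw, hw'⟩ := Finset.mem_image.1 huy
    rw [Finset.mem_range] at hv hw
    have : (a : ZMod n) * (x - y) = (((v : ℤ) - w : ℤ) : ZMod n) := by
      have h := hv'.trans hw'.symm
      push_cast at h ⊢
      linear_combination h
    rw [this]
    refine (cabs_intCast_le _).trans ?_
    omega)
  -- a point in `k` of these sets is counted with weight `k ≤ 1 + k * (k - 1)`
  have hcov : ∀ u, ((M.filter fun x => u ∈ I x).card : ℝ) ≤
      (gapScheme n Γ ℓ δ J N).X δ S₁ S₂ m ω u +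
      (((M.filter fun x => u ∈ I x).card * ((M.filter fun x => u ∈ I x).card - 1) : ℕ) : ℝ) := by
    intro u
    rcases (M.filter fun x => u ∈ I x).eq_empty_or_nonempty with h0 | ⟨x, hx⟩
    · simp only [h0, Finset.card_empty, Nat.cast_zero, zero_mul, add_zero]
      exact gapScheme_X_nonneg δ S₁ S₂ m ω u
    · have hX : (gapScheme n Γ ℓ δ J N).X δ S₁ S₂ m ω u = 1 := by
        by_contra hne
        obtain ⟨hxM, hxI⟩ := Finset.mem_filter.1 hx
        obtain ⟨v, hv, hv'⟩ := Finset.mem_image.1 hxI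
        rw [Finset.mem_range] at hv
        refine gapScheme_sound hδ hℓ hinj hne (v := lam + v) (by omega) (by omega) ?_
        rw [← hv', sub_add_cancel, Units.inv_mul_cancel_left]
        exact hM hxM
      have hpos := Finset.card_pos.2 ⟨x, hx⟩
      rw [hX]
      set k := (M.filter fun x => u ∈ I x).card
      have : k ≤ 1 + k * (k - 1) := by
        obtain ⟨k', hk'⟩ : ∃ k', k = k' + 1 := ⟨k - 1, by omega⟩
        rw [hk', Nat.add_sub_cancel]
        nlinarith
      exact_mod_cast this
  have hsum := Finset.sum_le_sum fun u (_ : u ∈ Finset.univ) => hcov u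
  rw [Finset.sum_add_distrib] at hsum
  have hcount : ∑ u, ((M.filter fun x => u ∈ I x).card : ℝ) = M.card * (2 * lam : ℕ) := by
    have : ∑ u, (M.filter fun x => u ∈ I x).card = M.card * (2 * lam) := by
      simp only [Finset.card_filter]
      rw [Finset.sum_comm, Finset.sum_congr rfl (g := fun _ => 2 * lam), Finset.sum_const,
        smul_eq_mul]
      intro x _
      rw [← hIcard x]
      simp
    exact_mod_cast this
  rw [hcount] at hsum
  have hover' : (∑ u, (((M.filter fun x => u ∈ I x).card *
      ((M.filter fun x => u ∈ I x).card - 1) : ℕ) : ℝ)) ≤ (2 * lam : ℕ) * collisions M (2 * lam) a := by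
    exact_mod_cast hover
  linarith

end GapScheme

/-! ### Parameters of the gap test -/

/-- The number of ranges among which the anchors of the gap test choose, of which all but about `log n`
are harmless. A local test with no mismatch nearby rejects with probability about `2 * L / gapJ L`;
these rejections have to stay below those caused by mismatches, whose windows cover a part of the
circle of order `1 / L ^ 2`, by a further factor of order `L`. -/
def gapJ (L : ℕ) : ℕ := 2 ^ 23 * L ^ 4

/-- The ratio of the two distances that the gap test distinguishes. Up to a factor `2`, it is also the
number of cells per unit of `κ`, and the windows are `16 * (gapJ L + 1)` cells long. -/
def gapRatio (L : ℕ) : ℕ := 2 ^ 26 * L ^ 3 * (gapJ L + 1)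

/-- The empty message. -/
lemma exists_zero_protocol (n : ℕ) [NeZero n] (Γ : Type) :
    ∃ P : Protocol n Γ, P.HasBits 0 ∧ ∀ S₁ S₂ m ω, P.out S₁ S₂ m ω = 0 :=
  ⟨⟨Unit, inferInstance, inferInstance, fun _ => Unit, fun _ => inferInstance, fun _ _ => (),
    fun _ _ _ _ => 0⟩, fun _ => le_of_eq (Fintype.card_unit), fun _ _ _ _ => rfl⟩

lemma natCast_le_two_pow_log (n : ℕ) : n ≤ 2 ^ (Nat.log 2 n + 1) :=
  (Nat.lt_pow_succ_log_self (by norm_num) n).le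

/-- The messages of the gap test about one cell have `O(log n)` bits. -/
lemma card_gapScheme_Msg_le {n : ℕ} [NeZero n] (Γ : Type) [Fintype Γ] {L ℓ δ J N : ℕ} [NeZero J]
    [NeZero N] (hL1 : 1 ≤ L) (hn2L : n ≤ 2 ^ L) (hδ : 0 < δ) (hℓ : ℓ = 16 * ((J + 1) * δ))
    (hℓn' : ℓ ≤ n) (hN : N = 2 ^ 22 * L ^ 3 * n ^ 2) :
    Fintype.card (gapScheme n Γ ℓ δ J N).Msg ≤ 2 ^ (30 * L) := by
  have hcard : Fintype.card (gapScheme n Γ ℓ δ J N).Msg = (2 * (J * δ) + 1) * (N * (ℓ + 2)) := by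
    change Fintype.card (Finset.Icc (-((J * δ : ℕ) : ℤ)) ((J * δ : ℕ) : ℤ) × Fin N ×
      Fin (ℓ + 2)) = _
    rw [Fintype.card_prod, Fintype.card_prod, Fintype.card_fin, Fintype.card_fin,
      Fintype.card_coe, Int.card_Icc]
    congr 1
    omega
  have hJδ : 2 * (J * δ) + 1 ≤ 2 ^ L := by
    refine le_trans ?_ (hℓn'.trans hn2L)
    rw [hℓ]
    have h : (J + 1) * δ = J * δ + δ := Nat.succ_mul J δ
    omega
  have hℓ2 : ℓ + 2 ≤ 2 ^ (L + 1) := by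
    rw [pow_succ]; omega
  have hL2 : L ≤ 2 ^ L := Nat.lt_two_pow_self.le
  have hN2 : N ≤ 2 ^ 22 * (2 ^ L) ^ 3 * (2 ^ L) ^ 2 := by
    rw [hN]; gcongr
  rw [hcard]
  calc _ ≤ 2 ^ L * (2 ^ 22 * (2 ^ L) ^ 3 * (2 ^ L) ^ 2 * 2 ^ (L + 1)) := by gcongr
    _ = 2 ^ (23 + 7 * L) := by ring
    _ ≤ 2 ^ (30 * L) := Nat.pow_le_pow_right (by norm_num) (by omega)

/-- There are about `z = (J + 1) * κ` cells up to logarithms, kept with rate about `1 / √z`. -/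
lemma gapTest_bits_le {n L κ J W δ P cap : ℕ} (hL1 : 1 ≤ L) (hκ : 1 ≤ κ) (hJ : J = gapJ L)
    (hW : W = gapRatio L * κ) (hδ : 0 < δ) (hδ2 : n < 2 * W * δ)
    (hPdef : P = Nat.sqrt (16 * ((J + 1) * κ))) (hP : 0 < P)
    (hcapdef : cap = 2 ^ 9 * L * ((n / δ + 1) / P + 1)) :
    ((2 * cap * (30 * L) : ℕ) : ℝ) ≤ 2 ^ 54 * L ^ 7 * √κ := by
  have hLr : (1 : ℝ) ≤ L := by exact_mod_cast hL1
  set z : ℝ := ((J : ℝ) + 1) * κ with hz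
  have hz0 : 0 < z := by positivity
  have hz1 : 1 ≤ z := by
    have : (1 : ℝ) ≤ κ := by exact_mod_cast hκ
    have : (1 : ℝ) ≤ (J : ℝ) + 1 := by linarith [Nat.cast_nonneg (α := ℝ) J]
    exact one_le_mul_of_one_le_of_one_le this ‹_›
  have hPr : (0 : ℝ) < P := by exact_mod_cast hP
  have hPz : 4 * √z ≤ 2 * P := by
    have h1 : 16 * ((J + 1) * κ) < (P + 1) * (P + 1) := hPdef ▸ Nat.lt_succ_sqrt _
    have h2 : (16 : ℝ) * z < (P + 1) * (P + 1) := by rw [hz]; exact_mod_cast h1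
    have h3 : (1 : ℝ) ≤ P := by exact_mod_cast hP
    have h4 : (4 * √z) ^ 2 ≤ (2 * P) ^ 2 := by
      rw [mul_pow, Real.sq_sqrt hz0.le]
      nlinarith
    exact (sq_le_sq₀ (by positivity) (by positivity)).1 h4
  have hcells : ((n / δ + 1 : ℕ) : ℝ) ≤ 2 ^ 27 * L ^ 3 * z := by
    have h1 : n / δ < 2 * W := (Nat.div_lt_iff_lt_mul hδ).2 hδ2
    have h2 : n / δ + 1 ≤ 2 ^ 27 * L ^ 3 * ((J + 1) * κ) := by
      calc n / δ + 1 ≤ 2 * W := h1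
        _ = _ := by rw [hW, gapRatio, ← hJ]; ring
    rw [hz]
    exact_mod_cast h2
  have hsz : √z ≤ 2 ^ 12 * L ^ 2 * √κ := by
    have h1 : (J : ℝ) + 1 ≤ (2 ^ 12 * L ^ 2) ^ 2 := by
      rw [hJ, gapJ]; push_cast
      have : (1 : ℝ) ≤ L ^ 4 := one_le_pow₀ hLr
      rw [mul_pow, ← pow_mul]
      norm_num
      linarith
    rw [hz, Real.sqrt_mul (by positivity)]
    gcongr
    exact (Real.sqrt_le_left (by positivity)).2 h1
  have hdivle : (((n / δ + 1) / P : ℕ) : ℝ) ≤ 2 ^ 38 * L ^ 5 * √κ := by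
    calc (((n / δ + 1) / P : ℕ) : ℝ) ≤ ((n / δ + 1 : ℕ) : ℝ) / P := Nat.cast_div_le
      _ ≤ 2 ^ 27 * L ^ 3 * z / P := by gcongr
      _ ≤ 2 ^ 26 * L ^ 3 * √z := by
          rw [div_le_iff₀ hPr]
          calc (2 : ℝ) ^ 27 * L ^ 3 * z = 2 ^ 26 * L ^ 3 * √z * (2 * √z) := by
                rw [show (2 : ℝ) ^ 26 * L ^ 3 * √z * (2 * √z) = 2 ^ 27 * L ^ 3 * (√z * √z) by ring,
                  Real.mul_self_sqrt hz0.le]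
            _ ≤ 2 ^ 26 * L ^ 3 * √z * P := by gcongr; linarith
      _ ≤ 2 ^ 26 * L ^ 3 * (2 ^ 12 * L ^ 2 * √κ) := by gcongr
      _ = _ := by ring
  have hsκ : 1 ≤ √(κ : ℝ) := Real.one_le_sqrt.2 (by exact_mod_cast hκ)
  have hone : 1 ≤ (L : ℝ) ^ 5 * √κ := one_le_mul_of_one_le_of_one_le (one_le_pow₀ hLr) hsκ
  have hcapr : (cap : ℝ) = 2 ^ 9 * L * ((((n / δ + 1) / P : ℕ) : ℝ) + 1) := by
    rw [hcapdef]; push_cast; ring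
  have hcaple : (cap : ℝ) ≤ 2 ^ 48 * L ^ 6 * √κ := by
    rw [hcapr]
    calc (2 : ℝ) ^ 9 * L * ((((n / δ + 1) / P : ℕ) : ℝ) + 1)
        ≤ 2 ^ 9 * L * (2 ^ 38 * L ^ 5 * √κ + L ^ 5 * √κ) := by gcongr
      _ ≤ 2 ^ 48 * L ^ 6 * √κ := by
          rw [← sub_nonneg]
          ring_nf
          positivity
  push_cast
  calc 2 * (cap : ℝ) * (30 * L) ≤ 2 * (2 ^ 48 * L ^ 6 * √κ) * (30 * L) := by gcongr
    _ ≤ 2 ^ 54 * L ^ 7 * √κ := by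
        rw [← sub_nonneg]
        ring_nf
        positivity

set_option maxHeartbeats 400000 in
/-- A protocol that tells distances at most `κ` from distances at least `gapRatio L * κ`. -/
theorem exists_gap_test {n : ℕ} [NeZero n] (hn2 : 2 ≤ n) (Γ : Type) [Fintype Γ] {κ : ℕ}
    (hκ : 1 ≤ κ) {L : ℕ} (hL : L = Nat.log 2 n + 1) :
    ∃ (P : Protocol n Γ) (b : ℕ), P.HasBits b ∧ (b : ℝ) ≤ 2 ^ 54 * L ^ 7 * √κ ∧
      P.Solves (fun H => {x | (H ≤ κ → x = 0) ∧ (gapRatio L * κ ≤ H → x ≠ 0)})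
        (1 / (64 * L)) := by
  classical
  have hL1 : 1 ≤ L := by omega
  have hLr : (1 : ℝ) ≤ L := by exact_mod_cast hL1
  -- no distance reaches `gapRatio L * κ`, so the answer `0` is always acceptable
  by_cases htriv : n < gapRatio L * κ
  · obtain ⟨P, hb, hout⟩ := exists_zero_protocol n Γ
    refine ⟨P, 0, hb, by push_cast; positivity, fun S₁ S₂ m => ?_⟩
    refine (pr_eq_zero fun ω => not_not.2 ?_).trans_le (by positivity)
    have := card_mism_le S₁ S₂ m
    exact ⟨fun _ => hout _ _ _ _, fun h => absurd h (by omega)⟩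
  rw [not_lt] at htriv
  obtain ⟨J, hJ⟩ : ∃ J : ℕ, J = gapJ L := ⟨_, rfl⟩
  have hJ0 : 0 < J := by rw [hJ, gapJ]; positivity
  have : NeZero J := ⟨hJ0.ne'⟩
  obtain ⟨W, hW⟩ : ∃ W : ℕ, W = gapRatio L * κ := ⟨_, rfl⟩
  rw [← hW] at htriv
  have hW0 : 0 < W := by rw [hW, gapRatio]; positivity
  -- the length of a cell, with about `W` cells on the circle
  obtain ⟨δ, hδdef⟩ : ∃ δ : ℕ, δ = n / W := ⟨_, rfl⟩
  have hδ : 0 < δ := hδdef ▸ Nat.div_pos htriv hW0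
  have hδ1 : δ * W ≤ n := hδdef ▸ Nat.div_mul_le_self n W
  have hδ2 : n < 2 * W * δ := by
    have := Nat.lt_mul_div_succ n hW0
    rw [← hδdef, Nat.mul_succ] at this
    have h : W ≤ W * δ := Nat.le_mul_of_pos_right W hδ
    linarith
  -- `k'` mismatches are so few that collisions of their windows are rare, and so many that the part of
  -- the circle covered by their windows exceeds what `κ` mismatches can cause by a factor of order `L`
  obtain ⟨k', hk'⟩ : ∃ k' : ℕ, k' = 2 ^ 13 * L * κ := ⟨_, rfl⟩
  -- the length of a window
  obtain ⟨ℓ, hℓ⟩ : ∃ ℓ : ℕ, ℓ = 16 * ((J + 1) * δ) := ⟨_, rfl⟩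
  have hWk : W = 2 ^ 13 * L ^ 2 * (J + 1) * k' := by rw [hW, gapRatio, hk', ← hJ]; ring
  have hℓn : 2 ^ 9 * L ^ 2 * k' * ℓ ≤ n := by
    calc 2 ^ 9 * L ^ 2 * k' * ℓ = δ * W := by rw [hWk, hℓ]; ring
      _ ≤ n := hδ1
  have hnℓ : n ≤ 2 ^ 10 * L ^ 2 * k' * ℓ := by
    calc n ≤ 2 * W * δ := hδ2.le
      _ = 2 ^ 10 * L ^ 2 * k' * ℓ := by rw [hWk, hℓ]; ring
  have hk'0 : 0 < k' := by rw [hk']; positivity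
  have hℓ0 : 0 < ℓ := by rw [hℓ]; positivity
  have hℓn' : ℓ ≤ n := le_trans (Nat.le_mul_of_pos_left ℓ (by positivity)) hℓn
  have hWn : k' ≤ n := by
    refine le_trans ?_ hℓn
    rw [show 2 ^ 9 * L ^ 2 * k' * ℓ = k' * (2 ^ 9 * L ^ 2 * ℓ) by ring]
    exact Nat.le_mul_of_pos_right k' (by positivity)
  -- the number of hash values: at most `2 * n` words occur, so collisions are unlikely
  obtain ⟨N, hN⟩ : ∃ N : ℕ, N = 2 ^ 22 * L ^ 3 * n ^ 2 := ⟨_, rfl⟩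
  have hn0 : 0 < n := by omega
  have : NeZero N := ⟨by rw [hN]; positivity⟩
  -- the inverse sampling rate: with at least `thr = ℓ * k' / 8` rejections the variance is small
  obtain ⟨P, hPdef⟩ : ∃ P : ℕ, P = Nat.sqrt (16 * ((J + 1) * κ)) := ⟨_, rfl⟩
  have hP : 0 < P := hPdef ▸ Nat.sqrt_pos.2 (by positivity)
  -- more than `cap` cells are kept with small probability
  obtain ⟨cap, hcapdef⟩ : ∃ cap : ℕ, cap = 2 ^ 9 * L * ((n / δ + 1) / P + 1) := ⟨_, rfl⟩
  have hcap : 0 < cap := by rw [hcapdef]; positivity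
  set D := gapScheme n Γ ℓ δ J N with hD
  -- real versions of the parameter inequalities
  have hnr : (0 : ℝ) < n := by exact_mod_cast hn0
  have hℓr : (0 : ℝ) < ℓ := by exact_mod_cast hℓ0
  have hk'r : (0 : ℝ) < k' := by exact_mod_cast hk'0
  have hκr : (0 : ℝ) < κ := by exact_mod_cast hκ
  have hk'e : (k' : ℝ) = 2 ^ 13 * L * κ := by rw [hk']; push_cast; ring
  have hℓnr : (2 : ℝ) ^ 9 * L ^ 2 * k' * ℓ ≤ n := by exact_mod_cast hℓn
  have hnℓr : (n : ℝ) ≤ 2 ^ 10 * L ^ 2 * k' * ℓ := by exact_mod_cast hnℓ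
  have hNq : (n : ℝ) ^ 2 / N = 1 / (2 ^ 22 * L ^ 3) := by
    rw [hN]; push_cast; field_simp; norm_num
  have hJq : 2 * (L : ℝ) / J = 1 / (2 ^ 22 * L ^ 3) := by
    rw [hJ, gapJ]; push_cast; field_simp; norm_num
  have hL3 : 1 / ((2 : ℝ) ^ 20 * L ^ 3) ≤ 1 / (2 ^ 8 * L) := by
    refine one_div_le_one_div_of_le (by positivity) ?_
    have : (L : ℝ) ≤ L ^ 3 := le_self_pow₀ hLr (by norm_num)
    linarith
  have hsizefail : 2 * (((n / δ + 1 : ℕ) : ℝ) / (P * cap)) ≤ 1 / (2 ^ 8 * L) := by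
    rw [hcapdef]
    exact two_mul_div_capacity_le hP hL1
  -- a quarter of the total length `ℓ / 2 * k'` of the middle parts of the windows of `k'` mismatches
  obtain ⟨thr, hthr⟩ : ∃ thr : ℝ, thr = ℓ * k' / 8 := ⟨_, rfl⟩
  have hthr0 : 0 < thr := by rw [hthr]; positivity
  let R := D.sample δ P cap hP
  refine ⟨Protocol.combine (fun _ : Unit => R) (fun x => if thr ≤ x () then 1 else 0),
    2 * cap * (30 * L), ?_, ?_, ?_⟩
  · have hb : Fintype.card D.Msg ≤ 2 ^ (30 * L) :=
      card_gapScheme_Msg_le Γ hL1 (hL ▸ natCast_le_two_pow_log n) hδ hℓ hℓn' hN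
    have := Protocol.combine_hasBits (P := fun _ : Unit => R)
      (fun x => if thr ≤ x () then 1 else 0) (b := fun _ => 2 * cap * (30 * L))
      fun _ => LocalScheme.sample_hasBits D hP hb
    simpa using this
  · exact gapTest_bits_le hL1 hκ hJ hW hδ hδ2 hPdef hP hcapdef
  · have hX0 : ∀ S₁ S₂ m ω u, 0 ≤ D.X δ S₁ S₂ m ω u := fun S₁ S₂ m ω u =>
      gapScheme_X_nonneg δ S₁ S₂ m ω u
    have hX1 : ∀ S₁ S₂ m ω u, D.X δ S₁ S₂ m ω u ≤ 1 := fun S₁ S₂ m ω u =>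
      gapScheme_X_le_one δ S₁ S₂ m ω u
    have hsolve : R.Solves (fun H => {x | (H ≤ κ → x < thr) ∧ (gapRatio L * κ ≤ H → thr ≤ x)})
        (1 / (64 * L)) := by
      intro S₁ S₂ m
      -- for many mismatches the test fails if windows collide, hash values collide, the sampled sum
      -- deviates, or a sample is oversized
      have hquarter : 1 / (64 * (L : ℝ)) = 1 / (2 ^ 8 * L) + 1 / (2 ^ 8 * L) + 1 / (2 ^ 8 * L) +
          1 / (2 ^ 8 * L) := by field_simp; norm_num
      have hq0 : 0 ≤ 1 / (2 ^ 8 * (L : ℝ)) := by positivity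
      have hκW : κ < gapRatio L * κ := by
        have : 1 < gapRatio L := by
          rw [gapRatio]
          have : 1 ≤ L ^ 3 * (gapJ L + 1) := Nat.mul_pos (by positivity) (by omega)
          rw [mul_assoc]
          omega
        exact lt_mul_left hκ this
      by_cases hsmall : (mism S₁ S₂ m).card ≤ κ
      · -- few mismatches: few rejections on average, by Markov's inequality
        have havg := gapScheme_avg_le (N := N) hδ hℓ S₁ S₂ m
        rw [← hL, hNq, hJq] at havg
        have hpr := LocalScheme.sample_pr_ge_le D (cap := cap) hP (hX0 S₁ S₂ m) hthr0 havg
        refine (pr_mono fun ω hω => ?_).trans (hpr.trans ?_)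
        · by_contra hlt
          exact hω ⟨fun _ => not_le.1 hlt, fun h => absurd h (by omega)⟩
        · rw [div_le_iff₀ hthr0]
          have h1 : ((mism S₁ S₂ m).card : ℝ) * (3 * ℓ + 1 : ℕ) ≤ κ * (4 * ℓ) := by
            have h2 : ((3 * ℓ + 1 : ℕ) : ℝ) ≤ 4 * ℓ := by
              have : 3 * ℓ + 1 ≤ 4 * ℓ := by omega
              exact_mod_cast this
            have h3 : ((mism S₁ S₂ m).card : ℝ) ≤ κ := by exact_mod_cast hsmall
            gcongr
          have h2 : (n : ℝ) * (1 / (2 ^ 22 * L ^ 3) + 1 / (2 ^ 22 * L ^ 3)) ≤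
              (k' : ℝ) * ℓ / (2 ^ 11 * L) := by
            calc (n : ℝ) * (1 / (2 ^ 22 * L ^ 3) + 1 / (2 ^ 22 * L ^ 3))
                ≤ (2 ^ 10 * L ^ 2 * k' * ℓ) * (1 / (2 ^ 22 * L ^ 3) + 1 / (2 ^ 22 * L ^ 3)) := by
                  gcongr
              _ = (k' : ℝ) * ℓ / (2 ^ 11 * L) := by field_simp; norm_num
          have h3 : (κ : ℝ) * (4 * ℓ) = (k' : ℝ) * ℓ / (2 ^ 11 * L) := by
            rw [hk'e]; field_simp; norm_num
          calc _ ≤ k' * ℓ / (2 ^ 11 * (L : ℝ)) + k' * ℓ / (2 ^ 11 * L) := by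
                rw [← h3] at h2 ⊢; linarith
            _ ≤ 1 / (64 * L) * thr := by
                rw [hthr]; field_simp; norm_num
      · rw [not_le] at hsmall
        by_cases hlarge : gapRatio L * κ ≤ (mism S₁ S₂ m).card
        · -- many mismatches: the rejections caused by `k'` of them are enough
          have hk'W : k' ≤ gapRatio L * κ := by
            rw [← hW, hWk]
            exact Nat.le_mul_of_pos_left _ (by positivity)
          obtain ⟨M, hMsub, hMcard⟩ := Finset.exists_subset_card_eq (hk'W.trans hlarge)
          set good : D.Ω → Prop := fun ω =>
            Set.InjOn ω.2.1 (allWords ℓ ω.1 S₁ ∪ allWords ℓ ω.1 S₂ : Set (Fin ℓ → Γ)) ∧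
              (collisions M (8 * ((J + 1) * δ)) ω.1 : ℝ) < k' / 2 with hgood
          have hcoll : pr (fun a : (ZMod n)ˣ =>
              (k' : ℝ) / 2 ≤ (collisions M (8 * ((J + 1) * δ)) a : ℝ)) ≤ 1 / (2 ^ 8 * L) := by
            have h1 := avg_collisions_le M (8 * ((J + 1) * δ))
            rw [← hL, hMcard] at h1
            refine (pr_le_avg_div (fun a => by positivity) (by positivity)).trans ?_
            rw [div_le_iff₀ (by positivity)]
            refine h1.trans ?_
            have h2 : ((8 * ((J + 1) * δ) : ℕ) : ℝ) = ℓ / 2 := by rw [hℓ]; push_cast; ring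
            rw [h2, ← mul_div_assoc, div_le_iff₀ hnr]
            calc (k' : ℝ) ^ 2 * (2 * (ℓ / 2) * L) =
                  1 / (2 ^ 8 * L) * (k' / 2) * (2 ^ 9 * L ^ 2 * k' * ℓ) := by
                    field_simp
              _ ≤ _ := by gcongr
          have hinjpr : pr (fun ω : D.Ω => ¬ Set.InjOn ω.2.1
              (allWords ℓ ω.1 S₁ ∪ allWords ℓ ω.1 S₂ : Set (Fin ℓ → Γ))) ≤ 1 / (2 ^ 8 * L) := by
            have key := pr_prod_le (Ω := (ZMod n)ˣ) (Ω' := ((Fin ℓ → Γ) → Fin N) × Fin J)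
              (p := fun ω => ¬ Set.InjOn ω.2.1
                (allWords ℓ ω.1 S₁ ∪ allWords ℓ ω.1 S₂ : Set (Fin ℓ → Γ)))
              (good := fun _ => True) (q₀ := 0) (q := 1 / (2 ^ 8 * L)) hq0
              (pr_eq_zero fun _ => by simp).le (fun a _ => by
                rw [pr_prod_fst (Ω := (Fin ℓ → Γ) → Fin N) (Ω' := Fin J) fun φ => ¬ Set.InjOn φ
                  (allWords ℓ a S₁ ∪ allWords ℓ a S₂ : Set (Fin ℓ → Γ))]
                have h1 := pr_not_injOn_le (N := N) (allWords ℓ a S₁ ∪ allWords ℓ a S₂)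
                rw [Finset.coe_union] at h1
                refine h1.trans (le_trans ?_ hL3)
                have h2 : ((allWords ℓ a S₁ ∪ allWords ℓ a S₂).card : ℝ) ≤ 2 * n := by
                  have := (Finset.card_union_le _ _).trans
                    (add_le_add (card_allWords_le (ℓ := ℓ) a S₁) (card_allWords_le a S₂))
                  rw [← two_mul] at this
                  exact_mod_cast this
                calc _ ≤ (2 * (n : ℝ)) ^ 2 / N := by gcongr
                  _ = 4 * ((n : ℝ) ^ 2 / N) := by ring
                  _ = 1 / (2 ^ 20 * L ^ 3) := by rw [hNq]; field_simp; norm_num)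
            rw [zero_add] at key
            exact key
          have hgoodpr : pr (fun ω : D.Ω => ¬ good ω) ≤ 1 / (2 ^ 8 * L) + 1 / (2 ^ 8 * L) := by
            have hc' := pr_prod_fst (Ω := (ZMod n)ˣ) (Ω' := ((Fin ℓ → Γ) → Fin N) × Fin J)
              (fun a => (k' : ℝ) / 2 ≤ (collisions M (8 * ((J + 1) * δ)) a : ℝ))
            refine (pr_mono fun ω hω => ?_).trans ((pr_or_le _ _).trans
              (add_le_add hinjpr (hc'.trans_le hcoll)))
            by_contra hcon
            push Not at hcon
            exact hω ⟨hcon.1, hcon.2⟩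
          have hsum : ∀ ω, good ω → 2 * thr ≤ ∑ u, D.X δ S₁ S₂ m ω u := by
            intro ω hω
            refine le_trans ?_ (le_sum_gapScheme_X hδ hℓ hℓn' hω.1 hMsub)
            have h2 : ((8 * ((J + 1) * δ) : ℕ) : ℝ) = ℓ / 2 := by rw [hℓ]; push_cast; ring
            rw [h2, hMcard, hthr]
            have h3 := mul_lt_mul_of_pos_left hω.2 hℓr
            linarith
          have hs := LocalScheme.sample_pr_le D (c := δ) (cap := cap) hP hδ hcap
            (S₁ := S₁) (S₂ := S₂) (m := m)
            (G := {x | ((mism S₁ S₂ m).card ≤ κ → x < thr) ∧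
              (gapRatio L * κ ≤ (mism S₁ S₂ m).card → thr ≤ x)})
            (good := good) (q₁ := 1 / (2 ^ 8 * L))
            (t := fun ω => (∑ u, D.X δ S₁ S₂ m ω u) / 2) hq0 hgoodpr
            (hX0 S₁ S₂ m) (hX1 S₁ S₂ m)
            (fun ω hω => by have := hsum ω hω; linarith)
            (fun ω hω x hx => by
              refine ⟨fun h => absurd h (by omega), fun _ => ?_⟩
              have h1 := hsum ω hω
              have h2 := (abs_lt.1 hx).1
              linarith)
            (Or.inr fun ω hω => by
              have h1 := hsum ω hω
              set s := ∑ u, D.X δ S₁ S₂ m ω u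
              have hPsq : (P : ℝ) ^ 2 ≤ 16 * ((J + 1) * κ) := by
                have : P * P ≤ 16 * ((J + 1) * κ) := hPdef ▸ Nat.sqrt_le _
                rw [sq]
                exact_mod_cast this
              have hs0 : 0 ≤ s := by linarith
              have hthre : 2 * thr = 2 ^ 15 * L * ((J + 1) * κ) * δ := by
                rw [hthr, hk'e, hℓ]; push_cast; ring
              rw [hthre] at h1
              calc (P : ℝ) ^ 2 * (2 * δ) * s ≤ 16 * ((J + 1) * κ) * (2 * δ) * s := by gcongr
                _ = 1 / (2 ^ 8 * L) * ((2 ^ 15 * L * ((J + 1) * κ) * δ) * s / 4) := by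
                    field_simp; ring
                _ ≤ 1 / (2 ^ 8 * L) * (s * s / 4) := by gcongr
                _ = _ := by ring)
          refine hs.trans ?_
          rw [hquarter]
          linarith
        · refine (pr_eq_zero fun ω => not_not.2 ?_).trans_le (by positivity)
          exact ⟨fun h => absurd h (by omega), fun h => absurd h hlarge⟩
    have hfin := Protocol.combine_solves (P := fun _ : Unit => R)
      (g := fun x => if thr ≤ x () then 1 else 0)
      (Good' := fun H => {x | (H ≤ κ → x = 0) ∧ (gapRatio L * κ ≤ H → x ≠ 0)})
      (fun _ => hsolve) (fun H _ x hx => by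
        refine ⟨fun h => if_neg (not_le.2 ((hx ()).1 h)), fun h => ?_⟩
        rw [if_pos ((hx ()).2 h)]
        exact one_ne_zero)
    simpa using hfin

/-! ### Gaussian weights -/

/-- The `j`-th Taylor coefficient at `τ = 0` of `exp (-(z - τ) ^ 2 / 2) * exp (τ ^ 2 / 2)`. -/
noncomputable def gaussCoef (j : ℕ) (z : ℝ) : ℝ := z ^ j / j.factorial * Real.exp (-z ^ 2 / 2)

lemma exp_two_le : Real.exp 2 ≤ 8 := by
  have h := Real.exp_one_lt_d9
  rw [show (2 : ℝ) = 1 + 1 by norm_num, Real.exp_add]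
  have h0 := Real.exp_pos 1
  nlinarith

/-- The coefficients decay geometrically, uniformly in `z`: `|2z| ^ j / j!` is a term of the series of
`exp |2z|`, and `|2z| - z ^ 2 / 2 ≤ 2`. -/
lemma abs_gaussCoef_le (j : ℕ) (z : ℝ) : |gaussCoef j z| ≤ 8 * (1 / 2) ^ j := by
  have h1 : (2 * |z|) ^ j / j.factorial ≤ Real.exp (2 * |z|) :=
    Real.pow_div_factorial_le_exp _ (by positivity) j
  have h2 : Real.exp (2 * |z|) * Real.exp (-z ^ 2 / 2) ≤ 8 := by
    rw [← Real.exp_add]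
    refine (Real.exp_le_exp.2 ?_).trans exp_two_le
    have := sq_abs z
    nlinarith [sq_nonneg (|z| - 2)]
  have h3 : |gaussCoef j z| = (1 / 2) ^ j * ((2 * |z|) ^ j / j.factorial) *
      Real.exp (-z ^ 2 / 2) := by
    rw [gaussCoef, abs_mul, Real.abs_exp, abs_div, abs_pow, Nat.abs_cast, mul_pow, one_div, inv_pow]
    field_simp
  rw [h3]
  calc _ ≤ (1 / 2) ^ j * Real.exp (2 * |z|) * Real.exp (-z ^ 2 / 2) := by gcongr
    _ = (1 / 2) ^ j * (Real.exp (2 * |z|) * Real.exp (-z ^ 2 / 2)) := by ring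
    _ ≤ (1 / 2) ^ j * 8 := by gcongr
    _ = _ := by ring

/-- A shifted Gaussian from the first `T` Taylor coefficients. -/
lemma abs_gauss_sub_sum_le (T : ℕ) {τ : ℝ} (h0 : 0 ≤ τ) (h1 : τ ≤ 1) (z : ℝ) :
    |Real.exp (-(z - τ) ^ 2 / 2) -
      Real.exp (-τ ^ 2 / 2) * ∑ j ∈ Finset.range T, τ ^ j * gaussCoef j z| ≤ 16 * (1 / 2) ^ T := by
  set u : ℕ → ℝ := fun T => ∑ j ∈ Finset.range T, τ ^ j * gaussCoef j z with hu
  have hs : HasSum (fun j : ℕ => τ ^ j * gaussCoef j z)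
      (Real.exp (τ * z) * Real.exp (-z ^ 2 / 2)) := by
    have := (NormedSpace.expSeries_div_hasSum_exp (τ * z)).mul_right (Real.exp (-z ^ 2 / 2))
    rw [← Real.exp_eq_exp_ℝ] at this
    refine this.congr_fun fun j => ?_
    rw [gaussCoef, mul_pow]
    ring
  have hd : ∀ j, dist (u j) (u (j + 1)) ≤ 8 * (1 / 2) ^ j := by
    intro j
    rw [dist_comm, Real.dist_eq, hu]
    simp only
    rw [Finset.sum_range_succ, add_sub_cancel_left, abs_mul, abs_pow, abs_of_nonneg h0]
    calc τ ^ j * |gaussCoef j z| ≤ 1 * |gaussCoef j z| := by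
          gcongr
          exact pow_le_one₀ h0 h1
      _ ≤ _ := by rw [one_mul]; exact abs_gaussCoef_le j z
  have key := dist_le_of_le_geometric_of_tendsto (1 / 2) 8 (by norm_num) hd hs.tendsto_sum_nat T
  rw [dist_comm, Real.dist_eq] at key
  have he : Real.exp (-(z - τ) ^ 2 / 2) =
      Real.exp (-τ ^ 2 / 2) * (Real.exp (τ * z) * Real.exp (-z ^ 2 / 2)) := by
    rw [← Real.exp_add, ← Real.exp_add]
    congr 1
    ring
  rw [he, ← mul_sub, abs_mul, Real.abs_exp]
  calc Real.exp (-τ ^ 2 / 2) * _ ≤ 1 * (8 * (1 / 2) ^ T / (1 - 1 / 2)) := by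
        refine mul_le_mul ?_ key (abs_nonneg _) zero_le_one
        refine Real.exp_le_one_iff.2 ?_
        have := sq_nonneg τ
        linarith
    _ = _ := by ring

/-- Beyond `T` standard deviations the Gaussian is as small as the error of `T` Taylor terms. -/
lemma exp_neg_sq_le {T : ℕ} (hT : 2 ≤ T) {z : ℝ} (hz : (T : ℝ) ≤ |z|) :
    Real.exp (-z ^ 2 / 2) ≤ (1 / 2) ^ T := by
  have hT' : (2 : ℝ) ≤ T := by exact_mod_cast hT
  have h1 : Real.exp (-z ^ 2 / 2) ≤ Real.exp (-(T : ℝ)) := by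
    refine Real.exp_le_exp.2 ?_
    have h2 : (T : ℝ) ^ 2 ≤ z ^ 2 := by
      rw [← sq_abs z]
      gcongr
    nlinarith
  refine h1.trans ?_
  rw [show -(T : ℝ) = T * (-1) by ring, Real.exp_nat_mul]
  refine pow_le_pow_left₀ (Real.exp_pos _).le ?_ _
  rw [Real.exp_neg, one_div]
  refine inv_anti₀ (by norm_num) ?_
  linarith [Real.add_one_le_exp 1]

section Kernel

variable {n : ℕ} [NeZero n]

/-- The Gaussian weight of width `Δ` on the circle. -/
noncomputable def gaussWeight (Δ : ℝ) (y : ZMod n) : ℝ :=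
  Real.exp (-(y.valMinAbs / Δ) ^ 2 / 2)

omit [NeZero n] in
lemma gaussWeight_pos (Δ : ℝ) (y : ZMod n) : 0 < gaussWeight Δ y := Real.exp_pos _

omit [NeZero n] in
lemma gaussWeight_le_one (Δ : ℝ) (y : ZMod n) : gaussWeight Δ y ≤ 1 := by
  refine Real.exp_le_one_iff.2 ?_
  have := sq_nonneg ((y.valMinAbs : ℝ) / Δ)
  linarith

omit [NeZero n] in
lemma abs_valMinAbs (y : ZMod n) : |(y.valMinAbs : ℝ)| = cabs y := by
  rw [cabs, Nat.cast_natAbs]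
  push_cast
  rfl

omit [NeZero n] in
lemma gaussWeight_le {T : ℕ} (hT : 2 ≤ T) {Δ : ℝ} (hΔ : 0 < Δ) {y : ZMod n}
    (hy : T * Δ ≤ cabs y) : gaussWeight Δ y ≤ (1 / 2) ^ T := by
  refine exp_neg_sq_le hT ?_
  rw [abs_div, abs_of_pos hΔ, abs_valMinAbs, le_div_iff₀ hΔ]
  exact hy

/-- The Gaussian weight of a difference, from the representative of the minuend: the two may differ
only far from the origin. -/
lemma abs_exp_sub_gaussWeight_le {T : ℕ} (hT : 2 ≤ T) {Δ : ℝ} (hΔ : 0 < Δ) (hΔn : 4 * T * Δ ≤ n)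
    (y : ZMod n) {t : ℕ} (ht : 8 * t ≤ n) :
    |Real.exp (-((y.valMinAbs - t) / Δ) ^ 2 / 2) - gaussWeight Δ (y - (t : ZMod n))| ≤ (1 / 2) ^ T := by
  have hn : 0 < n := NeZero.pos n
  have hle := ZMod.valMinAbs_mem_Ioc y
  by_cases hcase : -(n : ℤ) < 2 * (y.valMinAbs - t)
  · have : (y - (t : ZMod n)).valMinAbs = y.valMinAbs - t := by
      refine (ZMod.valMinAbs_spec _ _).2 ⟨by rw [Int.cast_sub, ZMod.coe_valMinAbs, Int.cast_natCast], ?_⟩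
      rw [Set.mem_Ioc] at *
      omega
    rw [gaussWeight, this]
    push_cast
    rw [sub_self, abs_zero]
    positivity
  · rw [Set.mem_Ioc] at hle
    have hr : (T : ℝ) * Δ ≤ n / 4 := by linarith
    have h1 : Real.exp (-((y.valMinAbs - t) / Δ) ^ 2 / 2) ≤ (1 / 2) ^ T := by
      refine exp_neg_sq_le hT ?_
      rw [abs_div, abs_of_pos hΔ, le_div_iff₀ hΔ]
      have h2 : (n : ℤ) ≤ 2 * |y.valMinAbs - t| := by
        rw [abs_of_nonpos (by omega)]; omega
      have h3 : (n : ℝ) ≤ 2 * |(y.valMinAbs : ℝ) - t| := by exact_mod_cast h2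
      have hn' : (0 : ℝ) < n := by exact_mod_cast hn
      linarith
    have h2 : gaussWeight Δ (y - (t : ZMod n)) ≤ (1 / 2) ^ T := by
      refine gaussWeight_le hT hΔ (hr.trans ?_)
      have h3 : cabs y ≤ cabs (y - (t : ZMod n)) + cabs ((t : ℕ) : ZMod n) := by
        have := cabs_add_le (y - (t : ZMod n)) ((t : ℕ) : ZMod n)
        rwa [sub_add_cancel] at this
      have h4 : cabs ((t : ℕ) : ZMod n) ≤ t := by
        have := cabs_intCast_le (n := n) (t : ℤ)
        simpa using this
      have h5 : n ≤ 4 * cabs (y - (t : ZMod n)) := by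
        have : cabs y = y.valMinAbs.natAbs := rfl
        omega
      have : (n : ℝ) ≤ 4 * cabs (y - (t : ZMod n)) := by exact_mod_cast h5
      linarith
    have h3 := Real.exp_pos (-((y.valMinAbs - t) / Δ) ^ 2 / 2)
    have h4 := gaussWeight_pos Δ (y - (t : ZMod n))
    rw [abs_le]
    constructor <;> linarith

/-- The total weight. -/
noncomputable def gaussMass (n : ℕ) [NeZero n] (Δ : ℝ) : ℝ := ∑ y : ZMod n, gaussWeight Δ y

lemma one_le_gaussMass (Δ : ℝ) : 1 ≤ gaussMass n Δ := by
  have := Finset.single_le_sum (fun y _ => (gaussWeight_pos Δ y).le) (Finset.mem_univ (0 : ZMod n))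
  refine le_trans (le_of_eq ?_) this
  simp [gaussWeight]

/-- The points at distance less than the width have weight at least `1 / 2`. -/
lemma div_two_le_gaussMass {Δ : ℝ} {c : ℕ} (hc : (c : ℝ) ≤ Δ) (hcn : 2 * c ≤ n) :
    (c : ℝ) / 2 ≤ gaussMass n Δ := by
  classical
  rcases Nat.eq_zero_or_pos c with rfl | hc0
  · have := one_le_gaussMass (n := n) Δ
    simp; linarith
  have hΔ : 0 < Δ := lt_of_lt_of_le (by exact_mod_cast hc0) hc
  set I := (Finset.range c).image fun i : ℕ => (i : ZMod n) with hI
  have hcard : I.card = c := by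
    rw [hI, Finset.card_image_of_injOn, Finset.card_range]
    intro i hi j hj hij
    simp only [Finset.coe_range, Set.mem_Iio] at hi hj
    exact Nat.ModEq.eq_of_lt_of_lt ((ZMod.natCast_eq_natCast_iff _ _ _).1 hij) (by omega) (by omega)
  calc (c : ℝ) / 2 = ∑ y ∈ I, (1 / 2 : ℝ) := by rw [Finset.sum_const, hcard, nsmul_eq_mul]; ring
    _ ≤ ∑ y ∈ I, gaussWeight Δ y := by
        refine Finset.sum_le_sum fun y hy => ?_
        obtain ⟨i, hi, rfl⟩ := Finset.mem_image.1 hy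
        have h1 : cabs ((i : ℕ) : ZMod n) ≤ i := by
          have := cabs_intCast_le (n := n) (i : ℤ)
          simpa using this
        have h2 : |(((i : ℕ) : ZMod n).valMinAbs : ℝ) / Δ| ≤ 1 := by
          rw [abs_div, abs_of_pos hΔ, div_le_one hΔ, abs_valMinAbs]
          have h3 : (i : ℝ) ≤ c := by exact_mod_cast (Finset.mem_range.1 hi).le
          have h4 : (cabs ((i : ℕ) : ZMod n) : ℝ) ≤ i := by exact_mod_cast h1
          linarith
        have h3 : ((((i : ℕ) : ZMod n).valMinAbs : ℝ) / Δ) ^ 2 ≤ 1 := by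
          rw [← sq_abs]
          exact pow_le_one₀ (abs_nonneg _) h2
        have h4 := Real.add_one_le_exp (-((((i : ℕ) : ZMod n).valMinAbs : ℝ) / Δ) ^ 2 / 2)
        rw [gaussWeight]
        linarith
    _ ≤ gaussMass n Δ := Finset.sum_le_sum_of_subset_of_nonneg (Finset.subset_univ _)
        fun y _ _ => (gaussWeight_pos Δ y).le

end Kernel

/-! ### Local estimates of the number of mismatches -/

/-- The norm of a weighted sum of vectors of norm `2` is twice the total weight, up to the weight
outside of `N`, if `N` has at most one point; otherwise the error is at most quadratic in the number of
points of `N`. -/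
lemma abs_min_norm_sub_sum_le {X : Type} [DecidableEq X] {B : ℕ} (M N : Finset X) (hNM : N ⊆ M)
    {w : X → ℝ} {η : ℝ} (hη0 : 0 ≤ η) (hw0 : ∀ x, 0 ≤ w x) (hw1 : ∀ x, w x ≤ 1) (hη : ∀ x ∈ M, x ∉ N → w x ≤ η)
    {s : X → Fin B → ℝ} (hs : ∀ x b, |s x b| ≤ 2) (hs2 : ∀ x ∈ M, ∃ b, |s x b| = 2) :
    |min 1 (‖fun b => ∑ x ∈ M, s x b * w x‖ / 2) - ∑ x ∈ M, w x| ≤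
      (N.card * (N.card - 1) : ℕ) + 2 * (M.card * η) := by
  set Z : Fin B → ℝ := fun b => ∑ x ∈ M, s x b * w x with hZ
  have hfar0 : 0 ≤ ∑ x ∈ M \ N, w x := Finset.sum_nonneg fun x _ => hw0 x
  set φ := ∑ x ∈ M \ N, w x with hφ
  have hfar : φ ≤ M.card * η := by
    calc φ ≤ ∑ x ∈ M \ N, η := Finset.sum_le_sum fun x hx =>
          hη x (Finset.mem_sdiff.1 hx).1 (Finset.mem_sdiff.1 hx).2
      _ = (M \ N).card * η := by rw [Finset.sum_const, nsmul_eq_mul]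
      _ ≤ M.card * η := by
          gcongr
          exact Finset.sdiff_subset
  have hsplit : ∑ x ∈ M, w x = ∑ x ∈ N, w x + φ := by
    rw [hφ, add_comm, Finset.sum_sdiff hNM]
  have hZsplit : ∀ b, |Z b - ∑ x ∈ N, s x b * w x| ≤ 2 * φ := by
    intro b
    rw [hZ]
    simp only
    rw [← Finset.sum_sdiff hNM, add_sub_cancel_right, hφ, Finset.mul_sum]
    refine (Finset.abs_sum_le_sum_abs _ _).trans (Finset.sum_le_sum fun x _ => ?_)
    rw [abs_mul, abs_of_nonneg (hw0 x)]
    exact mul_le_mul_of_nonneg_right (hs x b) (hw0 x)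
  have hn0 : 0 ≤ ‖Z‖ := norm_nonneg _
  rcases Nat.lt_or_ge 1 N.card with h2 | h1
  · have hN : (N.card : ℝ) ≤ (N.card * (N.card - 1) : ℕ) := by
      exact_mod_cast Nat.le_mul_of_pos_right _ (by omega)
    have hsum : ∑ x ∈ N, w x ≤ N.card := by
      refine (Finset.sum_le_sum fun x _ => hw1 x).trans ?_
      simp
    have hsum0 : 0 ≤ ∑ x ∈ N, w x := Finset.sum_nonneg fun x _ => hw0 x
    have hN1 : (1 : ℝ) ≤ N.card := by exact_mod_cast h2.le
    have hm0 : 0 ≤ min 1 (‖Z‖ / 2) := le_min zero_le_one (by positivity)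
    have hm1 : min 1 (‖Z‖ / 2) ≤ 1 := min_le_left _ _
    rw [abs_le]
    constructor <;> linarith
  have hrhs : (0 : ℝ) ≤ (N.card * (N.card - 1) : ℕ) := Nat.cast_nonneg _
  have key : ∃ v, ∑ x ∈ N, w x = v ∧ 0 ≤ v ∧ v ≤ 1 ∧ |‖Z‖ - 2 * v| ≤ 2 * φ := by
    rcases Nat.eq_zero_or_pos N.card with h0 | hpos
    · rw [Finset.card_eq_zero] at h0
      subst h0
      refine ⟨0, Finset.sum_empty, le_rfl, zero_le_one, ?_⟩
      rw [mul_zero, sub_zero, abs_of_nonneg hn0, pi_norm_le_iff_of_nonneg (by positivity)]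
      intro b
      have := hZsplit b
      rwa [Finset.sum_empty, sub_zero] at this
    · obtain ⟨x, rfl⟩ := Finset.card_eq_one.1 (show N.card = 1 by omega)
      simp only [Finset.sum_singleton] at hZsplit ⊢
      refine ⟨w x, rfl, hw0 x, hw1 x, abs_le.2 ⟨?_, ?_⟩⟩
      · obtain ⟨b, hb⟩ := hs2 x (hNM (Finset.mem_singleton_self x))
        have h3 : |s x b * w x| = 2 * w x := by rw [abs_mul, hb, abs_of_nonneg (hw0 x)]
        have h4 := norm_le_pi_norm Z b
        rw [Real.norm_eq_abs] at h4
        have h5 := abs_sub_abs_le_abs_sub (s x b * w x) (Z b)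
        rw [abs_sub_comm] at h5
        have := hZsplit b
        linarith
      · have h3 : ‖Z‖ ≤ 2 * w x + 2 * φ := by
          have := hw0 x
          rw [pi_norm_le_iff_of_nonneg (by positivity)]
          intro b
          rw [Real.norm_eq_abs]
          have h4 := abs_sub_abs_le_abs_sub (Z b) (s x b * w x)
          have h5 : |s x b * w x| ≤ 2 * w x := by
            rw [abs_mul, abs_of_nonneg (hw0 x)]
            exact mul_le_mul_of_nonneg_right (hs x b) (hw0 x)
          have := hZsplit b
          linarith
        linarith
  obtain ⟨v, hv, hv0, hv1, hZv⟩ := key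
  rw [hsplit, hv]
  have h6 : |min 1 (‖Z‖ / 2) - v| ≤ φ := by
    rw [abs_le] at hZv ⊢
    constructor
    · rw [neg_le_sub_iff_le_add, ← sub_le_iff_le_add]
      exact le_min (by linarith) (by linarith)
    · have := min_le_right 1 (‖Z‖ / 2)
      linarith
  rw [abs_le] at h6 ⊢
  constructor <;> linarith

/-- The sign `1` or `-1` of a bit. -/
def bitSign (v : Bool) : ℝ := if v then 1 else -1

lemma abs_bitSign (v : Bool) : |bitSign v| = 1 := by
  cases v <;> simp [bitSign]

lemma abs_bitSign_sub_le (v w : Bool) : |bitSign v - bitSign w| ≤ 2 := by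
  cases v <;> cases w <;> norm_num [bitSign]

lemma abs_bitSign_sub {v w : Bool} (h : v ≠ w) : |bitSign v - bitSign w| = 2 := by
  revert h
  cases v <;> cases w <;> norm_num [bitSign]

section EstScheme

variable {n : ℕ} [NeZero n] {Γ : Type} {B : ℕ}

/-- The sum of the signs of the letters, weighted by a Gaussian around the point `v` of the dilated
circle. -/
noncomputable def signSum (a : (ZMod n)ˣ) (h : Γ → Fin B → Bool) (Δ : ℝ) (S : ZMod n → Γ)
    (v : ZMod n) (b : Fin B) : ℝ :=
  ∑ x, bitSign (h (S x) b) * gaussWeight Δ ((a : ZMod n) * x - v)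

/-- The Taylor coefficients of `signSum` as a function of its centre, at the point `v`. -/
noncomputable def signMoment (a : (ZMod n)ˣ) (h : Γ → Fin B → Bool) (Δ : ℝ) (S : ZMod n → Γ)
    (v : ZMod n) (b : Fin B) (j : ℕ) : ℝ :=
  ∑ x, bitSign (h (S x) b) * gaussCoef j (((a : ZMod n) * x - v).valMinAbs / Δ)

lemma abs_signMoment_le (a : (ZMod n)ˣ) (h : Γ → Fin B → Bool) (Δ : ℝ) (S : ZMod n → Γ)
    (v : ZMod n) (b : Fin B) (j : ℕ) : |signMoment a h Δ S v b j| ≤ 8 * n := by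
  calc |signMoment a h Δ S v b j| ≤ ∑ x : ZMod n, (8 : ℝ) := by
        refine (Finset.abs_sum_le_sum_abs _ _).trans (Finset.sum_le_sum fun x _ => ?_)
        rw [abs_mul, abs_bitSign, one_mul]
        refine (abs_gaussCoef_le _ _).trans ?_
        have : ((1 : ℝ) / 2) ^ j ≤ 1 := pow_le_one₀ (by norm_num) (by norm_num)
        linarith
    _ = 8 * n := by
        rw [Finset.sum_const, Finset.card_univ, ZMod.card, nsmul_eq_mul, mul_comm]

/-- A bound on the Taylor coefficients, rounded to multiples of `2 ^ (-T)` and then scaled to integers. -/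
def momentBound (n T : ℕ) : ℕ := 8 * n * 2 ^ T

lemma floor_signMoment_mem (T : ℕ) (a : (ZMod n)ˣ) (h : Γ → Fin B → Bool) (Δ : ℝ) (S : ZMod n → Γ)
    (v : ZMod n) (b : Fin B) (j : ℕ) : ⌊signMoment a h Δ S v b j * 2 ^ T⌋ ∈
      Finset.Icc (-(momentBound n T : ℤ)) (momentBound n T) := by
  have h1 := abs_le.1 (abs_signMoment_le a h Δ S v b j)
  have h2 : (0 : ℝ) < 2 ^ T := by positivity
  rw [Finset.mem_Icc, momentBound]
  constructor
  · rw [Int.le_floor]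
    push_cast
    nlinarith
  · have h3 : (⌊signMoment a h Δ S v b j * 2 ^ T⌋ : ℝ) ≤ 8 * n * 2 ^ T := by
      refine (Int.floor_le _).trans ?_
      nlinarith
    exact_mod_cast h3

/-- The approximation of `signSum` at relative offset `τ` from rounded Taylor coefficients. -/
noncomputable def reading {T V : ℕ} (x : Fin B → Fin T → Finset.Icc (-(V : ℤ)) V) (τ : ℝ)
    (b : Fin B) : ℝ :=
  Real.exp (-τ ^ 2 / 2) * ∑ j : Fin T, τ ^ (j : ℕ) * (((x b j : ℤ) : ℝ) / 2 ^ T)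

/-- The accuracy of `reading`: `16 * (1 / 2) ^ T` for the Taylor expansion and `(1 / 2) ^ T` for the
representatives, for each of the `n` positions, and `(1 / 2) ^ T` for the rounding of each of the `T`
coefficients. -/
noncomputable def readingError (n T : ℕ) : ℝ := (17 * n + T) * (1 / 2) ^ T

open Classical in
/-- The local estimate of the Gaussian mass of the mismatches around a point. The message about a cell
consists of the rounded Taylor coefficients of `signSum` at the start of the cell, for `B` random
signings of the alphabet. Values below the accuracy are set to `0`, which makes the estimate exact if
there is no mismatch at all. -/
noncomputable def estScheme (n : ℕ) [NeZero n] (Γ : Type) [Fintype Γ] (B T c : ℕ) (Δ : ℝ) :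
    LocalScheme n Γ where
  Ω := (ZMod n)ˣ × (Γ → Fin B → Bool)
  fin := inferInstance
  ne := inferInstance
  unit ω := ω.1
  Msg := Fin B → Fin T → Finset.Icc (-(momentBound n T : ℤ)) (momentBound n T)
  finMsg := inferInstance
  msg ω S i b j := ⟨_, floor_signMoment_mem T ω.1 ω.2 Δ S ((i * c : ℕ) : ZMod n) b j⟩
  val _ x y t t' :=
    let v := ‖fun b => reading x (t / Δ) b - reading y (t' / Δ) b‖ / 2
    if v ≤ readingError n T then 0 else min 1 v

variable [Fintype Γ] {T c : ℕ} {Δ : ℝ}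

lemma estScheme_X_nonneg (S₁ S₂ : ZMod n → Γ) (m : ZMod n) (ω : (estScheme n Γ B T c Δ).Ω)
    (u : ZMod n) : 0 ≤ (estScheme n Γ B T c Δ).X c S₁ S₂ m ω u := by
  simp only [LocalScheme.X, estScheme]
  split_ifs
  · exact le_rfl
  · exact le_min zero_le_one (by positivity)

lemma estScheme_X_le_one (S₁ S₂ : ZMod n → Γ) (m : ZMod n) (ω : (estScheme n Γ B T c Δ).Ω)
    (u : ZMod n) : (estScheme n Γ B T c Δ).X c S₁ S₂ m ω u ≤ 1 := by
  simp only [LocalScheme.X, estScheme]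
  split_ifs
  · exact zero_le_one
  · exact min_le_left _ _

/-- The decoder recovers `signSum` at every point of the cell. -/
lemma abs_reading_sub_signSum_le (hT : 2 ≤ T) (hΔ : 0 < Δ) (hΔn : 4 * T * Δ ≤ n)
    (ω : (estScheme n Γ B T c Δ).Ω) (S : ZMod n → Γ) (v : ZMod n)
    (hc : ((v.val % c : ℕ) : ℝ) ≤ Δ) (b : Fin B) :
    |reading ((estScheme n Γ B T c Δ).msg ω S (v.val / c)) ((v.val % c : ℕ) / Δ) b -
      signSum ω.1 ω.2 Δ S v b| ≤ readingError n T := by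
  obtain ⟨a, h⟩ := ω
  set t := v.val % c with ht
  set v₀ : ZMod n := ((v.val / c * c : ℕ) : ZMod n) with hv₀
  have hT' : (2 : ℝ) ≤ T := by exact_mod_cast hT
  have ht8 : 8 * t ≤ n := by
    have : (8 : ℝ) * t ≤ n := by nlinarith
    exact_mod_cast this
  have hv : v = v₀ + t := by
    rw [hv₀, ← Nat.cast_add, ht, Nat.div_add_mod', ZMod.natCast_zmod_val]
  set τ : ℝ := t / Δ with hτ
  have hτ0 : 0 ≤ τ := by positivity
  have hτ1 : τ ≤ 1 := (div_le_one hΔ).2 hc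
  have hexp : Real.exp (-τ ^ 2 / 2) ≤ 1 := Real.exp_le_one_iff.2 (by nlinarith [sq_nonneg τ])
  -- rounding
  have h1 : |reading ((estScheme n Γ B T c Δ).msg (a, h) S (v.val / c)) τ b -
      Real.exp (-τ ^ 2 / 2) * ∑ j ∈ Finset.range T, τ ^ j * signMoment a h Δ S v₀ b j| ≤
      T * (1 / 2) ^ T := by
    change |Real.exp (-τ ^ 2 / 2) * ∑ j : Fin T, τ ^ (j : ℕ) *
      (((⌊signMoment a h Δ S v₀ b j * 2 ^ T⌋ : ℤ) : ℝ) / 2 ^ T) - _| ≤ _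
    rw [← mul_sub, ← Fin.sum_univ_eq_sum_range (fun j => τ ^ j * signMoment a h Δ S v₀ b j),
      ← Finset.sum_sub_distrib, abs_mul, Real.abs_exp]
    calc _ ≤ 1 * ∑ j : Fin T, ((1 : ℝ) / 2) ^ T := by
          refine mul_le_mul hexp ((Finset.abs_sum_le_sum_abs _ _).trans
            (Finset.sum_le_sum fun j _ => ?_)) (abs_nonneg _) zero_le_one
          rw [← mul_sub, abs_mul, abs_pow, abs_of_nonneg hτ0]
          refine (mul_le_of_le_one_left (abs_nonneg _) (pow_le_one₀ hτ0 hτ1)).trans ?_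
          have h2 : (0 : ℝ) < 2 ^ T := by positivity
          have h3 : ∀ s : ℝ, (⌊s * 2 ^ T⌋ : ℝ) / 2 ^ T - s = (⌊s * 2 ^ T⌋ - s * 2 ^ T) / 2 ^ T := by
            intro s
            field_simp
          rw [h3, abs_div, abs_of_pos h2, one_div, inv_pow, ← one_div]
          refine div_le_div_of_nonneg_right (abs_le.2 ⟨?_, ?_⟩) h2.le
          · linarith [Int.lt_floor_add_one (signMoment a h Δ S v₀ b j * 2 ^ T)]
          · linarith [Int.floor_le (signMoment a h Δ S v₀ b j * 2 ^ T)]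
      _ = _ := by simp
  -- Taylor expansion and the choice of representatives
  have h2 : |Real.exp (-τ ^ 2 / 2) * ∑ j ∈ Finset.range T, τ ^ j * signMoment a h Δ S v₀ b j -
      signSum a h Δ S v b| ≤ 17 * n * (1 / 2) ^ T := by
    have e1 : Real.exp (-τ ^ 2 / 2) * ∑ j ∈ Finset.range T, τ ^ j * signMoment a h Δ S v₀ b j =
        ∑ x, bitSign (h (S x) b) * (Real.exp (-τ ^ 2 / 2) * ∑ j ∈ Finset.range T,
          τ ^ j * gaussCoef j (((a : ZMod n) * x - v₀).valMinAbs / Δ)) := by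
      simp only [signMoment, Finset.mul_sum]
      rw [Finset.sum_comm]
      refine Finset.sum_congr rfl fun x _ => Finset.sum_congr rfl fun j _ => ?_
      ring
    rw [e1, signSum, ← Finset.sum_sub_distrib]
    calc _ ≤ ∑ x : ZMod n, 17 * ((1 : ℝ) / 2) ^ T := by
          refine (Finset.abs_sum_le_sum_abs _ _).trans (Finset.sum_le_sum fun x _ => ?_)
          rw [← mul_sub, abs_mul, abs_bitSign, one_mul]
          have h3 := abs_gauss_sub_sum_le T hτ0 hτ1 (((a : ZMod n) * x - v₀).valMinAbs / Δ)
          have h4 := abs_exp_sub_gaussWeight_le hT hΔ hΔn ((a : ZMod n) * x - v₀) ht8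
          rw [sub_sub, ← hv, sub_div, ← hτ] at h4
          rw [abs_sub_comm] at h3
          refine (abs_sub_le _ _ _).trans ((add_le_add h3 h4).trans_eq ?_)
          ring
      _ = _ := by
          rw [Finset.sum_const, Finset.card_univ, ZMod.card, nsmul_eq_mul]
          ring
  refine (abs_sub_le _ _ _).trans ((add_le_add h1 h2).trans_eq ?_)
  rw [readingError]
  ring

omit [Fintype Γ] in
/-- Matching positions cancel, so that the difference of the sums of the two strings at corresponding
points only depends on the mismatches. -/
lemma signSum_sub_signSum (a : (ZMod n)ˣ) (h : Γ → Fin B → Bool) (Δ : ℝ) (S₁ S₂ : ZMod n → Γ)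
    (m u : ZMod n) (b : Fin B) :
    signSum a h Δ S₁ u b - signSum a h Δ S₂ (u + a * m) b =
      ∑ x ∈ mism S₁ S₂ m, (bitSign (h (S₁ x) b) - bitSign (h (S₂ (x + m)) b)) *
        gaussWeight Δ ((a : ZMod n) * x - u) := by
  have h1 : signSum a h Δ S₂ (u + a * m) b =
      ∑ x, bitSign (h (S₂ (x + m)) b) * gaussWeight Δ ((a : ZMod n) * x - u) := by
    rw [signSum, ← Equiv.sum_comp (Equiv.addRight m)]
    refine Finset.sum_congr rfl fun x _ => ?_
    rw [Equiv.coe_addRight]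
    congr 2
    ring
  rw [h1, signSum, ← Finset.sum_sub_distrib]
  simp only [← sub_mul]
  refine (Finset.sum_subset (Finset.subset_univ _) fun x _ hx => ?_).symm
  rw [mem_mism, not_not] at hx
  rw [hx, sub_self, zero_mul]

/-- The local estimate is close to the truncated norm of the vector of weighted sign differences. -/
lemma abs_estScheme_X_sub_le (hT : 2 ≤ T) (hΔ : 0 < Δ) (hΔn : 4 * T * Δ ≤ n)
    (hc : ∀ v : ZMod n, ((v.val % c : ℕ) : ℝ) ≤ Δ) (S₁ S₂ : ZMod n → Γ) (m : ZMod n)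
    (ω : (estScheme n Γ B T c Δ).Ω) (u : ZMod n) :
    |(estScheme n Γ B T c Δ).X c S₁ S₂ m ω u - min 1 (‖fun b => ∑ x ∈ mism S₁ S₂ m,
      (bitSign (ω.2 (S₁ x) b) - bitSign (ω.2 (S₂ (x + m)) b)) *
        gaussWeight Δ ((ω.1 : ZMod n) * x - u)‖ / 2)| ≤ 2 * readingError n T ∧
    (mism S₁ S₂ m = ∅ → (estScheme n Γ B T c Δ).X c S₁ S₂ m ω u = 0) := by
  set η := readingError n T with hη
  have hη0 : 0 ≤ η := by rw [hη, readingError]; positivity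
  set Z : Fin B → ℝ := fun b => ∑ x ∈ mism S₁ S₂ m,
      (bitSign (ω.2 (S₁ x) b) - bitSign (ω.2 (S₂ (x + m)) b)) *
        gaussWeight Δ ((ω.1 : ZMod n) * x - u) with hZ
  set Y : Fin B → ℝ := fun b =>
    reading ((estScheme n Γ B T c Δ).msg ω S₁ (u.val / c)) ((u.val % c : ℕ) / Δ) b -
    reading ((estScheme n Γ B T c Δ).msg ω S₂ ((u + (ω.1 : ZMod n) * m).val / c))
      (((u + (ω.1 : ZMod n) * m).val % c : ℕ) / Δ) b with hY
  have hX : (estScheme n Γ B T c Δ).X c S₁ S₂ m ω u =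
      if ‖Y‖ / 2 ≤ η then 0 else min 1 (‖Y‖ / 2) := rfl
  have hYZ : ‖Y - Z‖ ≤ 2 * η := by
    rw [pi_norm_le_iff_of_nonneg (by positivity)]
    intro b
    rw [Pi.sub_apply, Real.norm_eq_abs, hY, hZ]
    simp only
    rw [← signSum_sub_signSum]
    have h1 := abs_le.1 (abs_reading_sub_signSum_le hT hΔ hΔn ω S₁ u (hc u) b)
    have h2 := abs_le.1 (abs_reading_sub_signSum_le hT hΔ hΔn ω S₂ (u + (ω.1 : ZMod n) * m)
      (hc _) b)
    rw [abs_le]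
    constructor <;> linarith [h1.1, h1.2, h2.1, h2.2]
  have hn1 := norm_sub_norm_le Y Z
  have hn2 := norm_sub_norm_le Z Y
  rw [norm_sub_rev] at hn2
  rw [hX]
  refine ⟨?_, fun h0 => if_pos ?_⟩
  · split_ifs with hif
    · have h0 : 0 ≤ min 1 (‖Z‖ / 2) := le_min zero_le_one (by positivity)
      have h1 := min_le_right 1 (‖Z‖ / 2)
      rw [abs_le]
      constructor <;> linarith
    · refine (abs_min_sub_min_le_max _ _ _ _).trans (max_le ?_ ?_)
      · simp; linarith
      · rw [abs_le]
        constructor <;> linarith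
  · have : ‖Z‖ = 0 := by
      rw [hZ, h0]
      simp only [Finset.sum_empty]
      exact norm_zero
    linarith

end EstScheme

/-! ### The sum of the local estimates -/

section EstSum

variable {n : ℕ} [NeZero n] {Γ : Type} {B : ℕ} [Fintype Γ] {T c : ℕ} {Δ : ℝ}

lemma card_cabs_sub_le (v : ZMod n) (r : ℕ) :
    (Finset.univ.filter fun u : ZMod n => cabs (v - u) ≤ r).card ≤ 2 * r + 1 := by
  classical
  have hsub : (Finset.univ.filter fun u : ZMod n => cabs (v - u) ≤ r) ⊆
      (Finset.Icc (-(r : ℤ)) r).image fun z : ℤ => v - (z : ZMod n) := by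
    intro u hu
    have h := (Finset.mem_filter.1 hu).2
    refine Finset.mem_image.2 ⟨(v - u).valMinAbs, Finset.mem_Icc.2 ?_, ?_⟩
    · unfold cabs at h
      omega
    · rw [ZMod.coe_valMinAbs, sub_sub_cancel]
  refine (Finset.card_le_card hsub).trans (Finset.card_image_le.trans ?_)
  rw [Int.card_Icc]
  omega

/-- The local estimates add up to the number of mismatches times the Gaussian mass, up to an error
that is governed by the number of pairs of mismatches that the dilation brings close together. -/
lemma abs_sum_estScheme_X_sub_le (hT : 2 ≤ T) (hΔ : 0 < Δ) (hΔn : 4 * T * Δ ≤ n)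
    (hc : ∀ v : ZMod n, ((v.val % c : ℕ) : ℝ) ≤ Δ) {S₁ S₂ : ZMod n → Γ} {m : ZMod n}
    {ω : (estScheme n Γ B T c Δ).Ω} (hsep : ∀ x ∈ mism S₁ S₂ m, ω.2 (S₁ x) ≠ ω.2 (S₂ (x + m))) :
    |∑ u, (estScheme n Γ B T c Δ).X c S₁ S₂ m ω u - (mism S₁ S₂ m).card * gaussMass n Δ| ≤
      ((2 * ⌊T * Δ⌋₊ + 1) * collisions (mism S₁ S₂ m) (2 * ⌊T * Δ⌋₊) ω.1 : ℕ) +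
        n * (2 * ((mism S₁ S₂ m).card * (1 / 2) ^ T) + 2 * readingError n T) := by
  classical
  set M := mism S₁ S₂ m with hM
  set r := ⌊T * Δ⌋₊ with hr
  set w : ZMod n → ZMod n → ℝ := fun u x => gaussWeight Δ ((ω.1 : ZMod n) * x - u) with hw
  set s : ZMod n → Fin B → ℝ := fun x b => bitSign (ω.2 (S₁ x) b) - bitSign (ω.2 (S₂ (x + m)) b)
  set I : ZMod n → Finset (ZMod n) := fun x =>
    Finset.univ.filter fun u => cabs ((ω.1 : ZMod n) * x - u) ≤ r with hI
  have hmem : ∀ u x, u ∈ I x ↔ cabs ((ω.1 : ZMod n) * x - u) ≤ r := fun u x => by simp [hI]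
  have hover := sum_overlap_le M I ω.1 (r := 2 * r) (w := 2 * r + 1)
    (fun x => card_cabs_sub_le _ _) (by
      intro x _ y _ u hux huy
      rw [hmem] at hux huy
      have h1 : (ω.1 : ZMod n) * (x - y) =
        ((ω.1 : ZMod n) * x - u) - ((ω.1 : ZMod n) * y - u) := by ring
      rw [h1]
      refine (cabs_sub_le _ _).trans ?_
      omega)
  have hmass : ∑ u, ∑ x ∈ M, w u x = M.card * gaussMass n Δ := by
    rw [Finset.sum_comm, Finset.sum_congr rfl (g := fun _ => gaussMass n Δ), Finset.sum_const,
      nsmul_eq_mul]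
    intro x _
    exact Equiv.sum_comp (Equiv.subLeft ((ω.1 : ZMod n) * x)) (gaussWeight Δ)
  have hloc : ∀ u, |(estScheme n Γ B T c Δ).X c S₁ S₂ m ω u - ∑ x ∈ M, w u x| ≤
      (((M.filter fun x => u ∈ I x).card * ((M.filter fun x => u ∈ I x).card - 1) : ℕ) : ℝ) +
      (2 * (M.card * (1 / 2) ^ T) + 2 * readingError n T) := by
    intro u
    have h1 := (abs_estScheme_X_sub_le hT hΔ hΔn hc S₁ S₂ m ω u).1
    have h2 := abs_min_norm_sub_sum_le M (M.filter fun x => u ∈ I x) (Finset.filter_subset _ _)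
      (w := w u) (η := (1 / 2) ^ T) (by positivity) (fun x => (gaussWeight_pos _ _).le)
      (fun x => gaussWeight_le_one _ _) (fun x hxM hx => by
        refine gaussWeight_le hT hΔ ?_
        have h3 : ¬ cabs ((ω.1 : ZMod n) * x - u) ≤ r := fun h3 =>
          hx (Finset.mem_filter.2 ⟨hxM, (hmem _ _).2 h3⟩)
        have h4 : r + 1 ≤ cabs ((ω.1 : ZMod n) * x - u) := by omega
        have h5 : (r : ℝ) + 1 ≤ cabs ((ω.1 : ZMod n) * x - u) := by exact_mod_cast h4
        exact (Nat.lt_floor_add_one _).le.trans h5)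
      (s := s) (fun x b => abs_bitSign_sub_le _ _) (fun x hx => by
        obtain ⟨b, hb⟩ := Function.ne_iff.1 (hsep x hx)
        exact ⟨b, abs_bitSign_sub hb⟩)
    refine (abs_sub_le _ _ _).trans ((add_le_add h1 h2).trans_eq ?_)
    ring
  rw [← hmass, ← Finset.sum_sub_distrib]
  refine (Finset.abs_sum_le_sum_abs _ _).trans ((Finset.sum_le_sum fun u _ => hloc u).trans ?_)
  rw [Finset.sum_add_distrib, Finset.sum_const, Finset.card_univ, ZMod.card, nsmul_eq_mul]
  refine add_le_add ?_ le_rfl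
  exact_mod_cast hover

/-- The random signs separate the letters of all mismatches with high probability. -/
lemma pr_not_separated_le (S₁ S₂ : ZMod n → Γ) (m : ZMod n) [DecidableEq Γ] :
    pr (fun h : Γ → Fin B → Bool => ¬ ∀ x ∈ mism S₁ S₂ m, h (S₁ x) ≠ h (S₂ (x + m))) ≤
      n / 2 ^ B := by
  have h1 : ∀ x ∈ mism S₁ S₂ m, pr (fun h : Γ → Fin B → Bool => h (S₁ x) = h (S₂ (x + m))) ≤
      1 / 2 ^ B := by
    intro x hx
    rw [pr_pi_eq (X := Fin B → Bool) (mem_mism.1 hx)]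
    simp
  refine (pr_mono fun h hh => ?_).trans ((pr_exists_le (mism S₁ S₂ m)
    fun x (h : Γ → Fin B → Bool) => h (S₁ x) = h (S₂ (x + m))).trans
    ((Finset.sum_le_sum h1).trans ?_))
  · push Not at hh
    exact hh
  · rw [Finset.sum_const, nsmul_eq_mul, mul_one_div]
    gcongr
    exact card_mism_le _ _ _

end EstSum

/-! ### The estimator at one scale -/

section Estimator

variable {n : ℕ} [NeZero n] {Γ : Type} [Fintype Γ] {κ Λ L B T c P cap : ℕ} {e Δ : ℝ}

/-- Few pairs of mismatches are brought close together by a random dilation. -/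
lemma pr_collisions_le (hL : L = Nat.log 2 n + 1) (he : 0 < e) (hT : 2 ≤ T) (hΔ : 0 < Δ)
    (hΔW : Δ ≤ 4 * gaussMass n Δ) (hK : 2 ^ 16 * T ^ 2 * L ^ 2 * (Λ * κ) * Δ ≤ e * n)
    {M : Finset (ZMod n)} (hM0 : 0 < M.card) (hM : M.card ≤ Λ * κ) :
    pr (fun a : (ZMod n)ˣ => e / 4 * (M.card * gaussMass n Δ) ≤
      ((2 * ⌊T * Δ⌋₊ + 1) * collisions M (2 * ⌊T * Δ⌋₊) a : ℕ)) ≤ 1 / (2 ^ 8 * L) := by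
  have hn : (0 : ℝ) < n := by exact_mod_cast NeZero.pos n
  have hLr : (1 : ℝ) ≤ L := by rw [hL]; push_cast; linarith [Nat.cast_nonneg (α := ℝ) (Nat.log 2 n)]
  have hTr : (2 : ℝ) ≤ T := by exact_mod_cast hT
  have hMr : (0 : ℝ) < M.card := by exact_mod_cast hM0
  have hMΛ : (M.card : ℝ) ≤ Λ * κ := by exact_mod_cast hM
  have hW1 := one_le_gaussMass (n := n) Δ
  obtain ⟨W, hW⟩ : ∃ W, W = gaussMass n Δ := ⟨_, rfl⟩
  obtain ⟨H, hH⟩ : ∃ H : ℝ, H = M.card := ⟨_, rfl⟩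
  rw [← hW] at hW1 hΔW ⊢
  rw [← hH] at hMr hMΛ ⊢
  have hr : (⌊T * Δ⌋₊ : ℝ) ≤ T * Δ := Nat.floor_le (by positivity)
  have hw : ((2 * ⌊T * Δ⌋₊ + 1 : ℕ) : ℝ) ≤ 9 * T * W := by
    push_cast
    have h1 : (T : ℝ) * Δ ≤ T * (4 * W) := by gcongr
    have h2 : 1 * W ≤ T * W := by gcongr; linarith
    linarith
  have havg := avg_collisions_le M (2 * ⌊T * Δ⌋₊)
  rw [← hL, ← hH] at havg
  have hcoll : avg (fun a => (collisions M (2 * ⌊T * Δ⌋₊) a : ℝ)) ≤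
      H ^ 2 * (2 * (2 * (T * Δ)) * L / n) := by
    refine havg.trans ?_
    push_cast
    gcongr
  refine (pr_le_avg_div (fun a => Nat.cast_nonneg _) (by positivity)).trans ?_
  rw [div_le_iff₀ (by positivity)]
  simp only [Nat.cast_mul (2 * ⌊T * Δ⌋₊ + 1)]
  rw [avg_const_mul]
  calc _ ≤ 9 * T * W * (H ^ 2 * (2 * (2 * (T * Δ)) * L / n)) := by
        refine mul_le_mul hw hcoll (avg_nonneg fun a => Nat.cast_nonneg _) (by positivity)
    _ = 36 * W * H * (T ^ 2 * L * H * Δ) / n := by ring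
    _ ≤ 36 * W * H * (T ^ 2 * L * (Λ * κ) * Δ) / n := by gcongr
    _ = 36 * W * H * (2 ^ 16 * T ^ 2 * L ^ 2 * (Λ * κ) * Δ) / (2 ^ 16 * L * n) := by
        field_simp
    _ ≤ 36 * W * H * (e * n) / (2 ^ 16 * L * n) := by gcongr
    _ = (36 / 2 ^ 6) * (1 / (2 ^ 8 * L) * (e / 4 * (H * W))) := by field_simp; norm_num
    _ ≤ 1 * (1 / (2 ^ 8 * L) * (e / 4 * (H * W))) := by gcongr; norm_num
    _ = _ := one_mul _

/-- The sampled sum of the local estimates is the number of mismatches times the Gaussian mass, up to a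
relative error `e`: half of the error is left to sampling, a quarter to collisions and a quarter to the
finite precision of the local estimates. -/
lemma estScheme_solves (hL : L = Nat.log 2 n + 1) (he0 : 1 / (4 * n) ≤ e) (he1 : e ≤ 1 / 4)
    (hT : 2 ≤ T) (hc0 : 0 < c) (hΔ : 0 < Δ) (hΔn : 4 * T * Δ ≤ n)
    (hc : ∀ v : ZMod n, ((v.val % c : ℕ) : ℝ) ≤ Δ)
    (hΔW : Δ ≤ 4 * gaussMass n Δ) (hcW : c ≤ 2 * gaussMass n Δ)
    (hK : 2 ^ 16 * T ^ 2 * L ^ 2 * (Λ * κ) * Δ ≤ e * n)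
    (hsmall : 16 * (n : ℝ) ^ 2 * (36 * n + 2 * T) * (1 / 2) ^ T ≤ 1) (hP : 0 < P)
    (hPvar : P = 1 ∨ (P : ℝ) ^ 2 * (2 ^ 14 * L) ≤ e ^ 2 * κ) (hB : (n : ℝ) / 2 ^ B ≤ 1 / (2 ^ 8 * L))
    (hcap : cap = 2 ^ 9 * L * ((n / c + 1) / P + 1)) :
    ((estScheme n Γ B T c Δ).sample c P cap hP).Solves
      (fun H => {x | (H = 0 ∨ (κ ≤ 2 * H ∧ H ≤ Λ * κ)) →
        |x - H * gaussMass n Δ| ≤ e * (H * gaussMass n Δ)}) (1 / (64 * L)) := by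
  classical
  intro S₁ S₂ m
  have hn : (0 : ℝ) < n := by exact_mod_cast NeZero.pos n
  have hL0 : 0 < L := by omega
  have hLr : (0 : ℝ) < L := by exact_mod_cast hL0
  have he : 0 < e := lt_of_lt_of_le (by positivity) he0
  have hX0 := fun (ω : (estScheme n Γ B T c Δ).Ω) u => estScheme_X_nonneg S₁ S₂ m ω u
  have hX1 := fun (ω : (estScheme n Γ B T c Δ).Ω) u => estScheme_X_le_one S₁ S₂ m ω u
  by_cases hrange : (mism S₁ S₂ m).card = 0 ∨
      (κ ≤ 2 * (mism S₁ S₂ m).card ∧ (mism S₁ S₂ m).card ≤ Λ * κ)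
  swap
  · exact (pr_eq_zero fun ω => not_not.2 fun h => absurd h hrange).trans_le (by positivity)
  rcases Nat.eq_zero_or_pos (mism S₁ S₂ m).card with h0 | hpos
  · refine (pr_eq_zero fun ω => not_not.2 fun _ => ?_).trans_le (by positivity)
    rw [LocalScheme.sample_out_eq_zero _ hP (fun ω u =>
      (abs_estScheme_X_sub_le hT hΔ hΔn hc S₁ S₂ m ω u).2 (Finset.card_eq_zero.1 h0)), h0]
    simp
  obtain ⟨hκH, hHΛ⟩ := hrange.resolve_left hpos.ne'
  have hH1 : (1 : ℝ) ≤ (mism S₁ S₂ m).card := by exact_mod_cast hpos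
  have hHn : ((mism S₁ S₂ m).card : ℝ) ≤ n := by exact_mod_cast card_mism_le S₁ S₂ m
  have hκH' : (κ : ℝ) ≤ 2 * (mism S₁ S₂ m).card := by exact_mod_cast hκH
  have hW1 := one_le_gaussMass (n := n) Δ
  have hcoll := pr_collisions_le hL he hT hΔ hΔW hK hpos hHΛ
  obtain ⟨W, hW⟩ : ∃ W, W = gaussMass n Δ := ⟨_, rfl⟩
  obtain ⟨H, hH⟩ : ∃ H : ℝ, H = (mism S₁ S₂ m).card := ⟨_, rfl⟩
  obtain ⟨E, hE⟩ : ∃ E : (ZMod n)ˣ → ℝ, E = fun a => (((2 * ⌊T * Δ⌋₊ + 1) *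
    collisions (mism S₁ S₂ m) (2 * ⌊T * Δ⌋₊) a : ℕ) : ℝ) := ⟨_, rfl⟩
  rw [← hW] at hW1 hΔW hcW ⊢
  rw [← hH] at hH1 hHn hκH'
  rw [← hW, ← hH] at hcoll
  set good : (estScheme n Γ B T c Δ).Ω → Prop := fun ω =>
    (∀ x ∈ mism S₁ S₂ m, ω.2 (S₁ x) ≠ ω.2 (S₂ (x + m))) ∧ E ω.1 < e / 4 * (H * W) with hgood
  have hq : 0 ≤ 1 / (2 ^ 8 * (L : ℝ)) := by positivity
  have hHW : 1 ≤ H * W := one_le_mul_of_one_le_of_one_le hH1 hW1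
  have hgoodpr : pr (fun ω => ¬ good ω) ≤ 1 / (2 ^ 8 * L) + 1 / (2 ^ 8 * L) := by
    have h1 := (pr_prod_snd (Ω := (ZMod n)ˣ) (fun h : Γ → Fin B → Bool =>
      ¬ ∀ x ∈ mism S₁ S₂ m, h (S₁ x) ≠ h (S₂ (x + m)))).trans_le
      ((pr_not_separated_le S₁ S₂ m).trans hB)
    have h2 := (pr_prod_fst (Ω' := Γ → Fin B → Bool)
      (fun a : (ZMod n)ˣ => e / 4 * (H * W) ≤ E a)).trans_le
      (le_trans (le_of_eq (by rw [hE])) hcoll)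
    refine (pr_mono fun ω hω => ?_).trans ((pr_or_le _ _).trans (add_le_add h1 h2))
    by_contra hcon
    push Not at hcon
    exact hω ⟨hcon.1, hcon.2⟩
  have htail : (n : ℝ) * (2 * (H * (1 / 2) ^ T) + 2 * readingError n T) ≤ e / 4 * (H * W) := by
    have h1 : (n : ℝ) * (2 * (H * (1 / 2) ^ T) + 2 * readingError n T) ≤
        n * (36 * n + 2 * T) * (1 / 2) ^ T := by
      rw [readingError]
      have h2 : (n : ℝ) * (2 * (H * (1 / 2) ^ T)) ≤ n * (2 * (n * (1 / 2) ^ T)) := by gcongr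
      linarith
    have h3 : 16 * n * ((n : ℝ) * (36 * n + 2 * T) * (1 / 2) ^ T) ≤ 1 := by
      refine le_trans (le_of_eq ?_) hsmall
      ring
    have h4 : (n : ℝ) * (36 * n + 2 * T) * (1 / 2) ^ T ≤ 1 / (16 * n) := by
      rw [le_div_iff₀ (by positivity), mul_comm]
      exact h3
    have h5 : 1 / (16 * (n : ℝ)) ≤ e / 4 := by
      refine le_trans (le_of_eq ?_) (div_le_div_of_nonneg_right he0 (by norm_num : (0 : ℝ) ≤ 4))
      field_simp
      norm_num
    calc _ ≤ e / 4 * 1 := by linarith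
      _ ≤ e / 4 * (H * W) := by gcongr
  have hsum : ∀ ω, good ω →
      |∑ u, (estScheme n Γ B T c Δ).X c S₁ S₂ m ω u - H * W| ≤ e / 2 * (H * W) := by
    intro ω hω
    have h1 := abs_sum_estScheme_X_sub_le hT hΔ hΔn hc hω.1
    have h2 := hω.2
    rw [hE] at h2
    rw [← hW, ← hH] at h1
    linarith
  have hs := LocalScheme.sample_pr_le (estScheme n Γ B T c Δ) (c := c) (cap := cap) hP hc0
    (by rw [hcap]; positivity) (S₁ := S₁) (S₂ := S₂) (m := m)
    (G := {x | |x - H * W| ≤ e * (H * W)}) (good := good) (q₁ := 1 / (2 ^ 8 * L))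
    (t := fun _ => e / 2 * (H * W)) hq hgoodpr hX0 hX1 (fun ω hω => by positivity)
    (fun ω hω x hx => by
      have h1 := abs_sub_le x (∑ u, (estScheme n Γ B T c Δ).X c S₁ S₂ m ω u) (H * W)
      have h2 := hsum ω hω
      change |x - H * W| ≤ e * (H * W)
      linarith)
    -- here `κ ≤ 2 * H` and `c ≤ 2 * W` bound the variance by a small multiple of the
    -- square of the allowed error
    (hPvar.imp_right fun hP2 ω hω => by
      have h1 := (abs_le.1 (hsum ω hω)).2
      have hs2 : ∑ u, (estScheme n Γ B T c Δ).X c S₁ S₂ m ω u ≤ 2 * (H * W) := by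
        have : e / 2 * (H * W) ≤ 1 * (H * W) := by gcongr; linarith
        linarith
      calc _ ≤ (P : ℝ) ^ 2 * (2 * (2 * W)) * (2 * (H * W)) := by
            refine mul_le_mul (by gcongr) hs2 (Finset.sum_nonneg fun u _ => hX0 ω u) (by positivity)
        _ = (P : ℝ) ^ 2 * (2 ^ 14 * L) * (H * W ^ 2 / (2 ^ 11 * L)) := by field_simp
        _ ≤ e ^ 2 * (2 * H) * (H * W ^ 2 / (2 ^ 11 * L)) := by
            refine mul_le_mul_of_nonneg_right (hP2.trans ?_) (by positivity)
            gcongr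
        _ = 1 / (2 ^ 8 * L) * (e / 2 * (H * W)) ^ 2 := by field_simp)
  refine (pr_mono fun ω hω => ?_).trans (hs.trans ?_)
  · exact fun hmem => hω fun _ => by rw [← hH]; exact hmem
  · have h1 := two_mul_div_capacity_le (C := n / c + 1) hP hL0
    rw [← hcap] at h1
    have h2 : 1 / (64 * (L : ℝ)) = 1 / (2 ^ 8 * L) + 1 / (2 ^ 8 * L) + (1 / (2 ^ 8 * L) +
        1 / (2 ^ 8 * L)) := by field_simp; norm_num
    rw [h2]
    linarith

end Estimator

/-! ### Parameters of the estimator -/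

/-- Rounding a positive real to a natural number that is at least `1`. -/
lemma exists_natCast_near (ρ : ℝ) (hρ : 0 < ρ) :
    ∃ P : ℕ, 0 < P ∧ (P = 1 ∨ (P : ℝ) ≤ ρ) ∧ ρ ≤ 2 * P := by
  rcases lt_or_ge ρ 1 with h | h
  · exact ⟨1, one_pos, Or.inl rfl, by push_cast; linarith⟩
  · have h1 := Nat.floor_le hρ.le
    have h2 := Nat.lt_floor_add_one ρ
    have h3 : 1 ≤ ⌊ρ⌋₊ := Nat.one_le_floor_iff ρ |>.2 h
    have h4 : (1 : ℝ) ≤ ⌊ρ⌋₊ := by exact_mod_cast h3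
    exact ⟨⌊ρ⌋₊, h3, Or.inr h1, by linarith⟩

section Cells

variable {n : ℕ} [NeZero n]

/-- The choice of the length of the cells for a Gaussian of width `Δ`. -/
lemma exists_cell_length {Δ : ℝ} (hΔ : 0 < Δ) (hΔn : 2 * Δ ≤ n) :
    ∃ c : ℕ, 0 < c ∧ (∀ v : ZMod n, ((v.val % c : ℕ) : ℝ) ≤ Δ) ∧ Δ ≤ 4 * gaussMass n Δ ∧
      (c : ℝ) ≤ 2 * gaussMass n Δ ∧ Δ ≤ 2 * c := by
  have hW := one_le_gaussMass (n := n) Δ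
  obtain ⟨c, hc0, hc1, hc2⟩ := exists_natCast_near Δ hΔ
  have hcW : (c : ℝ) ≤ 2 * gaussMass n Δ := by
    rcases hc1 with rfl | hc1
    · push_cast; linarith
    · have h1 : (2 : ℝ) * c ≤ n := by linarith
      have := div_two_le_gaussMass (n := n) hc1 (by exact_mod_cast h1)
      linarith
  refine ⟨c, hc0, fun v => ?_, by linarith, hcW, hc2⟩
  rcases hc1 with rfl | hc1
  · rw [Nat.mod_one]
    push_cast
    exact hΔ.le
  · have : ((v.val % c : ℕ) : ℝ) ≤ c := by exact_mod_cast (Nat.mod_lt _ hc0).le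
    linarith

end Cells

/-- With `T = 16 * L` coefficients and `B = 2 * L + 8` signings the messages about one cell have
`O(log ^ 3 n)` bits. -/
lemma card_estScheme_Msg_le {n : ℕ} [NeZero n] (Γ : Type) [Fintype Γ] {L : ℕ} (hL1 : 1 ≤ L)
    (hn : n ≤ 2 ^ L) (c : ℕ) (Δ : ℝ) :
    Fintype.card (estScheme n Γ (2 * L + 8) (16 * L) c Δ).Msg ≤ 2 ^ (2 ^ 12 * L ^ 3) := by
  change Fintype.card (Fin (2 * L + 8) → Fin (16 * L) →
    Finset.Icc (-(momentBound n (16 * L) : ℤ)) (momentBound n (16 * L))) ≤ _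
  rw [Fintype.card_fun, Fintype.card_fun, Fintype.card_coe, Int.card_Icc, Fintype.card_fin,
    Fintype.card_fin]
  have h1 : momentBound n (16 * L) ≤ 2 ^ (3 + 17 * L) := by
    calc 8 * n * 2 ^ (16 * L) ≤ 8 * 2 ^ L * 2 ^ (16 * L) := by gcongr
      _ = 2 ^ (3 + 17 * L) := by
        rw [pow_add, show 17 * L = L + 16 * L by ring, pow_add]
        ring
  have h2 : ((momentBound n (16 * L) : ℤ) + 1 - -(momentBound n (16 * L) : ℤ)).toNat ≤
      2 ^ (22 * L) := by
    have h3 : 2 ^ (3 + 17 * L) * 4 ≤ 2 ^ (22 * L) := by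
      rw [show 2 ^ (3 + 17 * L) * 4 = 2 ^ (5 + 17 * L) by
        rw [show 5 + 17 * L = 3 + 17 * L + 2 by ring, pow_add _ _ 2]; norm_num]
      exact Nat.pow_le_pow_right (by norm_num) (by omega)
    have h4 : 1 ≤ 2 ^ (3 + 17 * L) := Nat.one_le_two_pow
    omega
  calc _ ≤ ((2 ^ (22 * L)) ^ (16 * L)) ^ (2 * L + 8) := by gcongr
    _ = 2 ^ (22 * L * (16 * L) * (2 * L + 8)) := by rw [← pow_mul, ← pow_mul, ← mul_assoc]
    _ ≤ 2 ^ (2 ^ 12 * L ^ 3) := by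
      refine Nat.pow_le_pow_right (by norm_num) ?_
      calc 22 * L * (16 * L) * (2 * L + 8) ≤ 22 * L * (16 * L) * (2 * L + 8 * L) := by
            gcongr
            omega
        _ = 3520 * L ^ 3 := by ring
        _ ≤ 2 ^ 12 * L ^ 3 := by gcongr; norm_num

/-- With `16 * L` Taylor coefficients the finite precision is negligible. -/
lemma reading_tail_le {n L : ℕ} (hL1 : 1 ≤ L) (hn : n ≤ 2 ^ L) :
    16 * (n : ℝ) ^ 2 * (36 * n + 2 * (16 * L : ℕ)) * (1 / 2) ^ (16 * L) ≤ 1 := by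
  have h1 : 16 * n ^ 2 * (36 * n + 2 * (16 * L)) ≤ 2 ^ (16 * L) := by
    have hL2 : L ≤ 2 ^ L := Nat.lt_two_pow_self.le
    calc 16 * n ^ 2 * (36 * n + 2 * (16 * L))
        ≤ 16 * (2 ^ L) ^ 2 * (36 * 2 ^ L + 2 * (16 * 2 ^ L)) := by gcongr
      _ = 1088 * 2 ^ (3 * L) := by rw [show 3 * L = L * 3 by ring, pow_mul]; ring
      _ ≤ 2 ^ 11 * 2 ^ (3 * L) := by gcongr; norm_num
      _ = 2 ^ (11 + 3 * L) := by rw [pow_add]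
      _ ≤ 2 ^ (16 * L) := Nat.pow_le_pow_right (by norm_num) (by omega)
  have h2 : 16 * (n : ℝ) ^ 2 * (36 * n + 2 * (16 * L : ℕ)) ≤ 2 ^ (16 * L) := by exact_mod_cast h1
  rw [one_div, inv_pow, ← div_eq_mul_inv, div_le_one (by positivity)]
  exact h2

/-- With `2 * L + 8` signings all mismatches are likely to be seen by one of them. -/
lemma separation_tail_le {n L : ℕ} (hL1 : 1 ≤ L) (hn : n ≤ 2 ^ L) :
    (n : ℝ) / 2 ^ (2 * L + 8) ≤ 1 / (2 ^ 8 * L) := by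
  have hL2 : L ≤ 2 ^ L := Nat.lt_two_pow_self.le
  have h1 : n * (2 ^ 8 * L) ≤ 2 ^ (2 * L + 8) := by
    calc n * (2 ^ 8 * L) ≤ 2 ^ L * (2 ^ 8 * 2 ^ L) := by gcongr
      _ = 2 ^ (2 * L + 8) := by ring
  have hLr : (0 : ℝ) < L := by exact_mod_cast hL1
  rw [div_le_div_iff₀ (by positivity) (by positivity), one_mul]
  exact_mod_cast h1

/-- A protocol that estimates distances of order `κ`, up to a factor `Λ`, with relative error `e`. -/
theorem exists_estimator {n : ℕ} [NeZero n] (hn2 : 2 ≤ n) (Γ : Type) [Fintype Γ] {κ Λ : ℕ}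
    (hκ : 1 ≤ κ) (hκn : κ ≤ 2 * n) (hΛ : 1 ≤ Λ) {e : ℝ} (he0 : 1 / (4 * n) ≤ e) (he1 : e ≤ 1 / 4)
    {L : ℕ} (hL : L = Nat.log 2 n + 1) :
    ∃ (P : Protocol n Γ) (b : ℕ), P.HasBits b ∧ (b : ℝ) ≤ 2 ^ 32 * L ^ 5 * (n / (e * √κ)) ∧
      (b : ℝ) ≤ 2 ^ 56 * L ^ 9 * Λ * (√κ / e ^ 2) ∧
      P.Solves (fun H => {x | (H = 0 ∨ (κ ≤ 2 * H ∧ H ≤ Λ * κ)) → |x - H| ≤ e * H})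
        (1 / (64 * L)) := by
  have hL1 : 1 ≤ L := by omega
  have hn2L : n ≤ 2 ^ L := hL ▸ natCast_le_two_pow_log n
  have hLr : (1 : ℝ) ≤ L := by exact_mod_cast hL1
  have hn : (0 : ℝ) < n := by exact_mod_cast NeZero.pos n
  have hκr : (1 : ℝ) ≤ κ := by exact_mod_cast hκ
  have hΛr : (1 : ℝ) ≤ Λ := by exact_mod_cast hΛ
  have he : 0 < e := lt_of_lt_of_le (by positivity) he0
  -- the width `n / K` of the Gaussian, so small that pairs of mismatches at distance `T` widths cost a
  -- relative error of at most `e / 4`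
  obtain ⟨K, hK⟩ : ∃ K : ℝ, K = 2 ^ 24 * L ^ 4 * (Λ * κ) / e := ⟨_, rfl⟩
  have hKL : 2 ^ 24 * (L : ℝ) ≤ K := by
    have h1 : 1 ≤ (L : ℝ) ^ 3 := one_le_pow₀ hLr
    rw [hK, le_div_iff₀ he]
    calc 2 ^ 24 * (L : ℝ) * e ≤ 2 ^ 24 * (L : ℝ) * 1 := by gcongr; linarith
      _ ≤ 2 ^ 24 * (L : ℝ) * (L ^ 3 * (Λ * κ)) := by
          gcongr
          exact one_le_mul_of_one_le_of_one_le h1 (one_le_mul_of_one_le_of_one_le hΛr hκr)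
      _ = _ := by ring
  have hK0 : 0 < K := lt_of_lt_of_le (by positivity) hKL
  obtain ⟨Δ, hΔe⟩ : ∃ Δ : ℝ, Δ = n / K := ⟨_, rfl⟩
  have hΔ : 0 < Δ := by rw [hΔe]; positivity
  have hΔn : 4 * ((16 * L : ℕ) : ℝ) * Δ ≤ n := by
    rw [hΔe, ← mul_div_assoc, div_le_iff₀ hK0]
    push_cast
    calc 4 * (16 * (L : ℝ)) * n ≤ 2 ^ 24 * L * n := by
          refine mul_le_mul_of_nonneg_right ?_ hn.le
          linarith
      _ ≤ K * n := by gcongr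
      _ = n * K := mul_comm _ _
  have hΔn2 : 2 * Δ ≤ n := by
    refine le_trans ?_ hΔn
    push_cast
    gcongr
    linarith
  obtain ⟨c, hc0, hcmod, hΔW, hcW, hΔc⟩ := exists_cell_length (n := n) hΔ hΔn2
  -- the inverse sampling rate, about `e * √κ`; if this is below `1` then all cells are kept and there is
  -- no variance
  have hsL : 0 < √(L : ℝ) := Real.sqrt_pos.2 (by linarith)
  have hsκ : 0 < √(κ : ℝ) := Real.sqrt_pos.2 (by linarith)
  obtain ⟨P, hP, hP1, hP2⟩ := exists_natCast_near (e * √κ / (2 ^ 7 * √L)) (by positivity)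
  have hPr : (0 : ℝ) < P := by exact_mod_cast hP
  have hPvar : P = 1 ∨ (P : ℝ) ^ 2 * (2 ^ 14 * L) ≤ e ^ 2 * κ := by
    refine hP1.imp_right fun h => ?_
    rw [le_div_iff₀ (by positivity)] at h
    calc (P : ℝ) ^ 2 * (2 ^ 14 * L) = (P * (2 ^ 7 * √L)) ^ 2 := by
          rw [mul_pow, mul_pow, Real.sq_sqrt (by positivity)]; norm_num
      _ ≤ (e * √κ) ^ 2 := by gcongr
      _ = e ^ 2 * κ := by rw [mul_pow, Real.sq_sqrt (by positivity)]
  obtain ⟨cap, hcap⟩ : ∃ cap : ℕ, cap = 2 ^ 9 * L * ((n / c + 1) / P + 1) := ⟨_, rfl⟩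
  have hsol := estScheme_solves (Γ := Γ) (Λ := Λ) hL he0 he1 (by omega) hc0 hΔ hΔn hcmod hΔW hcW
    (le_of_eq (by rw [hΔe, hK]; push_cast; field_simp; norm_num)) (reading_tail_le hL1 hn2L) hP hPvar
    (separation_tail_le hL1 hn2L) hcap
  have hbits := LocalScheme.sample_hasBits (c := c) (cap := cap)
    (estScheme n Γ (2 * L + 8) (16 * L) c Δ) hP (card_estScheme_Msg_le Γ hL1 hn2L c Δ)
  have hW := one_le_gaussMass (n := n) Δ
  have hb : ((2 * cap * (2 ^ 12 * L ^ 3) : ℕ) : ℝ) ≤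
      2 ^ 22 * L ^ 4 * (((n / c : ℕ) + 1 : ℝ) * (2 ^ 8 * L / (e * √κ)) + 1) := by
    have h1 : (((n / c + 1) / P : ℕ) : ℝ) ≤ ((n / c : ℕ) + 1 : ℝ) / P := by
      refine Nat.cast_div_le.trans ?_
      push_cast
      exact le_rfl
    have h2 : 1 / (P : ℝ) ≤ 2 ^ 8 * L / (e * √κ) := by
      rw [div_le_div_iff₀ hPr (by positivity), one_mul]
      rw [div_le_iff₀ (by positivity)] at hP2
      have h3 : √(L : ℝ) ≤ L := Real.sqrt_le_self_iff.2 (Or.inr (by assumption))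
      calc e * √κ ≤ 2 * P * (2 ^ 7 * √L) := hP2
        _ ≤ 2 * P * (2 ^ 7 * L) := by gcongr
        _ = _ := by ring
    have h3 : (((n / c + 1) / P : ℕ) : ℝ) ≤ ((n / c : ℕ) + 1 : ℝ) * (2 ^ 8 * L / (e * √κ)) := by
      refine h1.trans ?_
      rw [div_eq_mul_one_div]
      gcongr
    rw [hcap]
    simp only [Nat.cast_mul, Nat.cast_add, Nat.cast_pow, Nat.cast_ofNat, Nat.cast_one] at h3 ⊢
    calc _ = 2 ^ 22 * (L : ℝ) ^ 4 * ((((n / c + 1) / P : ℕ) : ℝ) + 1) := by ring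
      _ ≤ _ := by gcongr
  refine ⟨Protocol.combine (fun _ : Unit => (estScheme n Γ (2 * L + 8) (16 * L) c Δ).sample c P cap hP)
    (fun x => x () / gaussMass n Δ), 2 * cap * (2 ^ 12 * L ^ 3), ?_, hb.trans ?_, hb.trans ?_, ?_⟩
  · have := Protocol.combine_hasBits (P := fun _ : Unit =>
      (estScheme n Γ (2 * L + 8) (16 * L) c Δ).sample c P cap hP) (fun x => x () / gaussMass n Δ)
      fun _ => hbits
    simpa using this
  · -- there are at most `n + 1` cells
    have h1 : ((n / c : ℕ) : ℝ) + 1 ≤ 2 * n := by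
      have h2 : ((n / c : ℕ) : ℝ) ≤ n := by exact_mod_cast Nat.div_le_self n c
      have h3 : (1 : ℝ) ≤ n := by exact_mod_cast NeZero.pos n
      linarith
    have h2 : 1 ≤ n / (e * √(κ : ℝ)) := by
      rw [le_div_iff₀ (by positivity), one_mul]
      have h3 : √(κ : ℝ) ≤ 2 * n := by
        refine le_trans (Real.sqrt_le_self_iff.2 (Or.inr (by assumption)) : √(κ : ℝ) ≤ κ) ?_
        exact_mod_cast hκn
      calc e * √κ ≤ 1 / 4 * (2 * n) := by gcongr
        _ ≤ n := by linarith
    calc _ ≤ 2 ^ 22 * (L : ℝ) ^ 4 * (2 * n * (2 ^ 8 * L / (e * √κ)) + L * (n / (e * √κ))) := by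
          gcongr
          exact one_le_mul_of_one_le_of_one_le hLr h2
      _ = (2 ^ 9 + 1) * 2 ^ 22 * L ^ 5 * (n / (e * √κ)) := by ring
      _ ≤ _ := by gcongr; norm_num
  · -- there are `O(K)` cells
    have h1 : ((n / c : ℕ) : ℝ) + 1 ≤ 3 * K := by
      have hcr : (0 : ℝ) < c := by exact_mod_cast hc0
      have h2 : ((n / c : ℕ) : ℝ) ≤ 2 * K := by
        refine Nat.cast_div_le.trans ?_
        rw [div_le_iff₀ hcr]
        rw [hΔe, div_le_iff₀ hK0] at hΔc
        linarith
      linarith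
    have hse : 1 ≤ √(κ : ℝ) / e ^ 2 := by
      rw [le_div_iff₀ (by positivity), one_mul]
      have h3 : 1 ≤ √(κ : ℝ) := Real.one_le_sqrt.2 hκr
      have h4 : e ^ 2 ≤ 1 := pow_le_one₀ he.le (by linarith)
      linarith
    have hfac : 3 * K * (2 ^ 8 * L / (e * √κ)) = 3 * 2 ^ 32 * L ^ 5 * Λ * (√κ / e ^ 2) := by
      have h5 : (κ : ℝ) = √κ * √κ := (Real.mul_self_sqrt (by positivity)).symm
      rw [hK]
      nth_rewrite 1 [h5]
      field_simp
    calc _ ≤ 2 ^ 22 * (L : ℝ) ^ 4 * (3 * K * (2 ^ 8 * L / (e * √κ)) +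
          L ^ 5 * Λ * (√κ / e ^ 2)) := by
          gcongr
          exact one_le_mul_of_one_le_of_one_le
            (one_le_mul_of_one_le_of_one_le (one_le_pow₀ hLr) hΛr) hse
      _ = (3 * 2 ^ 32 + 1) * 2 ^ 22 * L ^ 9 * Λ * (√κ / e ^ 2) := by rw [hfac]; ring
      _ ≤ _ := by gcongr; norm_num
  · have hfin := Protocol.combine_solves
      (P := fun _ : Unit => (estScheme n Γ (2 * L + 8) (16 * L) c Δ).sample c P cap hP)
      (g := fun x => x () / gaussMass n Δ)
      (Good' := fun H => {x | (H = 0 ∨ (κ ≤ 2 * H ∧ H ≤ Λ * κ)) → |x - H| ≤ e * H})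
      (fun _ => hsol) (fun H _ x hx h => by
        have h1 := hx () h
        have hW0 : 0 < gaussMass n Δ := by linarith
        have h2 : x () / gaussMass n Δ - H = (x () - H * gaussMass n Δ) / gaussMass n Δ := by
          field_simp
        rw [h2, abs_div, abs_of_pos hW0, div_le_iff₀ hW0]
        linarith)
    simpa using hfin

/-! ### Combining the scales -/

lemma gapRatio_le {L : ℕ} (hL1 : 1 ≤ L) : gapRatio L ≤ 2 ^ 50 * L ^ 7 := by
  have h1 : 1 ≤ L ^ 4 := Nat.one_le_pow _ _ hL1
  have h2 : gapJ L + 1 ≤ 2 ^ 24 * L ^ 4 := by rw [gapJ]; omega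
  calc gapRatio L ≤ 2 ^ 26 * L ^ 3 * (2 ^ 24 * L ^ 4) := Nat.mul_le_mul_left _ h2
    _ = _ := by ring

open Classical in
/-- The estimate at the least scale at which the gap test answers `0`, and `k` if there is none. -/
noncomputable def selectScale {s : ℕ} (k : ℝ) (x : Fin s × Bool → ℝ) : ℝ :=
  if h : (Finset.univ.filter fun i => x (i, false) = 0).Nonempty then
    x ((Finset.univ.filter fun i => x (i, false) = 0).min' h, true)
  else k

/-- If all gap tests and estimators answer correctly then the selected estimate is accurate: at the
least scale `κ` with answer `0` the distance is less than `Λ * κ` and, unless it is `0`, more than half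
of `κ`. -/
lemma selectScale_spec {s k H Λ : ℕ} (hs : k ≤ 2 ^ s) {e : ℝ} (he0 : 0 ≤ e) (he1 : e ≤ 1)
    {x : Fin (s + 1) × Bool → ℝ}
    (htest : ∀ i : Fin (s + 1), (H ≤ 2 ^ (i : ℕ) → x (i, false) = 0) ∧
      (Λ * 2 ^ (i : ℕ) ≤ H → x (i, false) ≠ 0))
    (hest : ∀ i : Fin (s + 1), (H = 0 ∨ (2 ^ (i : ℕ) ≤ 2 * H ∧ H ≤ Λ * 2 ^ (i : ℕ))) →
      |x (i, true) - H| ≤ e * H) :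
    (H ≤ k → |selectScale k x - H| ≤ e * H) ∧ (k < H → (1 - e) * k ≤ selectScale k x) := by
  classical
  rw [selectScale]
  split_ifs with hne
  · set i := (Finset.univ.filter fun i => x (i, false) = 0).min' hne with hi
    have h0 : x (i, false) = 0 :=
      (Finset.mem_filter.1 ((Finset.univ.filter fun i => x (i, false) = 0).min'_mem hne)).2
    have hlt : H < Λ * 2 ^ (i : ℕ) := by
      by_contra hcon
      exact (htest i).2 (not_lt.1 hcon) h0
    have key : |x (i, true) - H| ≤ e * H := by
      refine hest i ?_
      rcases Nat.eq_zero_or_pos H with hH | hH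
      · exact Or.inl hH
      refine Or.inr ⟨?_, hlt.le⟩
      rcases Nat.eq_zero_or_pos (i : ℕ) with hi0 | hi0
      · rw [hi0]; omega
      · by_contra hcon
        rw [not_le] at hcon
        set j : Fin (s + 1) := ⟨i - 1, by omega⟩ with hj
        have hpow : 2 ^ (i : ℕ) = 2 * 2 ^ (j : ℕ) := by
          rw [hj, ← pow_succ']
          congr 1
          simp only
          omega
        have hj0 : x (j, false) = 0 := (htest j).1 (by omega)
        have hle := (Finset.univ.filter fun i => x (i, false) = 0).min'_le j
          (Finset.mem_filter.2 ⟨Finset.mem_univ _, hj0⟩)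
        rw [← hi, Fin.le_def, hj] at hle
        simp only at hle
        omega
    refine ⟨fun _ => key, fun hk => ?_⟩
    have h1 := (abs_le.1 key).1
    have h2 : (k : ℝ) ≤ H := by exact_mod_cast hk.le
    have h3 : (1 - e) * k ≤ (1 - e) * H := mul_le_mul_of_nonneg_left h2 (by linarith)
    linarith
  · have hk : k < H := by
      by_contra hcon
      refine hne ⟨Fin.last s, Finset.mem_filter.2 ⟨Finset.mem_univ _, (htest _).1 ?_⟩⟩
      rw [Fin.val_last]
      omega
    refine ⟨fun h => absurd h (not_le.2 hk), fun _ => ?_⟩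
    have : (0 : ℝ) ≤ k := Nat.cast_nonneg k
    nlinarith

/-- A protocol for the approximate `k`-mismatch problem with constant failure probability. -/
theorem exists_mismatch_protocol {n : ℕ} [NeZero n] (hn2 : 2 ≤ n) (Γ : Type) [Fintype Γ] {k : ℕ}
    (hk1 : 1 ≤ k) (hkn : k ≤ n) {e : ℝ} (he0 : 1 / (4 * n) ≤ e) (he1 : e ≤ 1 / 4) {L : ℕ}
    (hL : L = Nat.log 2 n + 1) :
    ∃ (P : Protocol n Γ) (b : ℕ), P.HasBits b ∧ (b : ℝ) ≤ 2 ^ 109 * L ^ 17 * (√k / e ^ 2) ∧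
      (b : ℝ) ≤ 2 ^ 109 * L ^ 17 * √(n / e ^ 3) ∧
      P.Solves (fun H => {x | (H ≤ k → |x - H| ≤ e * H) ∧ (k < H → (1 - e) * k ≤ x)}) (1 / 16) := by
  have hL1 : 1 ≤ L := by omega
  have hn2L : n ≤ 2 ^ L := hL ▸ natCast_le_two_pow_log n
  have hLr : (1 : ℝ) ≤ L := by exact_mod_cast hL1
  have hn : (0 : ℝ) < n := by exact_mod_cast NeZero.pos n
  have he : 0 < e := lt_of_lt_of_le (by positivity) he0
  obtain ⟨s, hs1, hs2, hsL⟩ : ∃ s, k ≤ 2 ^ s ∧ 2 ^ s ≤ 2 * k ∧ s ≤ L := by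
    refine ⟨Nat.clog 2 k, Nat.le_pow_clog (by norm_num) k, ?_,
      Nat.clog_le_of_le_pow (hkn.trans hn2L)⟩
    rcases Nat.lt_or_ge 1 k with h | h
    · have h1 := Nat.pow_pred_clog_lt_self (b := 2) (by norm_num) h
      have h2 : 0 < Nat.clog 2 k := Nat.clog_pos (by norm_num) h
      obtain ⟨c, hc⟩ : ∃ c, Nat.clog 2 k = c + 1 := ⟨Nat.clog 2 k - 1, by omega⟩
      rw [hc] at h1 ⊢
      simp only [Nat.pred_succ] at h1
      rw [pow_succ]
      omega
    · have : k = 1 := by omega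
      subst this
      simp
  have hpow : ∀ i : Fin (s + 1), 2 ^ (i : ℕ) ≤ 2 * k := fun i =>
    (Nat.pow_le_pow_right (by norm_num) (by omega)).trans hs2
  obtain ⟨Λ, hΛ⟩ : ∃ Λ, Λ = gapRatio L := ⟨_, rfl⟩
  have hΛ1 : 1 ≤ Λ := by
    rw [hΛ, gapRatio]
    exact Nat.mul_pos (by positivity) (Nat.succ_pos _)
  choose Pt bt hbt hbt1 hPt using fun i : Fin (s + 1) =>
    exists_gap_test hn2 Γ (κ := 2 ^ (i : ℕ)) Nat.one_le_two_pow hL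
  choose Pe be hbe hbe1 hbe2 hPe using fun i : Fin (s + 1) =>
    exists_estimator hn2 Γ (κ := 2 ^ (i : ℕ)) Nat.one_le_two_pow ((hpow i).trans (by omega)) hΛ1
      he0 he1 hL
  have hΛr : (Λ : ℝ) ≤ 2 ^ 50 * L ^ 7 := by
    rw [hΛ]
    exact_mod_cast gapRatio_le hL1
  have hΛr1 : (1 : ℝ) ≤ Λ := by exact_mod_cast hΛ1
  have hsq : ∀ i : Fin (s + 1), √((2 ^ (i : ℕ) : ℕ) : ℝ) ≤ 2 * √k := by
    intro i
    have h1 : ((2 ^ (i : ℕ) : ℕ) : ℝ) ≤ 2 ^ 2 * k := by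
      have : ((2 ^ (i : ℕ) : ℕ) : ℝ) ≤ 2 * k := by exact_mod_cast hpow i
      linarith [Nat.cast_nonneg (α := ℝ) k]
    calc √((2 ^ (i : ℕ) : ℕ) : ℝ) ≤ √(2 ^ 2 * k) := Real.sqrt_le_sqrt h1
      _ = 2 * √k := by rw [Real.sqrt_mul (by norm_num), Real.sqrt_sq (by norm_num)]
  -- both bounds on the size of the estimators with the same factor
  obtain ⟨A, hA⟩ : ∃ A : ℝ, A = 2 ^ 106 * L ^ 16 := ⟨_, rfl⟩
  have hA0 : 0 < A := by rw [hA]; positivity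
  have hest1 : ∀ i, (be i : ℝ) ≤ A * (n / (e * √((2 ^ (i : ℕ) : ℕ) : ℝ))) := by
    intro i
    refine (hbe1 i).trans ?_
    have : 2 ^ 32 * (L : ℝ) ^ 5 ≤ A := by
      rw [hA]
      exact mul_le_mul (by norm_num) (pow_le_pow_right₀ hLr (by norm_num)) (by positivity)
        (by positivity)
    gcongr
  have hest2 : ∀ i, (be i : ℝ) ≤ A * (√((2 ^ (i : ℕ) : ℕ) : ℝ) / e ^ 2) := by
    intro i
    refine (hbe2 i).trans ?_
    have : 2 ^ 56 * (L : ℝ) ^ 9 * Λ ≤ A := by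
      calc 2 ^ 56 * (L : ℝ) ^ 9 * Λ ≤ 2 ^ 56 * L ^ 9 * (2 ^ 50 * L ^ 7) := by gcongr
        _ = A := by rw [hA]; ring
    gcongr
  -- the geometric mean of the two bounds does not depend on the scale
  have hest3 : ∀ i, (be i : ℝ) ≤ A * √(n / e ^ 3) := by
    intro i
    have hp : 0 < √((2 ^ (i : ℕ) : ℕ) : ℝ) := Real.sqrt_pos.2 (by positivity)
    rw [← Real.sqrt_sq hA0.le, ← Real.sqrt_mul (by positivity)]
    refine Real.le_sqrt_of_sq_le ?_
    calc (be i : ℝ) ^ 2 = be i * be i := sq _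
      _ ≤ A * (n / (e * √((2 ^ (i : ℕ) : ℕ) : ℝ))) * (A * (√((2 ^ (i : ℕ) : ℕ) : ℝ) / e ^ 2)) :=
          mul_le_mul (hest1 i) (hest2 i) (Nat.cast_nonneg _) (by positivity)
      _ = A ^ 2 * (n / e ^ 3) := by field_simp
  have htest : ∀ i, (bt i : ℝ) ≤ A * √k := by
    intro i
    calc (bt i : ℝ) ≤ 2 ^ 54 * L ^ 7 * (2 * √k) := (hbt1 i).trans (by gcongr; exact hsq i)
      _ = 2 ^ 55 * L ^ 7 * √k := by ring
      _ ≤ A * √k := by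
          rw [hA]
          refine mul_le_mul_of_nonneg_right ?_ (Real.sqrt_nonneg _)
          exact mul_le_mul (by norm_num) (pow_le_pow_right₀ hLr (by norm_num)) (by positivity)
            (by positivity)
  have hkn' : √(k : ℝ) ≤ √(n / e ^ 3) := by
    refine Real.sqrt_le_sqrt ?_
    rw [le_div_iff₀ (by positivity)]
    have h1 : (k : ℝ) ≤ n := by exact_mod_cast hkn
    have h2 : e ^ 3 ≤ 1 := pow_le_one₀ he.le (by linarith)
    calc (k : ℝ) * e ^ 3 ≤ n * 1 := by gcongr
      _ = n := mul_one _
  have hke : √(k : ℝ) ≤ √k / e ^ 2 := by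
    rw [le_div_iff₀ (by positivity)]
    exact mul_le_of_le_one_right (Real.sqrt_nonneg _) (pow_le_one₀ he.le (by linarith))
  have hsL' : ((s : ℝ) + 1) ≤ 2 * L := by
    have : (s : ℝ) ≤ L := by exact_mod_cast hsL
    linarith
  have htotal : ∀ z : ℝ, 0 ≤ z → (∀ i, (bt i : ℝ) + be i ≤ 4 * A * z) →
      ((∑ i, (bt i + be i) : ℕ) : ℝ) ≤ 2 ^ 109 * L ^ 17 * z := by
    intro z hz h
    push_cast
    calc ∑ i, ((bt i : ℝ) + be i) ≤ ∑ i : Fin (s + 1), 4 * A * z := Finset.sum_le_sum fun i _ => h i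
      _ = (s + 1) * (4 * A * z) := by simp
      _ ≤ 2 * L * (4 * A * z) := by gcongr
      _ = _ := by rw [hA]; ring
  refine ⟨Protocol.combine (fun p : Fin (s + 1) × Bool => if p.2 then Pe p.1 else Pt p.1)
    (selectScale k), ∑ i, (bt i + be i), ?_, htotal _ (by positivity) fun i => ?_,
    htotal _ (by positivity) fun i => ?_, ?_⟩
  · have := Protocol.combine_hasBits
      (P := fun p : Fin (s + 1) × Bool => if p.2 then Pe p.1 else Pt p.1) (selectScale k)
      (b := fun p => if p.2 then be p.1 else bt p.1) (by
        rintro ⟨i, b⟩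
        cases b
        · exact hbt i
        · exact hbe i)
    rw [Fintype.sum_prod_type] at this
    simpa [add_comm] using this
  · have h1 := htest i
    have h2 : (be i : ℝ) ≤ A * (2 * √k / e ^ 2) := (hest2 i).trans (by gcongr; exact hsq i)
    have h3 : A * √k ≤ A * (√k / e ^ 2) := by gcongr
    have h4 : 0 ≤ A * (√k / e ^ 2) := by positivity
    have h5 : A * (2 * √k / e ^ 2) = 2 * (A * (√k / e ^ 2)) := by ring
    linarith
  · have h1 := htest i
    have h2 := hest3 i
    have h3 : A * √k ≤ A * √(n / e ^ 3) := by gcongr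
    have h4 : 0 ≤ A * √(n / e ^ 3) := by positivity
    linarith
  · have := Protocol.combine_solves
      (P := fun p : Fin (s + 1) × Bool => if p.2 then Pe p.1 else Pt p.1) (g := selectScale k)
      (Good := fun p H => {x : ℝ | if p.2 then
          (H = 0 ∨ (2 ^ (p.1 : ℕ) ≤ 2 * H ∧ H ≤ Λ * 2 ^ (p.1 : ℕ))) → |x - H| ≤ e * H
        else (H ≤ 2 ^ (p.1 : ℕ) → x = 0) ∧ (Λ * 2 ^ (p.1 : ℕ) ≤ H → x ≠ 0)})
      (Good' := fun H => {x | (H ≤ k → |x - H| ≤ e * H) ∧ (k < H → (1 - e) * k ≤ x)})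
      (q := fun _ => 1 / (64 * L)) (by
        rintro ⟨i, b⟩
        cases b
        · have := hPt i
          rw [← hΛ] at this
          simpa using this
        · simpa using hPe i)
      (fun H _ x hx => selectScale_spec hs1 he.le (by linarith)
        (fun i => by simpa using hx (i, false)) (fun i => by simpa using hx (i, true)))
    intro S₁ S₂ m
    refine (this S₁ S₂ m).trans ?_
    rw [Finset.sum_const, Finset.card_univ, Fintype.card_prod, Fintype.card_fin, Fintype.card_bool,
      nsmul_eq_mul]
    push_cast
    rw [← mul_div_assoc, mul_one, div_le_div_iff₀ (by positivity) (by norm_num)]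
    linarith

lemma round_eq_of_abs_sub_lt {x : ℝ} {H : ℕ} (h : |x - H| ≤ 1 / 4) : round x = H := by
  have h1 := abs_le.1 h
  rw [round_eq, Int.floor_eq_iff]
  push_cast
  constructor <;> linarith

/-! ### The sketch -/

/-- A protocol for the approximate `k`-mismatch problem with failure probability at most `1 / n`. -/
theorem exists_amplified_protocol {n : ℕ} [NeZero n] (hn2 : 2 ≤ n) (Γ : Type) [Fintype Γ] {k : ℕ}
    (hk1 : 1 ≤ k) (hkn : k ≤ n) {ε : ℝ} (hε0 : 0 < ε) (hε1 : ε ≤ 1) {L : ℕ}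
    (hL : L = Nat.log 2 n + 1) :
    ∃ (P : Protocol n Γ) (b : ℕ), P.HasBits b ∧ (b : ℝ) ≤ 2 ^ 113 * L ^ 18 * (√k / ε ^ 2) ∧
      (b : ℝ) ≤ 2 ^ 113 * L ^ 18 * √(n / ε ^ 3) ∧
      P.Solves (fun H => if H ≤ k then Set.Icc ((1 - ε) * (H : ℝ)) ((1 + ε) * (H : ℝ))
        else Set.Ioi ((1 - ε) * (k : ℝ))) ((1 / 2) ^ L) := by
  classical
  have hn : (1 : ℝ) ≤ n := by exact_mod_cast NeZero.pos n
  have hn2' : (2 : ℝ) ≤ n := by exact_mod_cast hn2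
  have hk : (1 : ℝ) ≤ k := by exact_mod_cast hk1
  have hkn' : (k : ℝ) ≤ n := by exact_mod_cast hkn
  -- the factor `1 / 4` makes the lower bound strict for distances above `k`, and keeps the absolute
  -- error at most `1 / 4` if `ε < 1 / n`
  obtain ⟨e, he⟩ : ∃ e : ℝ, e = max ε (1 / n) / 4 := ⟨_, rfl⟩
  have heε : ε / 4 ≤ e := by rw [he]; gcongr; exact le_max_left _ _
  have hen : 1 / (4 * (n : ℝ)) ≤ e := by
    rw [he, one_div, mul_inv, mul_comm, ← div_eq_mul_inv, ← one_div]
    gcongr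
    exact le_max_right _ _
  have he1 : e ≤ 1 / 4 := by
    rw [he]
    gcongr
    exact max_le hε1 ((div_le_one (by linarith)).2 hn)
  have he0 : 0 < e := by linarith
  obtain ⟨P, b, hb, hb1, hb2, hP⟩ := exists_mismatch_protocol hn2 Γ hk1 hkn hen he1 hL
  set g : (Unit → ℝ) → ℝ := fun x => if ε < 1 / n then (round (x ()) : ℝ) else x () with hg
  -- if `ε < 1 / n` then the rounded estimate is the exact distance
  have hsol := Protocol.combine_solves (P := fun _ : Unit => P) (g := g)
    (Good' := fun H => if H ≤ k then Set.Icc ((1 - ε) * (H : ℝ)) ((1 + ε) * (H : ℝ))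
        else Set.Ioi ((1 - ε) * (k : ℝ))) (fun _ => hP) (by
      intro H hHn x hx
      obtain ⟨h1, h2⟩ := hx ()
      have hHn' : (H : ℝ) ≤ n := by exact_mod_cast hHn
      have hH0 : (0 : ℝ) ≤ H := Nat.cast_nonneg H
      rw [hg]
      simp only
      by_cases hsmall : ε < 1 / n
      · rw [if_pos hsmall]
        have hee : e = 1 / n / 4 := by rw [he, max_eq_right hsmall.le]
        by_cases hHk : H ≤ k
        · have h3 := h1 hHk
          have h4 : |x () - H| ≤ 1 / 4 := by
            refine h3.trans ?_
            rw [hee]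
            calc 1 / (n : ℝ) / 4 * H ≤ 1 / n / 4 * n := by gcongr
              _ = 1 / 4 := by field_simp
          rw [if_pos hHk, round_eq_of_abs_sub_lt h4]
          push_cast
          constructor <;> nlinarith
        · have h3 := h2 (by omega)
          have h4 : (k : ℝ) - 1 / 4 ≤ x () := by
            refine le_trans ?_ h3
            rw [hee]
            have : 1 / (n : ℝ) / 4 * k ≤ 1 / 4 := by
              calc 1 / (n : ℝ) / 4 * k ≤ 1 / n / 4 * n := by gcongr
                _ = 1 / 4 := by field_simp
            linarith
          have h5 : (k : ℤ) ≤ round (x ()) := by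
            rw [round_eq, Int.le_floor]
            push_cast
            linarith
          have h6 : (k : ℝ) ≤ round (x ()) := by exact_mod_cast h5
          rw [if_neg hHk, Set.mem_Ioi]
          nlinarith
      · rw [if_neg hsmall]
        have hee : e = ε / 4 := by rw [he, max_eq_left (not_lt.1 hsmall)]
        by_cases hHk : H ≤ k
        · have h3 := abs_le.1 (h1 hHk)
          rw [hee] at h3
          rw [if_pos hHk]
          have := mul_nonneg hε0.le hH0
          constructor <;> linarith
        · have h3 := h2 (by omega)
          rw [hee] at h3
          rw [if_neg hHk, Set.mem_Ioi]
          have := mul_pos hε0 (by linarith : (0 : ℝ) < k)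
          linarith)
  have hsol' : (Protocol.combine (fun _ : Unit => P) g).Solves
      (fun H => if H ≤ k then Set.Icc ((1 - ε) * (H : ℝ)) ((1 + ε) * (H : ℝ))
        else Set.Ioi ((1 - ε) * (k : ℝ))) (1 / 16) := by simpa using hsol
  have hamp := Protocol.amplify hsol' (fun H => by
    split_ifs
    · exact Set.ordConnected_Icc
    · exact Set.ordConnected_Ioi) (show 0 < L by omega)
  have hL0 : (0 : ℝ) ≤ L := Nat.cast_nonneg L
  have hA0 : (0 : ℝ) ≤ 2 ^ 109 * (L : ℝ) ^ 17 :=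
    mul_nonneg (pow_nonneg zero_le_two _) (pow_nonneg hL0 _)
  refine ⟨_, L * b, ?_, ?_, ?_, hamp⟩
  · have h1 := Protocol.combine_hasBits (P := fun _ : Unit => P) g fun _ => hb
    have h2 := Protocol.combine_hasBits
      (P := fun _ : Fin L => Protocol.combine (fun _ : Unit => P) g) median fun _ => h1
    simpa using h2
  · push_cast
    have h1 : √(k : ℝ) / e ^ 2 ≤ √k / (ε / 4) ^ 2 := by gcongr
    calc (L : ℝ) * b ≤ L * (2 ^ 109 * L ^ 17 * (√k / (ε / 4) ^ 2)) :=
          mul_le_mul_of_nonneg_left (hb1.trans (mul_le_mul_of_nonneg_left h1 hA0)) hL0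
      _ = _ := by field_simp; norm_num
  · push_cast
    have h1 : √(n / e ^ 3) ≤ 8 * √(n / ε ^ 3) := by
      calc √(n / e ^ 3) ≤ √(n / (ε / 4) ^ 3) := Real.sqrt_le_sqrt (by gcongr)
        _ = √(8 ^ 2 * (n / ε ^ 3)) := by congr 1; field_simp; norm_num
        _ = 8 * √(n / ε ^ 3) := by rw [Real.sqrt_mul (by norm_num), Real.sqrt_sq (by norm_num)]
    have h0 : 0 ≤ (L : ℝ) ^ 18 * √(n / ε ^ 3) := by positivity
    calc (L : ℝ) * b ≤ L * (2 ^ 109 * L ^ 17 * (8 * √(n / ε ^ 3))) :=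
          mul_le_mul_of_nonneg_left (hb2.trans (mul_le_mul_of_nonneg_left h1 hA0)) hL0
      _ = 2 ^ 112 * (L ^ 18 * √(n / ε ^ 3)) := by ring
      _ ≤ 2 ^ 113 * (L ^ 18 * √(n / ε ^ 3)) := by gcongr <;> norm_num
      _ = _ := by ring

lemma log_two_add_one_le {n : ℕ} (hn2 : 2 ≤ n) : ((Nat.log 2 n + 1 : ℕ) : ℝ) ≤ 3 * Real.log n := by
  have h2 := Real.log_two_gt_d9
  have h3 : Real.log 2 ≤ Real.log n := Real.log_le_log (by norm_num) (by exact_mod_cast hn2)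
  have h4 : (Nat.log 2 n : ℝ) * Real.log 2 ≤ Real.log n := by
    rw [← Real.log_pow]
    refine Real.log_le_log (by positivity) ?_
    exact_mod_cast Nat.pow_log_le_self 2 (by omega)
  have h5 : (0 : ℝ) ≤ Nat.log 2 n := Nat.cast_nonneg _
  push_cast
  nlinarith

theorem mainTheorem2 :
    ∃ (c C : ℝ) (D : ℕ), 0 < c ∧ 0 < C ∧
      ∀ (σ n k : ℕ) (ε : ℝ), 1 ≤ k → k ≤ n → 0 < ε →
        ∃ K : CircularSketch σ n,
          K.IsApprox ε k (1 - (n : ℝ) ^ (-c)) ∧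
          K.HasSize
            (C * Real.log n ^ D *
              min (ε ^ (-2 : ℝ) * Real.sqrt k) (ε ^ (-(3 / 2) : ℝ) * Real.sqrt n))
            (1 - (n : ℝ) ^ (-c)) := by
  refine ⟨1, 2 ^ 113 * 3 ^ 18, 18, one_pos, by positivity, ?_⟩
  intro σ n k ε hk1 hkn hε
  have hn : 1 ≤ n := hk1.trans hkn
  have : NeZero n := ⟨by omega⟩
  have hnr : (1 : ℝ) ≤ n := by exact_mod_cast hn
  have hlog : 0 ≤ Real.log n := Real.log_nonneg hnr
  have hsize : 0 ≤ 2 ^ 113 * 3 ^ 18 * Real.log n ^ 18 *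
      min (ε ^ (-2 : ℝ) * Real.sqrt k) (ε ^ (-(3 / 2) : ℝ) * Real.sqrt n) := by positivity
  have hq : 0 ≤ (n : ℝ) ^ (-1 : ℝ) := by positivity
  obtain ⟨Z, hZb, hZ⟩ := exists_zero_protocol n (Fin σ)
  rcases Nat.lt_or_ge 1 n with hn2 | hn1
  swap
  · -- for `n = 1` the required probability is `0`
    have h1 : n = 1 := le_antisymm hn1 hn
    have h2 : 1 - (n : ℝ) ^ (-1 : ℝ) = 0 := by rw [h1]; simp
    rw [h2]
    exact ⟨Z.toSketch hZb, fun _ _ _ => ENNReal.toReal_nonneg, fun _ => ENNReal.toReal_nonneg⟩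
  rcases lt_or_ge 1 ε with hε1 | hε1
  · -- for `1 < ε` the answer `0` is always acceptable
    refine Z.exists_sketch hZb (by push_cast; exact hsize) hq fun S₁ S₂ m => ?_
    refine (pr_eq_zero fun ω => not_not.2 ?_).trans_le hq
    rw [hZ]
    have hH : (0 : ℝ) ≤ (mism S₁ S₂ m).card := Nat.cast_nonneg _
    have hk : (1 : ℝ) ≤ k := by exact_mod_cast hk1
    by_cases hHk : (mism S₁ S₂ m).card ≤ k
    · simp only [if_pos hHk]
      constructor <;> nlinarith
    · simp only [if_neg hHk, Set.mem_Ioi]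
      nlinarith
  obtain ⟨L, hL⟩ : ∃ L, L = Nat.log 2 n + 1 := ⟨_, rfl⟩
  obtain ⟨P, b, hb, hb1, hb2, hP⟩ := exists_amplified_protocol hn2 (Fin σ) hk1 hkn hε hε1 hL
  refine P.exists_sketch hb ?_ hq fun S₁ S₂ m => (hP S₁ S₂ m).trans ?_
  · have hLn : (L : ℝ) ≤ 3 * Real.log n := hL ▸ log_two_add_one_le hn2
    have hfac : 2 ^ 113 * (L : ℝ) ^ 18 ≤ 2 ^ 113 * 3 ^ 18 * Real.log n ^ 18 := by
      calc 2 ^ 113 * (L : ℝ) ^ 18 ≤ 2 ^ 113 * (3 * Real.log n) ^ 18 := by gcongr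
        _ = _ := by rw [mul_pow]; ring
    have e1 : √(k : ℝ) / ε ^ 2 = ε ^ (-2 : ℝ) * Real.sqrt k := by
      rw [Real.rpow_neg hε.le, div_eq_inv_mul]
      norm_cast
    have e2 : √(n / ε ^ 3) = ε ^ (-(3 / 2) : ℝ) * Real.sqrt n := by
      rw [Real.sqrt_div (by positivity), Real.rpow_neg hε.le, div_eq_inv_mul]
      congr 2
      rw [Real.sqrt_eq_rpow, ← Real.rpow_natCast, ← Real.rpow_mul hε.le]
      norm_num
    rcases min_choice (ε ^ (-2 : ℝ) * Real.sqrt k) (ε ^ (-(3 / 2) : ℝ) * Real.sqrt n) with h | h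
    · rw [h, ← e1]
      exact hb1.trans (by gcongr)
    · rw [h, ← e2]
      exact hb2.trans (by gcongr)
  · rw [Real.rpow_neg_one, one_div, inv_pow]
    refine inv_anti₀ (by linarith) ?_
    exact_mod_cast hL ▸ natCast_le_two_pow_log n
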